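/- **Setting.** Let $b\in\{0,1\}^n$ have exactly $k$ nonzero entries, $0<k<n$, put $s=k/n$, let $T\ge 1$ be an integer and $$L_{opt}=\Big\lceil -\frac{T+2}{2\log(1-s)}\Big\rceil .$$ Let $w_1,\dots,w_D$ be real weights with $\sum_a v_a w_a\neq 0$ for every nonzero $v\in\{-1,0,1\}^D$, and assume $L_{opt}\le n$ and $L_{opt}\le D$. Rows of a measurement matrix $G$ with $n$ columns are generated one after the other: each row selects $L_{opt}$ columns among those with the currently smallest number of nonzero entries (ties broken uniformly at random), and puts there $L_{opt}$ weights drawn at random without repetition; the other entries are $0$. The measurements are $c=Gb$. The sum verification decoder with parameter $T$ repeats the following: find a row that still has unverified columns in its support and whose measurement, after the contribution of the verified columns has been subtracted, is a sum of at most $T$ of the weights; find a set $A$ of at most $T$ unverified columns of its support whose entries in the row add up to that value; set $b_j=1$ for $j\in A$, $b_j=0$ for the other unverified columns $j$ of its support, and declare all of these verified. It halts when there is no such row, and reconstructs $b$ if then all columns are verified with the right values. Let $m$ be the (random) minimum number of rows with which the decoder completely reconstructs $b$. **Lemma.** $m=\mathcal O(-n\log(1-s))$. Precisely: there is an absolute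 constant $C>0$ such that for every $T\ge1$ and all $n,k,b,w$ as above $$m\ \ge\ \frac{n}{L_{opt}}\quad\text{always, and}\quad \mathbb E[m]\ \le\ C\cdot\frac{-2n\log(1-s)}{T+2};$$ moreover, for every $T\ge 1$ and $\varepsilon>0$ there is $K$ such that, for all $n,k,b,w$ as above with $k\ge K$, $$\Pr\Big[m> C\cdot\frac{-2n\log(1-s)}{T+2}\Big]\le\varepsilon .$$ -/

import Mathlib

open MeasureTheory
open scoped ENNReal

noncomputable section

namespace AFCS

/-! ### Weights, signals and the measurement degree -/

/-- A weight family `w₁, …, w_D` is *uniquely decodable* if no nontrivial combination of the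
weights with coefficients in `{-1, 0, 1}` vanishes. In particular the weights are nonzero and
distinct. -/
def UniquelyDecodable {D : ℕ} (w : Fin D → ℝ) : Prop :=
  ∀ v : Fin D → ℝ, (∀ a, v a = -1 ∨ v a = 0 ∨ v a = 1) → v ≠ 0 → ∑ a, v a * w a ≠ 0

/-- `b` is a binary signal of length `n` with exactly `k` nonzero entries. -/
def IsBinarySignal {n : ℕ} (k : ℕ) (b : Fin n → ℝ) : Prop :=
  (∀ j, b j = 0 ∨ b j = 1) ∧ (Finset.univ.filter fun j => b j ≠ 0).card = k

/-- The measurement degree `L_opt = ⌈-(T+2) / (2 log (1-s))⌉`. -/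
def optDegree (T : ℕ) (s : ℝ) : ℕ := ⌈-((T : ℝ) + 2) / (2 * Real.log (1 - s))⌉₊

/-! ### The random measurement matrix

The rows are generated one after the other. Row `i` uses a fresh seed, consisting of a uniformly
random permutation of the variable nodes and an independent uniformly random permutation of the
weight indices. The `L` variable nodes with the currently smallest degrees are selected, ties
being broken by the first permutation; so, given the earlier rows, the selected set is uniformly
distributed among all `L`-sets of variable nodes of smallest degree. The selected nodes receive
the first `L` entries of the randomly permuted weight list, that is, weights drawn at random
without repetition. -/

/-- The randomness used for one row: a tie-breaking order and a shuffling of the weights. -/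
abbrev RowSeed (n D : ℕ) : Type := Equiv.Perm (Fin n) × Equiv.Perm (Fin D)

/-- The sample space: one seed for each row. -/
abbrev Sample (n D : ℕ) : Type := ℕ → RowSeed n D

/-- Seeds form a finite discrete space. -/
instance (n D : ℕ) : MeasurableSpace (RowSeed n D) := ⊤

/-- The law of the seeds: independent and uniformly distributed. -/
def seedLaw (n D : ℕ) : Measure (Sample n D) :=
  Measure.infinitePi fun _ : ℕ => (PMF.uniformOfFintype (RowSeed n D)).toMeasure

/-- The number of variable nodes that come before `j` when the variable nodes are sorted by their
current degrees, ties being broken by the permutation `π`. -/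
def rank {n : ℕ} (deg : Fin n → ℕ) (π : Equiv.Perm (Fin n)) (j : Fin n) : ℕ :=
  (Finset.univ.filter fun j' => deg j' < deg j ∨ (deg j' = deg j ∧ π j' < π j)).card

/-- The degrees of the variable nodes after the first `i` rows have been generated. -/
def degrees {n D : ℕ} (L : ℕ) (ω : Sample n D) : ℕ → Fin n → ℕ
  | 0 => fun _ => 0
  | i + 1 => fun j =>
      degrees L ω i j + if rank (degrees L ω i) (ω i).1 j < L then 1 else 0

/-- The measurement matrix formed by the first `m` rows. -/
def measurementMatrix {n D L : ℕ} (w : Fin D → ℝ) (hLD : L ≤ D) (ω : Sample n D) (m : ℕ) :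
    Matrix (Fin m) (Fin n) ℝ :=
  Matrix.of fun i j =>
    if h : rank (degrees L ω i) (ω i).1 j < L then w ((ω i).2 ⟨_, h.trans_le hLD⟩) else 0

/-! ### The sum verification decoder -/

/-- A state of the decoder: the variable nodes verified so far (the edges at these have been
removed) and the current estimate of the signal. -/
@[ext] structure DecoderState (n : ℕ) where
  verified : Finset (Fin n)
  est : Fin n → ℝ

/-- Initially nothing is verified and the estimate is zero. -/
def initialState (n : ℕ) : DecoderState n := ⟨∅, 0⟩

/-- The variable nodes still connected to check node `i`. -/
def nbrs {m n : ℕ} (G : Matrix (Fin m) (Fin n) ℝ) (σ : DecoderState n) (i : Fin m) :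
    Finset (Fin n) :=
  Finset.univ.filter fun j => G i j ≠ 0 ∧ j ∉ σ.verified

/-- The value of measurement `i` after the contribution of the verified nodes is subtracted. -/
def residualValue {m n : ℕ} (G : Matrix (Fin m) (Fin n) ℝ) (c : Fin m → ℝ) (σ : DecoderState n)
    (i : Fin m) : ℝ :=
  c i - ∑ j ∈ σ.verified, G i j * σ.est j

/-- One iteration of the decoder with parameter `T`: a measurement `i` that still has an edge and
whose value is a sum of at most `T` members of the weight list is found; a set `A` of at most `T`
of its remaining neighbours whose edge weights sum to this value is found; the nodes of `A` are set
to `1`, the other remaining neighbours to `0`, and all of them are verified. -/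
def Step {m n D : ℕ} (T : ℕ) (w : Fin D → ℝ) (G : Matrix (Fin m) (Fin n) ℝ) (c : Fin m → ℝ)
    (σ σ' : DecoderState n) : Prop :=
  ∃ i : Fin m, (nbrs G σ i).Nonempty ∧
    (∃ B : Finset (Fin D), B.card ≤ T ∧ ∑ a ∈ B, w a = residualValue G c σ i) ∧
    ∃ A : Finset (Fin n), A ⊆ nbrs G σ i ∧ A.card ≤ T ∧ ∑ j ∈ A, G i j = residualValue G c σ i ∧
      σ'.verified = σ.verified ∪ nbrs G σ i ∧
      σ'.est = fun j => if j ∈ nbrs G σ i then (if j ∈ A then 1 else 0) else σ.est j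

/-- The decoder completely reconstructs `b` from the measurements `G b`: whatever admissible choices
it makes, when it halts all variable nodes are verified and the estimate is `b`. (Each iteration
verifies a new node, so that the decoder always halts.) -/
def Reconstructs {m n D : ℕ} (T : ℕ) (w : Fin D → ℝ) (G : Matrix (Fin m) (Fin n) ℝ)
    (b : Fin n → ℝ) : Prop :=
  ∀ σ : DecoderState n, Relation.ReflTransGen (Step T w G (G.mulVec b)) (initialState n) σ →
    (∀ σ', ¬ Step T w G (G.mulVec b) σ σ') → σ.verified = Finset.univ ∧ σ.est = b

/-- The minimum number of measurements with which the decoder completely reconstructs `b`, as a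
function of the randomness; it is `⊤` if no number suffices. -/
def minMeasurements {n D L : ℕ} (T : ℕ) (w : Fin D → ℝ) (hLD : L ≤ D) (b : Fin n → ℝ)
    (ω : Sample n D) : ℕ∞ :=
  ⨅ (m : ℕ) (_ : Reconstructs T w (measurementMatrix w hLD ω m) b), (m : ℕ∞)

end AFCS

end

/-!
The supports of the rows determine the decoding. Let `K` be the set of nonzero columns of the
signal. By unique decodability, the value of a check node is a sum of at most `T` weights exactly
if at most `T` unverified columns of `K` are in its row, and the decoder then finds these columns;
so all verified values are correct, and the decoder completes unless some column is in no row or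
some nonempty `S ⊆ K` is a stopping set, which each row meets not at all or in more than `T`
columns (`reconstructs_of_no_stopping`). Each column must be in some row, and a row has `L` columns,
which is the lower bound (`div_le_minMeasurements`).

Degrees of columns differ by at most one at any time. Given the earlier rows, a row is either a
uniformly distributed `L`-subset of the columns of smallest degree, or consists of all of these and
of a uniformly distributed set of the others (`rowAvg_of_lt`, `rowAvg_of_le`),
which reduces conditional probabilities to averages over the subsets of a finite set. The choice of
`L` enters only through `4 (L - 1) k < (T + 2) (2 n - k)` (`admissible_optDegree`), that is, a row
contains at most about `T / 2` nonzero columns in the mean. If `L ≤ T` or `k ≤ T` there are no stopping sets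
once all columns are covered. Otherwise it is shown that the probability that there is a stopping
set after `e * B * n / L` rows decays geometrically in `e`, at an absolute rate
(`exists_measure_stuck_le`); summation bounds the expectation, since
`n / L ≤ -2 n log (1 - s) / (T + 2)`.

If `20 L ≤ n`, small and large stopping sets are treated separately. For a fixed set `S`, an
exponential potential which counts the elements of `S` of smallest degree gives a bound for the
probability that `S` is a stopping set (`measure_stopping_le`); a union bound over all small `S`
then gives a bound of the order of `L / n`. A large stopping set consists of columns of `K` that
are unresolved: each row that contains one of them contains more than `T` elements of `K`. A row
that contains `j ∈ K` has at most `T` elements in `K` with a probability that is bounded from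
below, so that an unresolved column survives until the smallest degree is `d` with a probability
that is exponentially small in `d`, and `l` given columns do so nearly independently
(`measure_unresolved_le`). The first moment of the number of unresolved columns suffices for the
expectation, and a high factorial moment for the bound in probability
(`measure_card_unresolvedSet_le`).

If `n < 20 L`, then `k` is of the order of `T`, and it suffices to find, within a bounded number of
rows, two consecutive ones that resolve a given column with a probability that is bounded from
below (`exists_window`, `exists_measure_unresolved_le`). Markov's inequality does this for large
`T`. For small `T` the number of nonzero columns is bounded, and a row that avoids all but one of
them has a probability that is bounded from below; for small `n` it is enough that some suitable
row exists.
-/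

noncomputable section

namespace AFCS

/-! ### The columns selected by a row -/

/-- The columns selected by a row when the current degrees are `deg` and ties are broken by `π`. -/
def selected {n : ℕ} (L : ℕ) (deg : Fin n → ℕ) (π : Equiv.Perm (Fin n)) : Finset (Fin n) :=
  Finset.univ.filter fun j => rank deg π j < L

/-- The support of row `i` of the measurement matrix. -/
def rowSupport {n D : ℕ} (L : ℕ) (ω : Sample n D) (i : ℕ) : Finset (Fin n) :=
  selected L (degrees L ω i) (ω i).1

theorem rank_lt_rank {n : ℕ} {deg : Fin n → ℕ} {π : Equiv.Perm (Fin n)} {a b : Fin n}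
    (h : deg a < deg b ∨ (deg a = deg b ∧ π a < π b)) : rank deg π a < rank deg π b := by
  unfold rank
  apply Finset.card_lt_card
  rw [Finset.ssubset_iff_of_subset]
  · refine ⟨a, by simpa using h, by simp⟩
  · intro c hc
    simp only [Finset.mem_filter, Finset.mem_univ, true_and] at hc ⊢
    rcases h with h | ⟨h, h'⟩ <;> rcases hc with hc | ⟨hc, hc'⟩
    · left; omega
    · left; omega
    · left; omega
    · right; exact ⟨by omega, hc'.trans h'⟩

theorem rank_injective {n : ℕ} (deg : Fin n → ℕ) (π : Equiv.Perm (Fin n)) :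
    Function.Injective (rank deg π) := by
  intro a b hab
  by_contra hne
  have hπ : π a ≠ π b := fun h => hne (π.injective h)
  rcases lt_trichotomy (deg a) (deg b) with h | h | h
  · exact absurd hab (rank_lt_rank (Or.inl h)).ne
  · rcases lt_or_gt_of_ne hπ with h' | h'
    · exact absurd hab (rank_lt_rank (Or.inr ⟨h, h'⟩)).ne
    · exact absurd hab (rank_lt_rank (Or.inr ⟨h.symm, h'⟩)).ne'
  · exact absurd hab (rank_lt_rank (Or.inl h)).ne'

theorem rank_lt {n : ℕ} (deg : Fin n → ℕ) (π : Equiv.Perm (Fin n)) (j : Fin n) :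
    rank deg π j < n := by
  unfold rank
  calc _ < (Finset.univ : Finset (Fin n)).card := by
        apply Finset.card_lt_card
        rw [Finset.ssubset_univ_iff]
        intro h
        have := Finset.mem_univ j
        rw [← h] at this
        simp at this
    _ = n := by simp

theorem card_selected {n L : ℕ} (hL : L ≤ n) (deg : Fin n → ℕ) (π : Equiv.Perm (Fin n)) :
    (selected L deg π).card = L := by
  let r : Fin n → Fin n := fun j => ⟨rank deg π j, rank_lt deg π j⟩
  have hr : Function.Bijective r := by
    apply Finite.injective_iff_bijective.1
    intro a b hab
    exact rank_injective deg π (by simpa [r] using hab)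
  have h1 : (selected L deg π).card = (Finset.univ.filter fun a : Fin n => (a : ℕ) < L).card := by
    apply Finset.card_bij (fun j _ => r j)
    · intro a ha
      simpa [selected, r] using ha
    · intro a _ b _ h
      exact hr.1 h
    · intro b hb
      obtain ⟨a, rfl⟩ := hr.2 b
      exact ⟨a, by simpa [selected, r] using hb, rfl⟩
  rw [h1, Fin.card_filter_val_lt]
  exact min_eq_right hL

theorem selected_subset {n L c : ℕ} {deg : Fin n → ℕ}
    (hC : L ≤ (Finset.univ.filter fun j => deg j ≤ c).card) (π : Equiv.Perm (Fin n)) :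
    selected L deg π ⊆ Finset.univ.filter fun j => deg j ≤ c := by
  intro j hj
  simp only [selected, Finset.mem_filter, Finset.mem_univ, true_and] at hj ⊢
  by_contra hlt
  push Not at hlt
  have : (Finset.univ.filter fun j => deg j ≤ c).card ≤ rank deg π j := by
    unfold rank
    apply Finset.card_le_card
    intro a ha
    simp only [Finset.mem_filter, Finset.mem_univ, true_and] at ha ⊢
    left; omega
  omega

theorem subset_selected {n L c : ℕ} {deg : Fin n → ℕ}
    (hB : (Finset.univ.filter fun j => deg j < c).card ≤ L) (π : Equiv.Perm (Fin n)) :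
    (Finset.univ.filter fun j => deg j < c) ⊆ selected L deg π := by
  intro j hj
  simp only [selected, Finset.mem_filter, Finset.mem_univ, true_and] at hj ⊢
  refine lt_of_lt_of_le ?_ hB
  unfold rank
  apply Finset.card_lt_card
  rw [Finset.ssubset_iff_of_subset]
  · exact ⟨j, by simpa using hj, by simp⟩
  · intro a ha
    simp only [Finset.mem_filter, Finset.mem_univ, true_and] at ha ⊢
    omega

theorem degrees_succ {n D : ℕ} (L : ℕ) (ω : Sample n D) (i : ℕ) (j : Fin n) :
    degrees L ω (i + 1) j = degrees L ω i j + if j ∈ rowSupport L ω i then 1 else 0 := by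
  simp [degrees, rowSupport, selected]

/-! ### Stopping sets and the decoder -/

/-- The columns on which the signal does not vanish. -/
def support {n : ℕ} (b : Fin n → ℝ) : Finset (Fin n) := Finset.univ.filter fun j => b j ≠ 0

/-- `S` is a stopping set of the rows before `m`: each of these rows meets `S` not at all or in
more than `T` columns. -/
def Stopping {n D : ℕ} (T L : ℕ) (ω : Sample n D) (m : ℕ) (S : Finset (Fin n)) : Prop :=
  ∀ i < m, (rowSupport L ω i ∩ S).card = 0 ∨ T < (rowSupport L ω i ∩ S).card

theorem UniquelyDecodable.ne_zero {D : ℕ} {w : Fin D → ℝ} (hw : UniquelyDecodable w) (a : Fin D) :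
    w a ≠ 0 := by
  have := hw (Pi.single a 1) (by
    intro c
    by_cases h : c = a
    · subst h; simp
    · simp [h]) (by
    intro h
    have := congrFun h a
    simp at this)
  simpa [Pi.single_apply] using this

/-- Distinct sets of weights have distinct sums. -/
theorem UniquelyDecodable.sum_inj {D : ℕ} {w : Fin D → ℝ} (hw : UniquelyDecodable w)
    {A B : Finset (Fin D)} (h : ∑ a ∈ A, w a = ∑ a ∈ B, w a) : A = B := by
  classical
  by_contra hne
  let v : Fin D → ℝ := fun a => (if a ∈ A then 1 else 0) - (if a ∈ B then 1 else 0)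
  refine hw v ?_ ?_ ?_
  · intro a
    by_cases h1 : a ∈ A <;> by_cases h2 : a ∈ B <;> simp [v, h1, h2]
  · intro hv
    apply hne
    ext a
    have h0 : v a = 0 := congrFun hv a
    by_cases h1 : a ∈ A <;> by_cases h2 : a ∈ B <;> simp [v, h1, h2] at h0 ⊢
  · simp only [v, sub_mul, Finset.sum_sub_distrib, ite_mul, one_mul, zero_mul,
      Finset.sum_ite_mem, Finset.univ_inter]
    rw [h, sub_self]

section Decoder

variable {n D L m T : ℕ} {w : Fin D → ℝ} {hLD : L ≤ D} {ω : Sample n D}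

theorem measurementMatrix_ne_zero (hw : UniquelyDecodable w) (i : Fin m) (j : Fin n) :
    measurementMatrix w hLD ω m i j ≠ 0 ↔ j ∈ rowSupport L ω i := by
  unfold measurementMatrix rowSupport selected
  by_cases h : rank (degrees L ω i) (ω i).1 j < L
  · simp [h, hw.ne_zero]
  · simp [h]

theorem mem_nbrs (hw : UniquelyDecodable w) (σ : DecoderState n) (i : Fin m) (j : Fin n) :
    j ∈ nbrs (measurementMatrix w hLD ω m) σ i ↔ j ∈ rowSupport L ω i ∧ j ∉ σ.verified := by
  simp [nbrs, measurementMatrix_ne_zero hw]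

/-- Within a row the sum of the entries over a set of columns determines this set. -/
theorem row_sum_inj (hw : UniquelyDecodable w) (i : Fin m) {A B : Finset (Fin n)}
    (hA : A ⊆ rowSupport L ω i) (hB : B ⊆ rowSupport L ω i)
    (h : ∑ j ∈ A, measurementMatrix w hLD ω m i j = ∑ j ∈ B, measurementMatrix w hLD ω m i j) :
    A = B := by
  have hrank : ∀ x : {j // j ∈ rowSupport L ω i}, rank (degrees L ω i) (ω i).1 x.1 < L :=
    fun x => by simpa [rowSupport, selected] using x.2
  -- the weight index used in a column of row `i`
  let f : {j // j ∈ rowSupport L ω i} ↪ Fin D :=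
    ⟨fun x => (ω i).2 ⟨_, (hrank x).trans_le hLD⟩, fun x y hxy => by
      simp only [EmbeddingLike.apply_eq_iff_eq, Fin.mk.injEq] at hxy
      exact Subtype.ext (rank_injective _ _ hxy)⟩
  have key : ∀ E ⊆ rowSupport L ω i, ∑ j ∈ E, measurementMatrix w hLD ω m i j =
      ∑ a ∈ (E.subtype (· ∈ rowSupport L ω i)).map f, w a := by
    intro E hE
    rw [Finset.sum_map, ← Finset.sum_subtype_of_mem _ (fun x hx => hE hx)]
    refine Finset.sum_congr rfl fun x _ => ?_
    simp only [measurementMatrix, Matrix.of_apply, dif_pos (hrank x)]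
    rfl
  rw [key A hA, key B hB] at h
  have h2 := Finset.map_injective f (hw.sum_inj h)
  ext j
  constructor
  · intro hj
    have : (⟨j, hA hj⟩ : {j // j ∈ rowSupport L ω i}) ∈ A.subtype _ := by simpa using hj
    rw [h2] at this
    simpa using this
  · intro hj
    have : (⟨j, hB hj⟩ : {j // j ∈ rowSupport L ω i}) ∈ B.subtype _ := by simpa using hj
    rw [← h2] at this
    simpa using this

theorem IsBinarySignal.eq_one {k : ℕ} {b : Fin n → ℝ} (hb : IsBinarySignal k b) {j : Fin n}
    (hj : j ∈ support b) : b j = 1 := by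
  rcases hb.1 j with h | h
  · simp [support, h] at hj
  · exact h

theorem residualValue_eq {k : ℕ} {b : Fin n → ℝ} (hb : IsBinarySignal k b)
    (hw : UniquelyDecodable w) {σ : DecoderState n} (hσ : ∀ j ∈ σ.verified, σ.est j = b j)
    (i : Fin m) :
    residualValue (measurementMatrix w hLD ω m) ((measurementMatrix w hLD ω m).mulVec b) σ i =
      ∑ j ∈ rowSupport L ω i ∩ (support b \ σ.verified), measurementMatrix w hLD ω m i j := by
  classical
  unfold residualValue Matrix.mulVec dotProduct
  have h1 : ∑ j ∈ σ.verified, measurementMatrix w hLD ω m i j * σ.est j =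
      ∑ j ∈ σ.verified, measurementMatrix w hLD ω m i j * b j :=
    Finset.sum_congr rfl fun j hj => by rw [hσ j hj]
  rw [h1, ← Finset.sum_sdiff (Finset.subset_univ σ.verified), add_sub_cancel_right]
  symm
  have h2 : rowSupport L ω i ∩ (support b \ σ.verified) ⊆ Finset.univ \ σ.verified := by
    intro j hj
    simp only [Finset.mem_inter, Finset.mem_sdiff] at hj ⊢
    exact ⟨Finset.mem_univ _, hj.2.2⟩
  rw [← Finset.sum_subset (f := fun j => measurementMatrix w hLD ω m i j * b j) h2]
  · refine Finset.sum_congr rfl fun j hj => ?_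
    simp only [Finset.mem_inter, Finset.mem_sdiff] at hj
    rw [hb.eq_one hj.2.1, mul_one]
  · intro j hj hj'
    simp only [Finset.mem_inter, Finset.mem_sdiff, Finset.mem_univ, true_and] at hj hj'
    by_cases h3 : j ∈ rowSupport L ω i
    · by_cases h4 : j ∈ support b
      · exact absurd ⟨h3, h4, hj⟩ hj'
      · have : b j = 0 := by simpa [support] using h4
        rw [this, mul_zero]
    · have : measurementMatrix w hLD ω m i j = 0 := by
        by_contra h
        exact h3 ((measurementMatrix_ne_zero hw i j).1 h)
      rw [this, zero_mul]

/-- A decoder state is correct if the estimate agrees with the signal at the verified columns and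
vanishes elsewhere; the decoder only visits correct states. -/
theorem correct_of_reachable {k : ℕ} {b : Fin n → ℝ} (hb : IsBinarySignal k b)
    (hw : UniquelyDecodable w) {σ : DecoderState n}
    (h : Relation.ReflTransGen (Step T w (measurementMatrix w hLD ω m)
      ((measurementMatrix w hLD ω m).mulVec b)) (initialState n) σ) :
    (∀ j ∈ σ.verified, σ.est j = b j) ∧ ∀ j ∉ σ.verified, σ.est j = 0 := by
  classical
  induction h with
  | refl => exact ⟨by simp [initialState], by simp [initialState]⟩
  | tail _ hstep ih =>
    rename_i σ₁ σ₂ _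
    obtain ⟨i, -, -, A, hA, -, hsum, hver, hest⟩ := hstep
    rw [residualValue_eq hb hw ih.1] at hsum
    have hA' : A = rowSupport L ω i ∩ (support b \ σ₁.verified) := by
      refine row_sum_inj hw i ?_ Finset.inter_subset_left hsum
      intro j hj
      exact ((mem_nbrs hw _ _ _).1 (hA hj)).1
    rw [hver, hest]
    refine ⟨?_, ?_⟩
    · intro j hj
      by_cases h1 : j ∈ nbrs (measurementMatrix w hLD ω m) σ₁ i
      · simp only [h1, if_true]
        rw [mem_nbrs hw] at h1
        by_cases h2 : j ∈ support b
        · rw [if_pos, hb.eq_one h2]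
          rw [hA']
          simp [h1.1, h1.2, h2]
        · rw [if_neg]
          · simpa [support, eq_comm] using h2
          · rw [hA']
            simp [h2]
      · simp only [h1, if_false]
        exact ih.1 j (by simpa [h1] using hj)
    · intro j hj
      simp only [Finset.mem_union, not_or] at hj
      simp only [hj.2, if_false]
      exact ih.2 j hj.1

/-- The decoder succeeds if every column lies in some row and no nonempty set of nonzero columns is
a stopping set. -/
theorem reconstructs_of_no_stopping {k : ℕ} {b : Fin n → ℝ} (hb : IsBinarySignal k b)
    (hw : UniquelyDecodable w) (hcov : ∀ j, ∃ i < m, j ∈ rowSupport L ω i)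
    (hS : ∀ S ⊆ support b, S.Nonempty → ¬ Stopping T L ω m S) :
    Reconstructs T w (measurementMatrix w hLD ω m) b := by
  classical
  intro σ hσ hhalt
  obtain ⟨h1, h2⟩ := correct_of_reachable hb hw hσ
  -- a row that still has an edge and meets the unverified nonzero columns in at most `T` elements
  -- allows for one more iteration
  have step : ∀ i : Fin m, (∃ j ∈ rowSupport L ω i, j ∉ σ.verified) →
      (rowSupport L ω i ∩ (support b \ σ.verified)).card ≤ T → False := by
    rintro i ⟨j, hj, hj'⟩ hcard
    set A := rowSupport L ω i ∩ (support b \ σ.verified) with hA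
    have hinj : ∀ x ∈ rowSupport L ω i, rank (degrees L ω i) (ω i).1 x < L := by
      intro x hx
      simpa [rowSupport, selected] using hx
    refine hhalt ⟨σ.verified ∪ nbrs (measurementMatrix w hLD ω m) σ i, fun j =>
      if j ∈ nbrs (measurementMatrix w hLD ω m) σ i then (if j ∈ A then 1 else 0) else σ.est j⟩
      ⟨i, ⟨j, (mem_nbrs hw _ _ _).2 ⟨hj, hj'⟩⟩, ?_, A, ?_, hcard,
        (residualValue_eq hb hw h1 i).symm, rfl, rfl⟩
    · let f : A → Fin D := fun x => (ω i).2 ⟨rank (degrees L ω i) (ω i).1 x.1,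
        (hinj x.1 (Finset.mem_inter.1 x.2).1).trans_le hLD⟩
      have hf : Function.Injective f := by
        intro x y hxy
        simp only [f, EmbeddingLike.apply_eq_iff_eq, Fin.mk.injEq] at hxy
        exact Subtype.ext (rank_injective _ _ hxy)
      refine ⟨Finset.univ.image f, ?_, ?_⟩
      · rw [Finset.card_image_of_injective _ hf]
        simpa using hcard
      · rw [Finset.sum_image (fun x _ y _ h => hf h), residualValue_eq hb hw h1 i, ← hA,
          ← Finset.sum_coe_sort A]
        refine Finset.sum_congr rfl fun x _ => ?_
        simp [measurementMatrix, f, hinj x.1 (Finset.mem_inter.1 x.2).1]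
    · intro x hx
      simp only [hA, Finset.mem_inter, Finset.mem_sdiff] at hx
      exact (mem_nbrs hw _ _ _).2 ⟨hx.1, hx.2.2⟩
  have hSe : support b \ σ.verified = ∅ := by
    by_contra hne
    have hne' := Finset.nonempty_iff_ne_empty.2 hne
    have := hS _ Finset.sdiff_subset hne'
    unfold Stopping at this
    push Not at this
    obtain ⟨i, hi, h3, h4⟩ := this
    obtain ⟨j, hj⟩ := Finset.card_pos.1 (Nat.pos_of_ne_zero h3)
    simp only [Finset.mem_inter, Finset.mem_sdiff] at hj
    exact step ⟨i, hi⟩ ⟨j, hj.1, hj.2.2⟩ h4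
  have hver : σ.verified = Finset.univ := by
    rw [Finset.eq_univ_iff_forall]
    intro j
    by_contra hj
    obtain ⟨i, hi, hij⟩ := hcov j
    exact step ⟨i, hi⟩ ⟨j, hij, hj⟩ (by rw [hSe]; simp)
  exact ⟨hver, funext fun j => h1 j (by simp [hver])⟩

/-- Only columns of the rows are ever verified. -/
theorem verified_subset {c : Fin m → ℝ} (hw : UniquelyDecodable w) {σ : DecoderState n}
    (h : Relation.ReflTransGen (Step T w (measurementMatrix w hLD ω m) c) (initialState n) σ) :
    ∀ j ∈ σ.verified, ∃ i < m, j ∈ rowSupport L ω i := by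
  induction h with
  | refl => simp [initialState]
  | tail _ hstep ih =>
    obtain ⟨i, -, -, A, -, -, -, hver, -⟩ := hstep
    intro j hj
    rw [hver, Finset.mem_union] at hj
    rcases hj with hj | hj
    · exact ih j hj
    · exact ⟨i, i.2, ((mem_nbrs hw _ _ _).1 hj).1⟩

/-- The decoder halts, because every iteration verifies a further column. -/
theorem exists_halting (G : Matrix (Fin m) (Fin n) ℝ) (c : Fin m → ℝ) :
    ∃ σ, Relation.ReflTransGen (Step T w G c) (initialState n) σ ∧ ∀ σ', ¬ Step T w G c σ σ' := by
  by_contra hcon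
  push Not at hcon
  have key : ∀ r : ℕ, ∃ σ, Relation.ReflTransGen (Step T w G c) (initialState n) σ ∧
      r ≤ σ.verified.card := by
    intro r
    induction r with
    | zero => exact ⟨_, Relation.ReflTransGen.refl, Nat.zero_le _⟩
    | succ r ih =>
      obtain ⟨σ, h1, h2⟩ := ih
      obtain ⟨σ', h3⟩ := hcon σ h1
      refine ⟨σ', h1.tail h3, ?_⟩
      obtain ⟨i, ⟨j, hj⟩, -, A, -, -, -, hver, -⟩ := h3
      rw [hver]
      have : σ.verified ⊂ σ.verified ∪ nbrs G σ i := by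
        rw [Finset.ssubset_iff_of_subset Finset.subset_union_left]
        refine ⟨j, Finset.mem_union_right _ hj, ?_⟩
        simp only [nbrs, Finset.mem_filter] at hj
        exact hj.2.2
      have := Finset.card_lt_card this
      omega
  obtain ⟨σ, -, h⟩ := key (n + 1)
  have := Finset.card_le_univ σ.verified
  simp at this
  omega

/-- Complete reconstruction needs `n ≤ m L`, because the rows have to cover all columns. -/
theorem le_mul_of_reconstructs (hw : UniquelyDecodable w) (hL : L ≤ n) {b : Fin n → ℝ}
    (h : Reconstructs T w (measurementMatrix w hLD ω m) b) : n ≤ m * L := by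
  classical
  obtain ⟨σ, h1, h2⟩ := exists_halting (T := T) (w := w) (measurementMatrix w hLD ω m)
    ((measurementMatrix w hLD ω m).mulVec b)
  have h3 := (h σ h1 h2).1
  have h4 := verified_subset hw h1
  have h5 : (Finset.univ : Finset (Fin n)) ⊆
      (Finset.range m).biUnion fun i => rowSupport L ω i := by
    intro j _
    obtain ⟨i, hi, hj⟩ := h4 j (by simp [h3])
    exact Finset.mem_biUnion.2 ⟨i, Finset.mem_range.2 hi, hj⟩
  calc n = (Finset.univ : Finset (Fin n)).card := by simp
    _ ≤ _ := Finset.card_le_card h5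
    _ ≤ ∑ i ∈ Finset.range m, (rowSupport L ω i).card := Finset.card_biUnion_le
    _ = m * L := by simp [rowSupport, card_selected hL]

theorem div_le_minMeasurements (hw : UniquelyDecodable w) (hL : L ≤ n)
    (b : Fin n → ℝ) :
    (n : ℝ≥0∞) / (L : ℝ≥0∞) ≤ (minMeasurements T w hLD b ω : ℝ≥0∞) := by
  have h : ∀ m : ℕ, Reconstructs T w (measurementMatrix w hLD ω m) b → n ≤ m * L :=
    fun m hm => le_mul_of_reconstructs hw hL hm
  have hmin : ∀ m : ℕ, minMeasurements T w hLD b ω = (m : ℕ∞) → n ≤ m * L := by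
    intro m hm
    by_contra hlt
    have : ((m + 1 : ℕ) : ℕ∞) ≤ minMeasurements T w hLD b ω := by
      refine le_iInf₂ fun m' hm' => ?_
      have := h m' hm'
      rw [Nat.cast_le]
      by_contra hc
      have hle : m' ≤ m := by omega
      exact hlt (this.trans (Nat.mul_le_mul_right _ hle))
    rw [hm, Nat.cast_le] at this
    omega
  rcases eq_or_ne (minMeasurements T w hLD b ω) ⊤ with htop | htop
  · rw [htop]; simp
  · obtain ⟨m, hm⟩ := ENat.ne_top_iff_exists.1 htop
    have h1 := hmin m hm.symm
    rw [← hm]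
    refine ENNReal.div_le_of_le_mul ?_
    simp only [ENat.toENNReal_coe]
    exact_mod_cast h1

end Decoder

/-! ### The law of one row -/

/-- The average of `f` over the subsets of `C` with `q` elements. -/
def subsetAvg {α : Type*} (C : Finset α) (q : ℕ) (f : Finset α → ℝ) : ℝ :=
  (∑ Q ∈ C.powersetCard q, f Q) / (C.card.choose q : ℝ)

theorem exists_perm_map_eq {n : ℕ} {C Q Q' : Finset (Fin n)} (hQ : Q ⊆ C) (hQ' : Q' ⊆ C)
    (h : Q.card = Q'.card) :
    ∃ τ : Equiv.Perm (Fin n), (∀ j ∉ C, τ j = j) ∧ (∀ j, τ j ∈ C ↔ j ∈ C) ∧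
      ∀ j ∈ C, τ j ∈ Q' ↔ j ∈ Q := by
  classical
  have hcard : Fintype.card {x : {j // j ∈ C} // x.1 ∈ Q} =
      Fintype.card {x : {j // j ∈ C} // x.1 ∈ Q'} := by
    rw [Fintype.card_subtype, Fintype.card_subtype]
    have key : ∀ E ⊆ C, (Finset.univ.filter fun x : {j // j ∈ C} => x.1 ∈ E).card = E.card := by
      intro E hE
      rw [← Finset.card_map (Function.Embedding.subtype _)]
      congr 1
      ext j
      simp only [Finset.mem_map, Finset.mem_filter, Finset.mem_univ, true_and,
        Function.Embedding.subtype_apply, Subtype.exists, exists_and_left, exists_prop,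
        exists_eq_right_right]
      exact ⟨fun h => h.1, fun h => ⟨h, hE h⟩⟩
    rw [key Q hQ, key Q' hQ', h]
  let e := Fintype.equivOfCardEq hcard
  let τ₀ : Equiv.Perm {j // j ∈ C} := e.extendSubtype
  refine ⟨Equiv.Perm.ofSubtype τ₀, ?_, ?_, ?_⟩
  · intro j hj
    exact Equiv.Perm.ofSubtype_apply_of_not_mem _ hj
  · intro j
    by_cases hj : j ∈ C
    · rw [Equiv.Perm.ofSubtype_apply_of_mem _ hj]
      simp [hj]
    · rw [Equiv.Perm.ofSubtype_apply_of_not_mem _ hj]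
  · intro j hj
    rw [Equiv.Perm.ofSubtype_apply_of_mem _ hj]
    constructor
    · intro h1
      by_contra h2
      exact e.extendSubtype_not_mem ⟨j, hj⟩ h2 h1
    · intro h1
      exact e.extendSubtype_mem ⟨j, hj⟩ h1

theorem rank_mul_inv {n : ℕ} {deg : Fin n → ℕ} {τ : Equiv.Perm (Fin n)}
    (hτ : ∀ j, deg (τ j) = deg j) (π : Equiv.Perm (Fin n)) (j : Fin n) :
    rank deg (π * τ⁻¹) (τ j) = rank deg π j := by
  unfold rank
  symm
  apply Finset.card_bij (fun a _ => τ a)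
  · intro a ha
    simpa [hτ] using ha
  · intro a _ b _ h
    exact τ.injective h
  · intro b hb
    refine ⟨τ⁻¹ b, ?_, by simp⟩
    obtain ⟨b, rfl⟩ := τ.surjective b
    simpa [hτ] using hb

/-- If the columns in `B` have degrees smaller than those in `C`, if the columns in `C` have all
the same degree and all others a larger one, then the selected columns consist of `B` and a
uniformly distributed subset of `C`. -/
theorem avg_selected {n L c : ℕ} {deg : Fin n → ℕ} {B C : Finset (Fin n)}
    (hB : ∀ j, j ∈ B ↔ deg j < c) (hC : ∀ j, j ∈ C ↔ deg j = c) (hL : L ≤ n)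
    (hBL : B.card ≤ L) (hCL : L ≤ B.card + C.card) (f : Finset (Fin n) → ℝ) :
    (∑ π : Equiv.Perm (Fin n), f (selected L deg π)) / (Fintype.card (Equiv.Perm (Fin n)) : ℝ) =
      subsetAvg C (L - B.card) fun Q => f (B ∪ Q) := by
  classical
  have hBC : Disjoint B C := by
    rw [Finset.disjoint_left]
    intro j h1 h2
    rw [hB] at h1; rw [hC] at h2; omega
  have hBs : ∀ π, B ⊆ selected L deg π := by
    intro π
    have : B = Finset.univ.filter fun j => deg j < c := by ext j; simp [hB]
    rw [this]
    exact subset_selected (by rw [← this]; exact hBL) π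
  have hsC : ∀ π, selected L deg π ⊆ B ∪ C := by
    intro π
    have : B ∪ C = Finset.univ.filter fun j => deg j ≤ c := by
      ext j; simp [hB, hC, le_iff_lt_or_eq]
    rw [this]
    refine selected_subset ?_ π
    rw [← this, Finset.card_union_of_disjoint hBC]
    exact hCL
  have hmaps : ∀ π ∈ (Finset.univ : Finset (Equiv.Perm (Fin n))),
      selected L deg π \ B ∈ C.powersetCard (L - B.card) := by
    intro π _
    rw [Finset.mem_powersetCard]
    refine ⟨?_, ?_⟩
    · intro j hj
      have := hsC π (Finset.mem_sdiff.1 hj).1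
      simpa [(Finset.mem_sdiff.1 hj).2] using this
    · rw [Finset.card_sdiff_of_subset (hBs π), card_selected hL]
  -- relabelling the columns in `C` shows that all subsets of the right size are equally likely
  have hconst : ∀ Q ∈ C.powersetCard (L - B.card), ∀ Q' ∈ C.powersetCard (L - B.card),
      (Finset.univ.filter fun π => selected L deg π \ B = Q).card ≤
      (Finset.univ.filter fun π => selected L deg π \ B = Q').card := by
    intro Q hQ Q' hQ'
    rw [Finset.mem_powersetCard] at hQ hQ'
    obtain ⟨τ, h1, h2, h3⟩ := exists_perm_map_eq hQ.1 hQ'.1 (hQ.2.trans hQ'.2.symm)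
    have hdeg : ∀ j, deg (τ j) = deg j := by
      intro j
      by_cases hj : j ∈ C
      · rw [(hC _).1 ((h2 j).2 hj), (hC _).1 hj]
      · rw [h1 j hj]
    apply Finset.card_le_card_of_injOn (fun π => π * τ⁻¹)
    · intro π hπ
      simp only [Finset.coe_filter, Finset.mem_univ, true_and, Set.mem_ofPred_eq] at hπ ⊢
      ext j
      obtain ⟨j, rfl⟩ := τ.surjective j
      have hmem : τ j ∈ selected L deg (π * τ⁻¹) ↔ j ∈ selected L deg π := by
        simp [selected, rank_mul_inv hdeg]
      have hBj : τ j ∈ B ↔ j ∈ B := by rw [hB, hB, hdeg]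
      rw [Finset.mem_sdiff, hmem, hBj, ← Finset.mem_sdiff, hπ]
      by_cases hj : j ∈ C
      · exact (h3 j hj).symm
      · exact ⟨fun h => absurd (hQ.1 h) hj, fun h => absurd ((h2 j).1 (hQ'.1 h)) hj⟩
    · intro a _ b _ h
      exact mul_right_cancel h
  have hne : (C.powersetCard (L - B.card)).Nonempty :=
    Finset.powersetCard_nonempty.2 (by omega)
  obtain ⟨Q₀, hQ₀⟩ := hne
  set N := (Finset.univ.filter fun π => selected L deg π \ B = Q₀).card with hN
  have hfib : ∀ Q ∈ C.powersetCard (L - B.card),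
      (Finset.univ.filter fun π => selected L deg π \ B = Q).card = N := fun Q hQ =>
    le_antisymm (hconst Q hQ Q₀ hQ₀) (hconst Q₀ hQ₀ Q hQ)
  have hsum : ∀ g : Finset (Fin n) → ℝ, ∑ π : Equiv.Perm (Fin n), g (selected L deg π) =
      N * ∑ Q ∈ C.powersetCard (L - B.card), g (B ∪ Q) := by
    intro g
    rw [← Finset.sum_fiberwise_of_maps_to hmaps, Finset.mul_sum]
    refine Finset.sum_congr rfl fun Q hQ => ?_
    rw [← hfib Q hQ, ← nsmul_eq_mul, ← Finset.sum_const]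
    refine Finset.sum_congr rfl fun π hπ => ?_
    rw [Finset.mem_filter] at hπ
    rw [← hπ.2, Finset.union_sdiff_of_subset (hBs π)]
  have htot : (Fintype.card (Equiv.Perm (Fin n)) : ℝ) = N * (C.card.choose (L - B.card) : ℝ) := by
    have := hsum fun _ => 1
    simpa using this
  have hN0 : (N : ℝ) ≠ 0 := by
    intro h0
    rw [h0, zero_mul] at htot
    have : 0 < Fintype.card (Equiv.Perm (Fin n)) := Fintype.card_pos
    exact this.ne' (by exact_mod_cast htot)
  rw [hsum f, htot, subsetAvg, mul_div_mul_left _ _ hN0]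

/-! ### The columns of smallest degree -/

/-- The columns that have the smallest degree before row `i` is generated. -/
def minSet {n D : ℕ} (L : ℕ) (ω : Sample n D) (i : ℕ) : Finset (Fin n) :=
  Finset.univ.filter fun j => degrees L ω i j = i * L / n

section MinSet

variable {n D L : ℕ} {ω : Sample n D}

theorem card_rowSupport (hL : L ≤ n) (i : ℕ) : (rowSupport L ω i).card = L :=
  card_selected hL _ _

theorem sum_degrees (hL : L ≤ n) (i : ℕ) : ∑ j, degrees L ω i j = i * L := by
  induction i with
  | zero => simp [degrees]
  | succ i ih =>
    simp only [degrees_succ, Finset.sum_add_distrib, ih, Finset.sum_boole]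
    simp [card_rowSupport hL, add_mul]

theorem card_minSet_of (hn : 0 < n) (hL : L ≤ n) {i : ℕ}
    (h : ∀ j, degrees L ω i j = i * L / n ∨ degrees L ω i j = i * L / n + 1) :
    (minSet L ω i).card = n - i * L % n := by
  have h1 : ∀ j, degrees L ω i j = i * L / n + 1 - if j ∈ minSet L ω i then 1 else 0 := by
    intro j
    by_cases hj : degrees L ω i j = i * L / n
    · simp [minSet, hj]
    · have := (h j).resolve_left hj
      simp [minSet, this]
  have h2 : ∑ j, (degrees L ω i j + if j ∈ minSet L ω i then 1 else 0) = n * (i * L / n + 1) := by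
    rw [Finset.sum_congr rfl (g := fun _ => i * L / n + 1)]
    · simp
    · intro j _
      have := h1 j
      generalize i * L / n = v at this ⊢
      split_ifs at this ⊢ <;> omega
  rw [Finset.sum_add_distrib, sum_degrees hL] at h2
  simp only [Finset.sum_boole, Finset.filter_mem_eq_inter, Finset.univ_inter, Nat.cast_id] at h2
  have h3 := Nat.div_add_mod (i * L) n
  have h4 := Nat.mod_lt (i * L) hn
  rw [mul_add, mul_one] at h2
  omega

theorem succ_mul_div_of_lt (hn : 0 < n) {i : ℕ} (h : L < n - i * L % n) :
    (i + 1) * L / n = i * L / n := by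
  have h3 := Nat.div_add_mod (i * L) n
  rw [add_mul, one_mul]
  generalize i * L = x at *
  have h4 : x % n + L < n := by omega
  have : x + L = n * (x / n) + (x % n + L) := by omega
  rw [this, Nat.mul_add_div hn, Nat.div_eq_of_lt h4, add_zero]

theorem succ_mul_div_of_le (hn : 0 < n) (hL : L ≤ n) {i : ℕ} (h : n - i * L % n ≤ L) :
    (i + 1) * L / n = i * L / n + 1 := by
  have h3 := Nat.div_add_mod (i * L) n
  have h4 := Nat.mod_lt (i * L) hn
  rw [add_mul, one_mul]
  generalize i * L = x at *
  have h5 : x % n + L - n < n := by omega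
  have : x + L = n * (x / n + 1) + (x % n + L - n) := by rw [mul_add]; omega
  rw [this, Nat.mul_add_div hn, Nat.div_eq_of_lt h5, add_zero]

theorem filter_degrees_le {v i : ℕ}
    (h : ∀ j, degrees L ω i j = v ∨ degrees L ω i j = v + 1) :
    (Finset.univ.filter fun j => degrees L ω i j ≤ v) =
      Finset.univ.filter fun j => degrees L ω i j = v := by
  ext j
  simp only [Finset.mem_filter, Finset.mem_univ, true_and]
  rcases h j with h | h <;> omega

theorem filter_degrees_lt {v i : ℕ}
    (h : ∀ j, degrees L ω i j = v ∨ degrees L ω i j = v + 1) :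
    (Finset.univ.filter fun j => degrees L ω i j < v + 1) =
      Finset.univ.filter fun j => degrees L ω i j = v := by
  ext j
  simp only [Finset.mem_filter, Finset.mem_univ, true_and]
  rcases h j with h | h <;> omega

/-- At every time the degrees take at most two values, which are consecutive. -/
theorem degrees_eq_or (hn : 0 < n) (hL : L ≤ n) (i : ℕ) (j : Fin n) :
    degrees L ω i j = i * L / n ∨ degrees L ω i j = i * L / n + 1 := by
  induction i generalizing j with
  | zero => simp [degrees]
  | succ i ih =>
    have hcard := card_minSet_of hn hL ih
    rw [degrees_succ]
    rcases lt_or_ge L (n - i * L % n) with hlt | hge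
    · rw [succ_mul_div_of_lt hn hlt]
      by_cases hj : j ∈ rowSupport L ω i
      · have h1 := selected_subset (L := L) (c := i * L / n) (deg := degrees L ω i)
          (by rw [filter_degrees_le ih]; exact (hlt.trans_eq hcard.symm).le) (ω i).1 hj
        rw [filter_degrees_le ih] at h1
        simp only [Finset.mem_filter, Finset.mem_univ, true_and] at h1
        simp [hj, h1]
      · simpa [hj] using ih j
    · rw [succ_mul_div_of_le hn hL hge]
      rcases ih j with h | h
      · have h1 := subset_selected (L := L) (c := i * L / n + 1) (deg := degrees L ω i)
          (by rw [filter_degrees_lt ih]; exact hcard.trans_le hge) (ω i).1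
        have h1' : j ∈ rowSupport L ω i := h1 (by simp [h])
        simp [h1', h]
      · split_ifs <;> omega

theorem card_minSet (hn : 0 < n) (hL : L ≤ n) (i : ℕ) :
    (minSet L ω i).card = n - i * L % n :=
  card_minSet_of hn hL fun j => degrees_eq_or hn hL i j

theorem minSet_subset_rowSupport (hn : 0 < n) (hL : L ≤ n) {i : ℕ} (h : (minSet L ω i).card ≤ L) :
    minSet L ω i ⊆ rowSupport L ω i := by
  have := subset_selected (L := L) (c := i * L / n + 1) (deg := degrees L ω i)
    (by rw [filter_degrees_lt (degrees_eq_or hn hL i)]; exact h) (ω i).1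
  rw [filter_degrees_lt (degrees_eq_or hn hL i)] at this
  exact this

theorem minSet_succ_of_lt (hn : 0 < n) (hL : L ≤ n) {i : ℕ} (h : L < n - i * L % n) :
    minSet L ω (i + 1) = minSet L ω i \ rowSupport L ω i := by
  ext j
  simp only [minSet, Finset.mem_filter, Finset.mem_univ, true_and, Finset.mem_sdiff,
    succ_mul_div_of_lt hn h, degrees_succ]
  rcases degrees_eq_or (ω := ω) hn hL i j with h1 | h1
  · by_cases hj : j ∈ rowSupport L ω i <;> simp [hj, h1]
  · rw [h1]
    split_ifs <;> omega

theorem minSet_succ_of_le (hn : 0 < n) (hL : L ≤ n) {i : ℕ} (h : n - i * L % n ≤ L) :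
    minSet L ω (i + 1) = (rowSupport L ω i \ minSet L ω i)ᶜ := by
  ext j
  have hsub := minSet_subset_rowSupport (ω := ω) hn hL (by rw [card_minSet hn hL i]; exact h)
  simp only [Finset.mem_compl, Finset.mem_sdiff, not_and, not_not]
  simp only [minSet, Finset.mem_filter, Finset.mem_univ, true_and,
    succ_mul_div_of_le hn hL h, degrees_succ]
  rcases degrees_eq_or (ω := ω) hn hL i j with h1 | h1
  · have hj : j ∈ rowSupport L ω i := hsub (by simp [minSet, h1])
    simp [hj, h1]
  · by_cases hj : j ∈ rowSupport L ω i <;> simp [hj, h1]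

/-- Once `i L ≥ n`, the rows before `i` cover all columns. -/
theorem exists_mem_rowSupport (hn : 0 < n) (hL : L ≤ n) {i : ℕ} (h : n ≤ i * L) (j : Fin n) :
    ∃ i' < i, j ∈ rowSupport L ω i' := by
  by_contra hcon
  push Not at hcon
  have key : ∀ i' ≤ i, degrees L ω i' j = 0 := by
    intro i' hi'
    induction i' with
    | zero => simp [degrees]
    | succ i' ih => rw [degrees_succ, ih (by omega), if_neg (hcon i' (by omega))]
  have h1 := degrees_eq_or (ω := ω) hn hL i j
  rw [key i le_rfl] at h1
  have : 1 ≤ i * L / n := (Nat.one_le_div_iff hn).2 h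
  omega

end MinSet

/-! ### Conditioning on the earlier rows -/

/-- `f` depends only on the seeds of the rows before `m`. -/
def Past {n D : ℕ} {β : Type*} (m : ℕ) (f : Sample n D → β) : Prop :=
  ∀ ω ω' : Sample n D, (∀ i < m, ω i = ω' i) → f ω = f ω'

/-- The average of `f` over the possible supports of row `i`, given the earlier rows. -/
def rowAvg {n D : ℕ} (L : ℕ) (ω : Sample n D) (i : ℕ) (f : Finset (Fin n) → ℝ) : ℝ :=
  (∑ π : Equiv.Perm (Fin n), f (selected L (degrees L ω i) π)) /
    (Fintype.card (Equiv.Perm (Fin n)) : ℝ)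

section Past

variable {n D L : ℕ} {β : Type*}

theorem Past.mono {m m' : ℕ} {f : Sample n D → β} (h : Past m f) (hm : m ≤ m') : Past m' f :=
  fun ω ω' hω => h ω ω' fun i hi => hω i (hi.trans_le hm)

theorem Past.update {m : ℕ} {f : Sample n D → β} (h : Past m f) (ω : Sample n D)
    (s : RowSeed n D) : f (Function.update ω m s) = f ω :=
  h _ _ fun i hi => by rw [Function.update_of_ne hi.ne]

theorem past_degrees (L i : ℕ) : Past i fun ω : Sample n D => degrees L ω i := by
  induction i with
  | zero => intro ω ω' _; rfl
  | succ i ih =>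
    intro ω ω' h
    have h1 := ih ω ω' fun i' hi' => h i' (by omega)
    simp only at h1
    funext j
    simp only [degrees, h1, h i (Nat.lt_succ_self i)]

theorem past_rowSupport (L : ℕ) {i m : ℕ} (h : i < m) :
    Past m fun ω : Sample n D => rowSupport L ω i := by
  intro ω ω' hω
  simp only [rowSupport, (past_degrees (D := D) L i).mono h.le ω ω' hω, hω i h]

theorem past_minSet (L i : ℕ) : Past i fun ω : Sample n D => minSet L ω i := by
  intro ω ω' hω
  simp only [minSet, past_degrees (D := D) L i ω ω' hω]

instance : DiscreteMeasurableSpace (RowSeed n D) := ⟨fun _ => trivial⟩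

theorem Past.measurable [MeasurableSpace β] {m : ℕ} {f : Sample n D → β} (h : Past m f) :
    Measurable f := by
  let r : Sample n D → (Fin m → RowSeed n D) := fun ω i => ω i
  let e : (Fin m → RowSeed n D) → Sample n D := fun x i => if hi : i < m then x ⟨i, hi⟩ else 1
  have hr : Measurable r := measurable_pi_lambda _ fun i => measurable_pi_apply _
  have : f = (fun x => f (e x)) ∘ r := by
    funext ω
    refine h _ _ fun i hi => ?_
    simp [e, r, hi]
  rw [this]
  exact (measurable_of_countable _).comp hr

/-- The seed of one row may be replaced by an independent uniformly distributed one. -/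
theorem lintegral_eq_lintegral_update (i : ℕ) {g : Sample n D → ℝ≥0∞} (hg : Measurable g) :
    ∫⁻ ω, g ω ∂seedLaw n D =
      ∫⁻ ω, (∑ s, g (Function.update ω i s)) / (Fintype.card (RowSeed n D) : ℝ≥0∞)
        ∂seedLaw n D := by
  classical
  have hupd : ∀ s : RowSeed n D, Measurable fun ω : Sample n D => Function.update ω i s := by
    intro s
    refine measurable_pi_lambda _ fun i' => ?_
    by_cases h : i' = i
    · subst h; simp
    · simpa [Function.update_of_ne h] using measurable_pi_apply i'
  have hc0 : (Fintype.card (RowSeed n D) : ℝ≥0∞) ≠ 0 := by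
    exact_mod_cast (Fintype.card_pos (α := RowSeed n D)).ne'
  have hctop : (Fintype.card (RowSeed n D) : ℝ≥0∞) ≠ ⊤ := ENNReal.natCast_ne_top _
  let ν : Measure (Sample n D) := (Fintype.card (RowSeed n D) : ℝ≥0∞)⁻¹ •
    ∑ s : RowSeed n D, (seedLaw n D).map fun ω => Function.update ω i s
  have hν : ν = seedLaw n D := by
    refine Measure.eq_infinitePi _ fun S t ht => ?_
    have hmeas : MeasurableSet (Set.pi (S : Set ℕ) t) :=
      MeasurableSet.pi S.countable_toSet fun a _ => ht a
    have hunif : ∀ A : Set (RowSeed n D),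
        (PMF.uniformOfFintype (RowSeed n D)).toMeasure A =
          (∑ s : RowSeed n D, if s ∈ A then 1 else 0) / (Fintype.card (RowSeed n D) : ℝ≥0∞) := by
      intro A
      rw [PMF.toMeasure_apply_fintype, ENNReal.div_eq_inv_mul, Finset.mul_sum]
      refine Finset.sum_congr rfl fun s _ => ?_
      by_cases hs : s ∈ A <;> simp [hs]
    have hpi : ∀ S : Finset ℕ, (∀ a ∈ S, MeasurableSet (t a)) → seedLaw n D (Set.pi S t) =
        ∏ a ∈ S, (PMF.uniformOfFintype (RowSeed n D)).toMeasure (t a) := by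
      intro S hS
      exact Measure.infinitePi_pi _ hS
    simp only [ν, Measure.smul_apply, Measure.finsetSum_apply, smul_eq_mul]
    have hmap : ∀ s : RowSeed n D, (seedLaw n D).map (fun ω => Function.update ω i s)
        (Set.pi S t) = (if i ∈ S → s ∈ t i then 1 else 0) *
          ∏ a ∈ S.erase i, (PMF.uniformOfFintype (RowSeed n D)).toMeasure (t a) := by
      intro s
      rw [Measure.map_apply (hupd s) hmeas, ← hpi _ fun a _ => ht a]
      split_ifs with h
      · rw [one_mul]
        congr 1
        ext ω
        simp only [Set.mem_preimage, Set.mem_pi, Finset.mem_coe, Finset.mem_erase]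
        constructor
        · rintro h1 a ⟨ha, haS⟩
          have := h1 a haS
          rwa [Function.update_of_ne ha] at this
        · intro h1 a ha
          by_cases hai : a = i
          · subst hai; simpa using h ha
          · rw [Function.update_of_ne hai]; exact h1 a ⟨hai, ha⟩
      · push Not at h
        rw [zero_mul]
        convert measure_empty (μ := seedLaw n D)
        ext ω
        simp only [Set.mem_preimage, Set.mem_pi, Finset.mem_coe, Set.mem_empty_iff_false, iff_false]
        intro h1
        have := h1 i h.1
        rw [Function.update_self] at this
        exact h.2 this
    simp only [hmap, ← Finset.sum_mul]
    by_cases hi : i ∈ S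
    · rw [← Finset.mul_prod_erase S _ hi, hunif (t i)]
      simp only [hi, true_imp_iff]
      rw [ENNReal.div_eq_inv_mul, mul_assoc]
    · simp only [hi, false_imp_iff, if_true, Finset.erase_eq_of_notMem hi]
      simp only [Finset.sum_const, Finset.card_univ, nsmul_eq_mul, mul_one]
      rw [← mul_assoc, ENNReal.inv_mul_cancel hc0 hctop, one_mul]
  conv_lhs => rw [← hν]
  rw [lintegral_smul_measure, lintegral_finsetSum_measure]
  simp only [ENNReal.div_eq_inv_mul]
  rw [lintegral_const_mul (f := fun ω => ∑ s, g (Function.update ω i s)) _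
      (Finset.measurable_fun_sum _ fun s _ => hg.comp (hupd s)),
    smul_eq_mul, lintegral_finsetSum (f := fun s ω => g (Function.update ω i s)) _
      fun s _ => hg.comp (hupd s)]
  congr 1
  refine Finset.sum_congr rfl fun s _ => ?_
  rw [lintegral_map hg (hupd s)]

/-- Averaging over the tie-breaking order of row `i`, given the earlier rows. -/
theorem lintegral_row_le {i : ℕ} {F : Sample n D → Finset (Fin n) → ℝ} {G : Sample n D → ℝ}
    (hF : ∀ R, Past i fun ω => F ω R) (hF0 : ∀ ω R, 0 ≤ F ω R)
    (h : ∀ ω, rowAvg L ω i (F ω) ≤ G ω) :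
    ∫⁻ ω, ENNReal.ofReal (F ω (rowSupport L ω i)) ∂seedLaw n D ≤
      ∫⁻ ω, ENNReal.ofReal (G ω) ∂seedLaw n D := by
  have hpast : Past (i + 1) fun ω : Sample n D => ENNReal.ofReal (F ω (rowSupport L ω i)) := by
    intro ω ω' hω
    have h1 : rowSupport L ω i = rowSupport L ω' i :=
      past_rowSupport (n := n) (D := D) L (Nat.lt_succ_self i) ω ω' hω
    have h2 := (hF (rowSupport L ω' i)).mono (Nat.le_succ i) ω ω' hω
    simp only at h2 ⊢
    rw [h1, h2]
  rw [lintegral_eq_lintegral_update i hpast.measurable]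
  refine lintegral_mono fun ω => ?_
  have hupd : ∀ s : RowSeed n D, ENNReal.ofReal (F (Function.update ω i s)
      (rowSupport L (Function.update ω i s) i)) =
      ENNReal.ofReal (F ω (selected L (degrees L ω i) s.1)) := by
    intro s
    have h1 : degrees L (Function.update ω i s) i = degrees L ω i :=
      (past_degrees (n := n) (D := D) L i).update ω s
    rw [(hF _).update ω s, rowSupport, h1, Function.update_self]
  simp only [hupd]
  rw [← ENNReal.ofReal_sum_of_nonneg fun s _ => hF0 _ _, ← ENNReal.ofReal_natCast,
    ← ENNReal.ofReal_div_of_pos (by exact_mod_cast Fintype.card_pos)]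
  refine ENNReal.ofReal_le_ofReal (le_trans (le_of_eq ?_) (h ω))
  rw [Fintype.sum_prod_type, rowAvg]
  simp only [Finset.sum_const, Finset.card_univ, nsmul_eq_mul]
  rw [← Finset.mul_sum, Fintype.card_prod, Nat.cast_mul,
    mul_comm (Fintype.card _ : ℝ) (Fintype.card (Equiv.Perm (Fin D)) : ℝ)]
  exact mul_div_mul_left _ _ (by exact_mod_cast Fintype.card_pos.ne')

/-- A row that lies within the columns of smallest degree is a uniformly distributed subset of
these, given the earlier rows. -/
theorem rowAvg_of_lt (hn : 0 < n) (hL : L ≤ n) {i : ℕ} (hi : L < n - i * L % n)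
    (f : Finset (Fin n) → ℝ) : rowAvg L ω i f = subsetAvg (minSet L ω i) L f := by
  have hdeg := degrees_eq_or (ω := ω) hn hL i
  rw [rowAvg, avg_selected (c := i * L / n) (B := ∅) (C := minSet L ω i) _ _ hL (by simp)]
  · simp
  · rw [card_minSet hn hL]; simpa using hi.le
  · intro j
    rcases hdeg j with h1 | h1 <;> simp [h1]
  · intro j
    simp [minSet]

/-- A row that exhausts the columns of smallest degree consists of these and of a uniformly
distributed set of further columns, given the earlier rows. -/
theorem rowAvg_of_le (hn : 0 < n) (hL : L ≤ n) {i : ℕ} (hi : n - i * L % n ≤ L)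
    (f : Finset (Fin n) → ℝ) :
    rowAvg L ω i f = subsetAvg (minSet L ω i)ᶜ (L - (minSet L ω i).card)
      (fun Q => f (minSet L ω i ∪ Q)) := by
  have hdeg := degrees_eq_or (ω := ω) hn hL i
  rw [rowAvg, avg_selected (c := i * L / n + 1) (B := minSet L ω i) (C := (minSet L ω i)ᶜ) _ _ hL
    (by rw [card_minSet hn hL]; exact hi)]
  · rw [Finset.card_add_card_compl]; simpa using hL
  · intro j
    rcases hdeg j with h1 | h1 <;> simp [minSet, h1]
  · intro j
    rcases hdeg j with h1 | h1 <;> simp [minSet, h1]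

theorem lintegral_row_le_of_lt (hn : 0 < n) (hL : L ≤ n) {i : ℕ} (hi : L < n - i * L % n)
    {F : Sample n D → Finset (Fin n) → ℝ} {G : Sample n D → ℝ}
    (hF : ∀ R, Past i fun ω => F ω R) (hF0 : ∀ ω R, 0 ≤ F ω R)
    (h : ∀ ω, subsetAvg (minSet L ω i) L (F ω) ≤ G ω) :
    ∫⁻ ω, ENNReal.ofReal (F ω (rowSupport L ω i)) ∂seedLaw n D ≤
      ∫⁻ ω, ENNReal.ofReal (G ω) ∂seedLaw n D :=
  lintegral_row_le hF hF0 fun ω => by rw [rowAvg_of_lt hn hL hi]; exact h ω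

theorem lintegral_row_le_of_le (hn : 0 < n) (hL : L ≤ n) {i : ℕ} (hi : n - i * L % n ≤ L)
    {F : Sample n D → Finset (Fin n) → ℝ} {G : Sample n D → ℝ}
    (hF : ∀ R, Past i fun ω => F ω R) (hF0 : ∀ ω R, 0 ≤ F ω R)
    (h : ∀ ω, subsetAvg (minSet L ω i)ᶜ (L - (minSet L ω i).card)
      (fun Q => F ω (minSet L ω i ∪ Q)) ≤ G ω) :
    ∫⁻ ω, ENNReal.ofReal (F ω (rowSupport L ω i)) ∂seedLaw n D ≤
      ∫⁻ ω, ENNReal.ofReal (G ω) ∂seedLaw n D :=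
  lintegral_row_le hF hF0 fun ω => by rw [rowAvg_of_le hn hL hi]; exact h ω

end Past

/-! ### Uniformly distributed subsets -/

section SubsetAvg

variable {α : Type*} {C : Finset α} {q : ℕ} {f g : Finset α → ℝ}

theorem subsetAvg_mono (h : ∀ Q ∈ C.powersetCard q, f Q ≤ g Q) :
    subsetAvg C q f ≤ subsetAvg C q g :=
  div_le_div_of_nonneg_right (Finset.sum_le_sum h) (Nat.cast_nonneg _)

theorem subsetAvg_const (hq : q ≤ C.card) (a : ℝ) : subsetAvg C q (fun _ => a) = a := by
  have : (C.card.choose q : ℝ) ≠ 0 := by exact_mod_cast (Nat.choose_pos hq).ne'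
  simp [subsetAvg, this]

theorem subsetAvg_add : subsetAvg C q (fun Q => f Q + g Q) = subsetAvg C q f + subsetAvg C q g := by
  simp [subsetAvg, Finset.sum_add_distrib, add_div]

theorem subsetAvg_sub : subsetAvg C q (fun Q => f Q - g Q) = subsetAvg C q f - subsetAvg C q g := by
  simp [subsetAvg, Finset.sum_sub_distrib, sub_div]

theorem subsetAvg_mul_left (a : ℝ) : subsetAvg C q (fun Q => a * f Q) = a * subsetAvg C q f := by
  simp [subsetAvg, ← Finset.mul_sum, mul_div_assoc]

theorem subsetAvg_sum {ι : Type*} (s : Finset ι) (F : ι → Finset α → ℝ) :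
    subsetAvg C q (fun Q => ∑ a ∈ s, F a Q) = ∑ a ∈ s, subsetAvg C q (F a) := by
  simp only [subsetAvg]
  rw [Finset.sum_comm, Finset.sum_div]

theorem subsetAvg_indicator (p : Finset α → Prop) [DecidablePred p] :
    subsetAvg C q (fun Q => if p Q then 1 else 0) =
      (((C.powersetCard q).filter p).card : ℝ) / (C.card.choose q : ℝ) := by
  simp [subsetAvg, Finset.sum_boole]

variable [DecidableEq α]

theorem card_filter_inter_eq {A F : Finset α} (hA : A ⊆ C) (hF : F ⊆ A) (hq : F.card ≤ q) :
    ((C.powersetCard q).filter fun Q => Q ∩ A = F).card =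
      (C.card - A.card).choose (q - F.card) := by
  rw [← Finset.card_sdiff_of_subset hA, ← Finset.card_powersetCard]
  apply Finset.card_bij' (fun Q _ => Q \ A) (fun P _ => P ∪ F)
  · intro Q hQ
    simp only [Finset.mem_filter, Finset.mem_powersetCard] at hQ ⊢
    refine ⟨Finset.sdiff_subset_sdiff hQ.1.1 le_rfl, ?_⟩
    have := Finset.card_sdiff_add_card_inter Q A
    rw [hQ.2, hQ.1.2] at this
    omega
  · intro P hP
    simp only [Finset.mem_filter, Finset.mem_powersetCard] at hP ⊢
    have hPA : Disjoint P A :=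
      Finset.disjoint_of_subset_left hP.1 Finset.sdiff_disjoint
    refine ⟨⟨Finset.union_subset (hP.1.trans Finset.sdiff_subset) (hF.trans hA), ?_⟩, ?_⟩
    · rw [Finset.card_union_of_disjoint (Finset.disjoint_of_subset_right hF hPA), hP.2]
      omega
    · rw [Finset.union_inter_distrib_right, Finset.disjoint_iff_inter_eq_empty.1 hPA,
        Finset.empty_union, Finset.inter_eq_left.2 hF]
  · intro Q hQ
    simp only [Finset.mem_filter] at hQ
    rw [← hQ.2, Finset.sdiff_union_inter]
  · intro P hP
    simp only [Finset.mem_powersetCard] at hP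
    have hPA : Disjoint P A :=
      Finset.disjoint_of_subset_left hP.1 Finset.sdiff_disjoint
    rw [Finset.union_sdiff_distrib, Finset.sdiff_eq_empty_iff_subset.2 hF, Finset.union_empty,
      Finset.sdiff_eq_self_of_disjoint hPA]

theorem choose_sub_div_choose {c q a : ℕ} (hq : q ≤ c) (ha : a ≤ q) :
    ((c - a).choose (q - a) : ℝ) / (c.choose q : ℝ) = (q.choose a : ℝ) / (c.choose a : ℝ) := by
  have h1 : (c.choose q : ℝ) ≠ 0 := by exact_mod_cast (Nat.choose_pos hq).ne'
  have h2 : (c.choose a : ℝ) ≠ 0 := by exact_mod_cast (Nat.choose_pos (ha.trans hq)).ne'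
  rw [div_eq_div_iff h1 h2]
  have := Nat.choose_mul (n := c) ha
  have h3 : (c.choose q : ℝ) * (q.choose a : ℝ) =
      (c.choose a : ℝ) * ((c - a).choose (q - a) : ℝ) := by
    exact_mod_cast this
  linarith

theorem choose_div_choose_le {c q : ℕ} (hq : q ≤ c) (a : ℕ) :
    (q.choose a : ℝ) / (c.choose a : ℝ) ≤ ((q : ℝ) / c) ^ a := by
  rcases le_or_gt a q with ha | ha
  · induction a with
    | zero => simp
    | succ a ih =>
      have ih := ih (by omega)
      have hc : 0 < (c.choose a : ℝ) := by exact_mod_cast Nat.choose_pos (by omega)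
      have hc1 : 0 < (c.choose (a + 1) : ℝ) := by exact_mod_cast Nat.choose_pos (by omega)
      have e1 : ((q.choose (a + 1) : ℕ) : ℝ) * (a + 1) = q.choose a * (q - a) := by
        have := Nat.choose_succ_right_eq q a
        rw [← Nat.cast_sub (by omega)]
        exact_mod_cast this
      have e2 : ((c.choose (a + 1) : ℕ) : ℝ) * (a + 1) = c.choose a * (c - a) := by
        have := Nat.choose_succ_right_eq c a
        rw [← Nat.cast_sub (by omega)]
        exact_mod_cast this
      have hqc : (q : ℝ) ≤ c := by exact_mod_cast hq
      have hac : (a : ℝ) < c := by exact_mod_cast (by omega : a < c)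
      have haq : (a : ℝ) < q := by exact_mod_cast (by omega : a < q)
      have ha0 : (0 : ℝ) ≤ a := Nat.cast_nonneg a
      have h3 : (q.choose (a + 1) : ℝ) / (c.choose (a + 1) : ℝ) =
          (q.choose a : ℝ) / (c.choose a : ℝ) * ((q - a) / (c - a)) := by
        rw [div_mul_div_comm, div_eq_div_iff hc1.ne' (mul_pos hc (by linarith)).ne', ← e1, ← e2]
        ring
      rw [h3, pow_succ]
      refine mul_le_mul ih ?_ (div_nonneg (by linarith) (by linarith)) (by positivity)
      rw [div_le_div_iff₀ (by linarith) (by linarith)]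
      nlinarith
  · rw [Nat.choose_eq_zero_of_lt ha]
    simp only [Nat.cast_zero, zero_div]
    positivity

/-- Passing from `m` to `m - a` elements, `m.choose q` shrinks at most by the factor
`(1 - q / (m - a)) ^ a`. -/
theorem pow_mul_choose_le_choose_sub {m q a : ℕ} (ha : a < m) (hq : q ≤ m - a) :
    (1 - (q : ℝ) / ((m - a : ℕ) : ℝ)) ^ a * (m.choose q : ℝ) ≤ ((m - a).choose q : ℝ) := by
  have hma : (0 : ℝ) < ((m - a : ℕ) : ℝ) := by exact_mod_cast (by omega : 0 < m - a)
  have hbase : 0 ≤ 1 - (q : ℝ) / ((m - a : ℕ) : ℝ) := by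
    rw [sub_nonneg, div_le_one hma]
    exact_mod_cast hq
  have key : ∀ r ≤ a, (1 - (q : ℝ) / ((m - a : ℕ) : ℝ)) ^ r * ((m - a + r).choose q : ℝ) ≤
      ((m - a).choose q : ℝ) := by
    intro r hr
    induction r with
    | zero => simp
    | succ r ih =>
      refine le_trans ?_ (ih (by omega))
      rw [pow_succ, mul_assoc]
      refine mul_le_mul_of_nonneg_left ?_ (pow_nonneg hbase _)
      have h1 := Nat.choose_mul_succ_eq (m - a + r) q
      have h2 : ((m - a + r).choose q : ℝ) * ((m - a + r : ℕ) + 1) =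
          ((m - a + r + 1).choose q : ℝ) * (((m - a + r : ℕ) : ℝ) + 1 - q) := by
        have : (((m - a + r + 1 - q : ℕ)) : ℝ) = ((m - a + r : ℕ) : ℝ) + 1 - q := by
          rw [Nat.cast_sub (by omega)]; push_cast; ring
        rw [← this]
        exact_mod_cast h1
      have hM : ((m - a : ℕ) : ℝ) ≤ ((m - a + r : ℕ) : ℝ) + 1 := by
        push_cast
        linarith [(Nat.cast_nonneg r : (0 : ℝ) ≤ r)]
      set M : ℝ := ((m - a + r : ℕ) : ℝ) + 1 with hMdef
      have hM0 : 0 < M := hma.trans_le hM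
      have h3 : ((m - a + r).choose q : ℝ) = ((m - a + r + 1).choose q : ℝ) * (1 - q / M) := by
        field_simp
        linarith
      rw [h3, mul_comm, ← add_assoc]
      refine mul_le_mul_of_nonneg_left ?_ (Nat.cast_nonneg _)
      have : (q : ℝ) / M ≤ q / ((m - a : ℕ) : ℝ) :=
        div_le_div_of_nonneg_left (Nat.cast_nonneg _) hma hM
      linarith
  have := key a le_rfl
  rwa [Nat.sub_add_cancel ha.le] at this

theorem subsetAvg_superset {F : Finset α} (hF : F ⊆ C) (hq : q ≤ C.card) :
    subsetAvg C q (fun Q => if F ⊆ Q then 1 else 0) =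
      (q.choose F.card : ℝ) / (C.card.choose F.card : ℝ) := by
  rw [subsetAvg_indicator]
  rcases le_or_gt F.card q with h | h
  · rw [← choose_sub_div_choose hq h, ← card_filter_inter_eq hF le_rfl h]
    simp only [Finset.inter_eq_right]
  · rw [Nat.choose_eq_zero_of_lt h, Finset.filter_false_of_mem]
    · simp
    · intro Q hQ hFQ
      rw [Finset.mem_powersetCard] at hQ
      have := Finset.card_le_card hFQ
      omega

theorem subsetAvg_superset_le (F : Finset α) (hq : q ≤ C.card) :
    subsetAvg C q (fun Q => if F ⊆ Q then 1 else 0) ≤ ((q : ℝ) / C.card) ^ F.card := by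
  by_cases hF : F ⊆ C
  · rw [subsetAvg_superset hF hq]
    exact choose_div_choose_le hq _
  · rw [subsetAvg_indicator, Finset.filter_false_of_mem]
    · simp only [Finset.card_empty, Nat.cast_zero, zero_div]; positivity
    · intro Q hQ hFQ
      exact hF (hFQ.trans (Finset.mem_powersetCard.1 hQ).1)

theorem subsetAvg_mem {j : α} (hj : j ∈ C) (hq : q ≤ C.card) :
    subsetAvg C q (fun Q => if j ∈ Q then 1 else 0) = (q : ℝ) / C.card := by
  have := subsetAvg_superset (q := q) (Finset.singleton_subset_iff.2 hj) hq
  simpa using this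

theorem subsetAvg_mem_mem {j x : α} (hj : j ∈ C) (hx : x ∈ C) (hne : x ≠ j) (hq : q ≤ C.card) :
    subsetAvg C q (fun Q => if j ∈ Q ∧ x ∈ Q then 1 else 0) =
      (q : ℝ) / C.card * ((q - 1) / (C.card - 1)) := by
  have h1 := subsetAvg_superset (q := q) (F := {j, x}) (C := C)
    (Finset.insert_subset hj (Finset.singleton_subset_iff.2 hx)) hq
  rw [Finset.card_pair hne.symm] at h1
  simp only [Finset.insert_subset_iff, Finset.singleton_subset_iff] at h1
  rw [h1, Nat.cast_choose_two, Nat.cast_choose_two, div_mul_div_comm,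
    div_div_div_cancel_right₀ (by norm_num)]

/-- The probability generating function of the number of elements of `S` in a random subset is
bounded by that of independent choices. -/
theorem subsetAvg_prod_le (S : Finset α) (hq : q ≤ C.card) {A B : ℝ} (hA : 0 ≤ A) (hB : 0 ≤ B) :
    subsetAvg C q (fun Q => ∏ j ∈ S, ((if j ∈ Q then B else 0) + A)) ≤
      (B * (q / C.card) + A) ^ S.card := by
  have h1 : ∀ Q : Finset α, ∏ j ∈ S, ((if j ∈ Q then B else 0) + A) =
      ∑ F ∈ S.powerset, B ^ F.card * A ^ (S.card - F.card) * (if F ⊆ Q then 1 else 0) := by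
    intro Q
    rw [Finset.prod_add]
    refine Finset.sum_congr rfl fun F hF => ?_
    rw [Finset.mem_powerset] at hF
    rw [Finset.prod_const, Finset.card_sdiff_of_subset hF]
    by_cases hFQ : F ⊆ Q
    · rw [Finset.prod_congr rfl fun j hj => if_pos (hFQ hj), Finset.prod_const, if_pos hFQ, mul_one]
    · obtain ⟨j, hj, hjQ⟩ := Finset.not_subset.1 hFQ
      rw [Finset.prod_eq_zero hj (if_neg hjQ), if_neg hFQ]; ring
  simp only [h1]
  rw [subsetAvg_sum]
  have h2 : (B * (q / C.card) + A) ^ S.card =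
      ∑ F ∈ S.powerset, (B * (q / C.card)) ^ F.card * A ^ (S.card - F.card) := by
    rw [Finset.sum_pow_mul_eq_add_pow]
  rw [h2]
  refine Finset.sum_le_sum fun F _ => ?_
  rw [subsetAvg_mul_left, mul_pow]
  calc _ ≤ B ^ F.card * A ^ (S.card - F.card) * ((q : ℝ) / C.card) ^ F.card :=
        mul_le_mul_of_nonneg_left (subsetAvg_superset_le F hq) (by positivity)
    _ = _ := by ring

theorem prod_ite_add (S Q : Finset α) (A B : ℝ) :
    ∏ j ∈ S, ((if j ∈ Q then B else 0) + A) =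
      (B + A) ^ (Q ∩ S).card * A ^ (S \ Q).card := by
  rw [← Finset.prod_sdiff (Finset.inter_subset_right : Q ∩ S ⊆ S), mul_comm]
  congr 1
  · rw [Finset.prod_congr rfl fun j hj => by rw [if_pos (Finset.mem_inter.1 hj).1],
      Finset.prod_const]
  · rw [Finset.inter_comm, Finset.sdiff_inter_self_left, Finset.prod_congr rfl fun j hj => by
      rw [if_neg (Finset.mem_sdiff.1 hj).2, zero_add], Finset.prod_const]

/-- Averaging a function of the number of elements of `S` with respect to the hypergeometric law. -/
theorem subsetAvg_card_inter {S : Finset α} (hS : S ⊆ C) (φ : ℕ → ℝ) :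
    subsetAvg C q (fun Q => φ (Q ∩ S).card) =
      ∑ a ∈ Finset.range (S.card + 1), if a ≤ q then
        ((S.card.choose a : ℝ) * ((C.card - S.card).choose (q - a) : ℝ) /
          (C.card.choose q : ℝ)) * φ a else 0 := by
  have hmaps : ∀ Q ∈ C.powersetCard q, (Q ∩ S).card ∈ Finset.range (S.card + 1) := by
    intro Q _
    rw [Finset.mem_range, Nat.lt_succ_iff]
    exact Finset.card_le_card Finset.inter_subset_right
  rw [subsetAvg, ← Finset.sum_fiberwise_of_maps_to hmaps, Finset.sum_div]
  refine Finset.sum_congr rfl fun a _ => ?_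
  have h1 : ∑ Q ∈ (C.powersetCard q).filter (fun Q => (Q ∩ S).card = a), φ (Q ∩ S).card =
      ((C.powersetCard q).filter fun Q => (Q ∩ S).card = a).card * φ a := by
    rw [← nsmul_eq_mul, ← Finset.sum_const]
    exact Finset.sum_congr rfl fun Q hQ => by rw [(Finset.mem_filter.1 hQ).2]
  rw [h1]
  split_ifs with ha
  · have h2 : ((C.powersetCard q).filter fun Q => (Q ∩ S).card = a).card =
        S.card.choose a * (C.card - S.card).choose (q - a) := by
      rw [Finset.card_eq_sum_card_fiberwise (t := S.powersetCard a) (f := fun Q => Q ∩ S)]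
      · rw [Finset.sum_congr rfl (g := fun _ => (C.card - S.card).choose (q - a))]
        · simp
        · intro F hF
          rw [Finset.mem_powersetCard] at hF
          rw [Finset.filter_filter, ← hF.2, ← card_filter_inter_eq hS hF.1 (hF.2.trans_le ha)]
          congr 1
          ext Q
          simp only [Finset.mem_filter]
          constructor
          · rintro ⟨h, -, h'⟩; exact ⟨h, h'⟩
          · rintro ⟨h, h'⟩; exact ⟨h, by rw [h'], h'⟩
      · intro Q hQ
        simp only [Finset.coe_filter, Set.mem_ofPred_eq] at hQ
        simp only [Finset.mem_coe, Finset.mem_powersetCard]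
        exact ⟨Finset.inter_subset_right, hQ.2⟩
    rw [h2]; push_cast; ring
  · rw [Finset.filter_false_of_mem]
    · simp
    · intro Q hQ h
      rw [Finset.mem_powersetCard] at hQ
      have := Finset.card_le_card (Finset.inter_subset_left : Q ∩ S ⊆ Q)
      omega

/-! ### Few nonzero columns in a random subset -/

/-- If the expected number of further elements of `K` in a random subset containing `j` is at most
`(1 - p) T`, then by Markov's inequality there are fewer than `T` of them with probability at
least `p`. -/
theorem le_subsetAvg_of_markov {j : α} {K : Finset α} {T : ℕ} {p : ℝ} (hj : j ∈ C) (hjK : j ∈ K)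
    (hT : 1 ≤ T) (hq1 : 1 ≤ q) (hq : q ≤ C.card) (hC : 2 ≤ C.card)
    (h : ((K.card : ℝ) - 1) * (q - 1) ≤ (1 - p) * T * (C.card - 1)) :
    q / C.card * p ≤ subsetAvg C q (fun Q => if j ∈ Q ∧ (Q ∩ K).card ≤ T then 1 else 0) := by
  have hT0 : (0 : ℝ) < T := by exact_mod_cast hT
  have hC1 : (0 : ℝ) < (C.card : ℝ) - 1 := by
    have : (2 : ℝ) ≤ C.card := by exact_mod_cast hC
    linarith
  have hq1' : (0 : ℝ) ≤ (q : ℝ) - 1 := by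
    have : (1 : ℝ) ≤ q := by exact_mod_cast hq1
    linarith
  have hpt : ∀ Q ∈ C.powersetCard q, (if j ∈ Q then (1 : ℝ) else 0) -
      (T : ℝ)⁻¹ * ∑ x ∈ (K ∩ C).erase j, (if j ∈ Q ∧ x ∈ Q then (1 : ℝ) else 0) ≤
      if j ∈ Q ∧ (Q ∩ K).card ≤ T then 1 else 0 := by
    intro Q hQ
    rw [Finset.mem_powersetCard] at hQ
    by_cases hjQ : j ∈ Q
    · simp only [hjQ, true_and, if_true]
      have h1 : ∑ x ∈ (K ∩ C).erase j, (if x ∈ Q then (1 : ℝ) else 0) = ((Q ∩ K).card : ℝ) - 1 := by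
        rw [Finset.sum_boole]
        have : ((K ∩ C).erase j).filter (· ∈ Q) = (Q ∩ K).erase j := by
          ext x
          simp only [Finset.mem_filter, Finset.mem_erase, Finset.mem_inter]
          constructor
          · rintro ⟨⟨a, b, c⟩, d⟩; exact ⟨a, d, b⟩
          · rintro ⟨a, b, c⟩; exact ⟨⟨a, c, hQ.1 b⟩, b⟩
        rw [this, Finset.card_erase_of_mem (Finset.mem_inter.2 ⟨hjQ, hjK⟩), Nat.cast_sub,
          Nat.cast_one]
        exact Finset.card_pos.2 ⟨j, Finset.mem_inter.2 ⟨hjQ, hjK⟩⟩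
      rw [h1]
      split_ifs with hc
      · have : (1 : ℝ) ≤ (Q ∩ K).card := by
          exact_mod_cast Finset.card_pos.2 ⟨j, Finset.mem_inter.2 ⟨hjQ, hjK⟩⟩
        have : 0 ≤ (T : ℝ)⁻¹ * (((Q ∩ K).card : ℝ) - 1) := mul_nonneg (by positivity) (by linarith)
        linarith
      · have : (T : ℝ) + 1 ≤ (Q ∩ K).card := by exact_mod_cast (by omega : T + 1 ≤ (Q ∩ K).card)
        have h3 : (T : ℝ)⁻¹ * T ≤ (T : ℝ)⁻¹ * (((Q ∩ K).card : ℝ) - 1) :=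
          mul_le_mul_of_nonneg_left (by linarith) (by positivity)
        rw [inv_mul_cancel₀ hT0.ne'] at h3
        linarith
    · simp [hjQ]
  refine le_trans ?_ (subsetAvg_mono hpt)
  rw [subsetAvg_sub, subsetAvg_mem hj hq, subsetAvg_mul_left, subsetAvg_sum]
  have h2 : ∑ x ∈ (K ∩ C).erase j, subsetAvg C q (fun Q => if j ∈ Q ∧ x ∈ Q then 1 else 0) ≤
      (K.card - 1) * ((q : ℝ) / C.card * ((q - 1) / (C.card - 1))) := by
    rw [Finset.sum_congr rfl fun x hx => subsetAvg_mem_mem hj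
      (Finset.mem_inter.1 (Finset.mem_of_mem_erase hx)).2 (Finset.ne_of_mem_erase hx) hq,
      Finset.sum_const, nsmul_eq_mul]
    refine mul_le_mul_of_nonneg_right ?_ (by positivity)
    rw [Finset.card_erase_of_mem (Finset.mem_inter.2 ⟨hjK, hj⟩),
      Nat.cast_sub (Finset.card_pos.2 ⟨j, Finset.mem_inter.2 ⟨hjK, hj⟩⟩), Nat.cast_one]
    have : ((K ∩ C).card : ℝ) ≤ K.card := by
      exact_mod_cast Finset.card_le_card Finset.inter_subset_left
    linarith
  have h3 : (T : ℝ)⁻¹ * ((K.card - 1) * ((q : ℝ) / C.card * ((q - 1) / (C.card - 1)))) ≤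
      (q : ℝ) / C.card * (1 - p) := by
    have e : (T : ℝ)⁻¹ * ((K.card - 1) * ((q : ℝ) / C.card * ((q - 1) / (C.card - 1)))) =
        (q : ℝ) / C.card * (((K.card : ℝ) - 1) * (q - 1) / (T * (C.card - 1))) := by
      field_simp
    rw [e]
    refine mul_le_mul_of_nonneg_left ?_ (by positivity)
    rw [div_le_iff₀ (by positivity)]
    linarith
  have h4 := mul_le_mul_of_nonneg_left h2 (inv_nonneg.2 hT0.le)
  linarith

/-- A random subset contains `j` and no further element of `K` with probability at least
`q / |C| * (1 - (q - 1) / (|C| - |K|)) ^ |K|`. -/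
theorem le_subsetAvg_of_avoid {j : α} {K : Finset α} {T : ℕ} (hj : j ∈ C) (hjK : j ∈ K)
    (hT : 1 ≤ T) (hq1 : 1 ≤ q) (hK : K.card < C.card) (hq : q ≤ C.card - K.card) :
    q / C.card * (1 - ((q : ℝ) - 1) / (C.card - K.card)) ^ K.card ≤
      subsetAvg C q (fun Q => if j ∈ Q ∧ (Q ∩ K).card ≤ T then 1 else 0) := by
  set A := K ∩ C with hA
  have hjA : j ∈ A := Finset.mem_inter.2 ⟨hjK, hj⟩
  have hAC : A ⊆ C := Finset.inter_subset_right
  have hAK : A.card ≤ K.card := Finset.card_le_card Finset.inter_subset_left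
  have hA1 : 1 ≤ A.card := Finset.card_pos.2 ⟨j, hjA⟩
  have h1 : subsetAvg C q (fun Q => if Q ∩ A = {j} then 1 else 0) ≤
      subsetAvg C q (fun Q => if j ∈ Q ∧ (Q ∩ K).card ≤ T then 1 else 0) := by
    refine subsetAvg_mono fun Q hQ => ?_
    rw [Finset.mem_powersetCard] at hQ
    by_cases h : Q ∩ A = {j}
    · have h2 : Q ∩ K = {j} := by
        rw [← h, hA, Finset.inter_comm K C, ← Finset.inter_assoc, Finset.inter_eq_left.2 hQ.1]
      have h3 : j ∈ Q := by
        have : j ∈ Q ∩ A := by rw [h]; simp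
        exact (Finset.mem_inter.1 this).1
      rw [if_pos h, if_pos ⟨h3, by rw [h2]; simpa using hT⟩]
    · rw [if_neg h]; split_ifs <;> norm_num
  refine le_trans ?_ h1
  rw [subsetAvg_indicator, card_filter_inter_eq hAC (Finset.singleton_subset_iff.2 hjA)
    (by simpa using hq1), Finset.card_singleton]
  have hc : C.card - A.card = (C.card - 1) - (A.card - 1) := by omega
  have h2 := pow_mul_choose_le_choose_sub (m := C.card - 1) (q := q - 1) (a := A.card - 1)
    (by omega) (by omega)
  rw [← hc] at h2
  have h3 : ((C.card - 1).choose (q - 1) : ℝ) / (C.card.choose q : ℝ) = q / C.card := by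
    have := choose_sub_div_choose (c := C.card) (q := q) (a := 1) (by omega) hq1
    simpa using this
  have hpos : (0 : ℝ) < C.card.choose q := by exact_mod_cast Nat.choose_pos (by omega)
  have hden : (0 : ℝ) < (C.card : ℝ) - K.card := by
    have : (K.card : ℝ) < C.card := by exact_mod_cast hK
    linarith
  have hq' : ((q - 1 : ℕ) : ℝ) = (q : ℝ) - 1 := by rw [Nat.cast_sub hq1, Nat.cast_one]
  have hcA : ((C.card - A.card : ℕ) : ℝ) = (C.card : ℝ) - A.card := by
    rw [Nat.cast_sub (by omega)]
  have hqr : (q : ℝ) ≤ (C.card : ℝ) - K.card := by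
    rw [← Nat.cast_sub hK.le]; exact_mod_cast hq
  have hq1r : (1 : ℝ) ≤ q := by exact_mod_cast hq1
  have hAKr : (A.card : ℝ) ≤ K.card := by exact_mod_cast hAK
  have hb0 : 0 ≤ 1 - ((q : ℝ) - 1) / (C.card - K.card) := by
    rw [sub_nonneg, div_le_one hden]; linarith
  have hb1 : 1 - ((q : ℝ) - 1) / (C.card - K.card) ≤ 1 := by
    have : 0 ≤ ((q : ℝ) - 1) / (C.card - K.card) := div_nonneg (by linarith) hden.le
    linarith
  have h4 : (1 - ((q : ℝ) - 1) / (C.card - K.card)) ^ K.card ≤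
      (1 - ((q - 1 : ℕ) : ℝ) / ((C.card - A.card : ℕ) : ℝ)) ^ (A.card - 1) := by
    refine (pow_le_pow_of_le_one hb0 hb1 (by omega : A.card - 1 ≤ K.card)).trans ?_
    refine pow_le_pow_left₀ hb0 ?_ _
    rw [hq', hcA]
    have : ((q : ℝ) - 1) / (C.card - A.card) ≤ ((q : ℝ) - 1) / (C.card - K.card) :=
      div_le_div_of_nonneg_left (by linarith) hden (by linarith)
    linarith
  rw [← h3, div_mul_eq_mul_div]
  refine div_le_div_of_nonneg_right ?_ hpos.le
  rw [mul_comm]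
  exact (mul_le_mul_of_nonneg_right h4 (Nat.cast_nonneg _)).trans h2

end SubsetAvg

/-! ### Small stopping sets -/

theorem choose_mul_choose_comm (m p r : ℕ) :
    m.choose p * (m - p).choose r = m.choose r * (m - r).choose p := by
  have h1 := Nat.choose_mul (n := m) (k := p + r) (s := p) (Nat.le_add_right p r)
  have h2 := Nat.choose_mul (n := m) (k := p + r) (s := r) (Nat.le_add_left r p)
  rw [Nat.add_sub_cancel_left] at h1
  rw [Nat.add_sub_cancel] at h2
  rw [← h1, ← h2, Nat.choose_symm_add]

/-- The hypergeometric law is symmetric in the sizes of the two sets. -/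
theorem hypergeometric_symm {c u q b : ℕ} (hbu : b ≤ u) (hbq : b ≤ q) :
    u.choose b * (c - u).choose (q - b) * c.choose u =
      q.choose b * (c - q).choose (u - b) * c.choose q := by
  have h1 := Nat.choose_mul (n := c) hbu
  have h2 := Nat.choose_mul (n := c) hbq
  have h3 := choose_mul_choose_comm (c - b) (u - b) (q - b)
  have e1 : c - b - (u - b) = c - u := by omega
  have e2 : c - b - (q - b) = c - q := by omega
  rw [e1, e2] at h3
  calc u.choose b * (c - u).choose (q - b) * c.choose u
      = (c.choose u * u.choose b) * (c - u).choose (q - b) := by ring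
    _ = c.choose b * ((c - b).choose (u - b) * (c - u).choose (q - b)) := by rw [h1]; ring
    _ = (c.choose q * q.choose b) * (c - q).choose (u - b) := by rw [h3, h2]; ring
    _ = _ := by ring

/-- The generating function of the numbers of columns in which a row may meet a stopping set: the
coefficient of `y ^ a` counts the possible intersections with `a` elements. -/
def stopGen (T L : ℕ) (y : ℝ) : ℝ :=
  ∑ a ∈ Finset.range (L + 1), if a = 0 ∨ T < a then (L.choose a : ℝ) * y ^ a else 0

/-- The weight of a set of `p` columns of smallest degree that contains `u` columns of the
stopping set. The rows to come split these `p` columns into sets of size `L`, each of which may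
contain `0` or more than `T` of the `u` columns; this leaves at most the coefficient of `y ^ u` in
`stopGen T L y ^ (p / L)` out of `p.choose u` possible positions. Up to the powers of `stopGen`,
the weight is the resulting bound for the conditional probability. -/
def stopWeight (y : ℝ) (p u : ℕ) : ℝ := y⁻¹ ^ u / (p.choose u : ℝ)

theorem stopWeight_nonneg {y : ℝ} (hy : 0 < y) (p u : ℕ) : 0 ≤ stopWeight y p u := by
  unfold stopWeight; positivity

theorem stopGen_nonneg {y : ℝ} (hy : 0 < y) (T L : ℕ) : 0 ≤ stopGen T L y :=
  Finset.sum_nonneg fun a _ => by split_ifs <;> positivity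

theorem stopWeight_mul_le {y : ℝ} (hy : 0 < y) {c u q b : ℕ} (hbu : b ≤ u) (hbq : b ≤ q)
    (hu : u ≤ c) (hq : q ≤ c) :
    ((u.choose b : ℝ) * ((c - u).choose (q - b) : ℝ) / (c.choose q : ℝ)) *
      stopWeight y (c - q) (u - b) ≤ stopWeight y c u * ((q.choose b : ℝ) * y ^ b) := by
  have hcq : (0 : ℝ) < c.choose q := by exact_mod_cast Nat.choose_pos hq
  have hcu : (0 : ℝ) < c.choose u := by exact_mod_cast Nat.choose_pos hu
  rcases Nat.eq_zero_or_pos ((c - q).choose (u - b)) with h0 | h0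
  · simp only [stopWeight, h0, Nat.cast_zero, div_zero, mul_zero]
    positivity
  · have h0' : (0 : ℝ) < (c - q).choose (u - b) := by exact_mod_cast h0
    have h1 : (u.choose b : ℝ) * ((c - u).choose (q - b) : ℝ) * (c.choose u : ℝ) =
        (q.choose b : ℝ) * ((c - q).choose (u - b) : ℝ) * (c.choose q : ℝ) := by
      exact_mod_cast hypergeometric_symm hbu hbq
    have h2 : y⁻¹ ^ (u - b) = y⁻¹ ^ u * y ^ b := by
      rw [← Nat.sub_add_cancel hbu, pow_add, Nat.add_sub_cancel, mul_assoc, ← mul_pow,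
        inv_mul_cancel₀ hy.ne', one_pow, mul_one]
    apply le_of_eq
    unfold stopWeight
    rw [h2, div_mul_div_comm, div_mul_eq_mul_div, div_eq_div_iff (by positivity) hcu.ne']
    linear_combination (y⁻¹ ^ u * y ^ b) * h1

section Potential

variable {n D L T : ℕ}

open Classical in
/-- The potential used to bound the probability that `S` is a stopping set: the weight of the
columns that have the smallest degree before row `i`, or `0` if an earlier row meets `S` in between
`1` and `T` columns. -/
def stopPotential (T L : ℕ) (y : ℝ) (S : Finset (Fin n)) (i : ℕ) (ω : Sample n D) : ℝ :=
  if Stopping T L ω i S then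
    stopWeight y (minSet L ω i).card (minSet L ω i ∩ S).card else 0

theorem past_stopping (T L i : ℕ) (S : Finset (Fin n)) :
    Past i fun ω : Sample n D => Stopping T L ω i S := by
  intro ω ω' hω
  simp only [Stopping, eq_iff_iff]
  refine forall₂_congr fun i' hi' => ?_
  have h : rowSupport L ω i' = rowSupport L ω' i' := past_rowSupport L hi' ω ω' hω
  rw [h]

theorem stopping_succ {ω : Sample n D} {i : ℕ} {S : Finset (Fin n)} :
    Stopping T L ω (i + 1) S ↔ Stopping T L ω i S ∧
      ((rowSupport L ω i ∩ S).card = 0 ∨ T < (rowSupport L ω i ∩ S).card) := by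
  unfold Stopping
  constructor
  · exact fun h => ⟨fun i' hi' => h i' (by omega), h i (Nat.lt_succ_self i)⟩
  · rintro ⟨h1, h2⟩ i' hi'
    rcases Nat.lt_succ_iff_lt_or_eq.1 hi' with h | rfl
    · exact h1 i' h
    · exact h2

/-- A row within the columns of smallest degree multiplies the expected potential at most by the
generating function. -/
theorem lintegral_stopPotential_of_lt (hn : 0 < n) (hL : L ≤ n) {i : ℕ}
    (hi : L < n - i * L % n) {y : ℝ} (hy : 0 < y) (S : Finset (Fin n)) :
    ∫⁻ ω, ENNReal.ofReal (stopPotential T L y S (i + 1) ω) ∂seedLaw n D ≤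
      ∫⁻ ω, ENNReal.ofReal (stopGen T L y * stopPotential T L y S i ω) ∂seedLaw n D := by
  classical
  let F : Sample n D → Finset (Fin n) → ℝ := fun ω R =>
    if Stopping T L ω i S ∧ ((R ∩ S).card = 0 ∨ T < (R ∩ S).card) then
      stopWeight y (minSet L ω i \ R).card ((minSet L ω i \ R) ∩ S).card else 0
  have hF : ∀ ω, stopPotential T L y S (i + 1) ω = F ω (rowSupport L ω i) := by
    intro ω
    simp only [stopPotential, F, stopping_succ, minSet_succ_of_lt hn hL hi]
  simp only [hF]
  refine lintegral_row_le_of_lt hn hL hi ?_ ?_ ?_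
  · intro R ω ω' hω
    have h1 : Stopping T L ω i S = Stopping T L ω' i S := past_stopping T L i S ω ω' hω
    have h2 : minSet L ω i = minSet L ω' i := past_minSet L i ω ω' hω
    simp only [F, h1, h2]
  · intro ω R
    simp only [F]
    split_ifs
    · exact stopWeight_nonneg hy _ _
    · exact le_rfl
  · intro ω
    have hcard := card_minSet (ω := ω) hn hL i
    set M := minSet L ω i with hM
    have hLM : L ≤ M.card := by rw [hcard]; exact hi.le
    by_cases hs : Stopping T L ω i S
    swap
    · have : F ω = fun _ => 0 := by funext R; simp [F, hs]
      rw [this, subsetAvg_const hLM]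
      simp [stopPotential, hs]
    set u := (M ∩ S).card with hu
    have huM : u ≤ M.card := Finset.card_le_card Finset.inter_subset_left
    let φ : ℕ → ℝ := fun a => if a = 0 ∨ T < a then stopWeight y (M.card - L) (u - a) else 0
    have h1 : subsetAvg M L (F ω) ≤ subsetAvg M L fun Q => φ (Q ∩ (M ∩ S)).card := by
      refine subsetAvg_mono fun Q hQ => le_of_eq ?_
      rw [Finset.mem_powersetCard] at hQ
      have e1 : Q ∩ (M ∩ S) = Q ∩ S := by
        rw [← Finset.inter_assoc, Finset.inter_eq_left.2 hQ.1]
      have e2 : ((M \ Q) ∩ S).card = u - (Q ∩ S).card := by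
        have : (M \ Q) ∩ S = (M ∩ S) \ (Q ∩ S) := by
          ext x; simp only [Finset.mem_inter, Finset.mem_sdiff]; tauto
        rw [this, Finset.card_sdiff_of_subset (Finset.inter_subset_inter_right hQ.1)]
      simp only [F, φ, e1, hs, true_and, ← hM, e2, Finset.card_sdiff_of_subset hQ.1, hQ.2]
    refine h1.trans ?_
    rw [subsetAvg_card_inter Finset.inter_subset_left]
    have h2 : stopPotential T L y S i ω = stopWeight y M.card u := by
      simp [stopPotential, hs, ← hM, ← hu]
    rw [h2, stopGen, Finset.sum_mul]
    have h3 : ∀ a ∈ Finset.range (u + 1), (if a ≤ L then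
        ((u.choose a : ℝ) * ((M.card - u).choose (L - a) : ℝ) / (M.card.choose L : ℝ)) * φ a
          else 0) ≤ if a ≤ L then (if a = 0 ∨ T < a then (L.choose a : ℝ) * y ^ a else 0) *
            stopWeight y M.card u else 0 := by
      intro a ha
      rw [Finset.mem_range] at ha
      by_cases haL : a ≤ L
      · simp only [haL, if_true, φ]
        by_cases hok : a = 0 ∨ T < a
        · simp only [hok, if_true]
          have := stopWeight_mul_le hy (by omega : a ≤ u) haL huM hLM
          linarith
        · simp [hok]
      · simp [haL]
    refine (Finset.sum_le_sum h3).trans ?_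
    rw [← Finset.sum_filter]
    refine Finset.sum_le_sum_of_subset_of_nonneg ?_ ?_
    · intro a ha
      rw [Finset.mem_filter] at ha
      rw [Finset.mem_range]; omega
    · intro a _ _
      refine mul_nonneg ?_ (stopWeight_nonneg hy _ _)
      split_ifs <;> positivity

theorem stopWeight_le_pow {y : ℝ} (hy : 0 < y) {p u t : ℕ} (hu : u ≤ p) (hut : u ≤ t)
    {m : ℝ} (hm : 0 < m) (hmp : m ≤ p) : stopWeight y p u ≤ (t / (y * m)) ^ u := by
  have h1 := choose_div_choose_le hu u
  rw [Nat.choose_self, Nat.cast_one] at h1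
  have h2 : ((u : ℝ) / p) ^ u ≤ (t / m) ^ u := by
    refine pow_le_pow_left₀ (by positivity) ?_ _
    have : (u : ℝ) ≤ t := by exact_mod_cast hut
    exact div_le_div₀ (by positivity) this hm hmp
  calc stopWeight y p u = y⁻¹ ^ u * (1 / (p.choose u : ℝ)) := by unfold stopWeight; ring
    _ ≤ y⁻¹ ^ u * (t / m) ^ u := mul_le_mul_of_nonneg_left (h1.trans h2) (by positivity)
    _ = _ := by rw [← mul_pow]; congr 1; field_simp

theorem exp_neg_le_stopWeight {y : ℝ} (hy : 0 < y) {p u : ℕ} (hup : u ≤ p) (hp : p ≤ L) :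
    Real.exp (-(y * L)) ≤ stopWeight y p u := by
  have h1 : (p.choose u : ℝ) ≤ (L : ℝ) ^ u / (u.factorial : ℝ) := by
    refine (Nat.choose_le_pow_div u p).trans ?_
    gcongr
  have h2 := Real.pow_div_factorial_le_exp (x := y * L) (by positivity) u
  have hc : (0 : ℝ) < p.choose u := by exact_mod_cast Nat.choose_pos hup
  unfold stopWeight
  rw [Real.exp_neg, inv_pow, ← one_div, ← one_div, div_div, div_le_div_iff₀ (Real.exp_pos _)
    (by positivity), one_mul, one_mul]
  calc y ^ u * (p.choose u : ℝ) ≤ y ^ u * ((L : ℝ) ^ u / (u.factorial : ℝ)) :=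
        mul_le_mul_of_nonneg_left h1 (by positivity)
    _ = (y * L) ^ u / (u.factorial : ℝ) := by rw [mul_pow]; ring
    _ ≤ _ := h2

/-- A row that exhausts the columns of smallest degree makes the expected potential small. Before
this row the weight is at least `exp (-y L)` and afterwards a column of `S` contributes a factor
`|S| / (y n / 2)`, unless it is in the row, which has probability at most `L / n`. -/
theorem lintegral_stopPotential_of_le (hn : 0 < n) (hL : 2 * L ≤ n) {i : ℕ}
    (hi : n - i * L % n ≤ L) {y : ℝ} (hy : 0 < y) (S : Finset (Fin n)) :
    ∫⁻ ω, ENNReal.ofReal (stopPotential T L y S (i + 1) ω) ∂seedLaw n D ≤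
      ∫⁻ ω, ENNReal.ofReal (((L : ℝ) / n + S.card / (y * (n / 2))) ^ S.card *
        Real.exp (y * L) * stopPotential T L y S i ω) ∂seedLaw n D := by
  classical
  have hL' : L ≤ n := by omega
  have hn' : (0 : ℝ) < n := by exact_mod_cast hn
  let F : Sample n D → Finset (Fin n) → ℝ := fun ω R =>
    if Stopping T L ω i S ∧ ((R ∩ S).card = 0 ∨ T < (R ∩ S).card) then
      stopWeight y ((R \ minSet L ω i)ᶜ).card ((R \ minSet L ω i)ᶜ ∩ S).card else 0
  have hF : ∀ ω, stopPotential T L y S (i + 1) ω = F ω (rowSupport L ω i) := by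
    intro ω
    simp only [stopPotential, F, stopping_succ, minSet_succ_of_le hn hL' hi]
  simp only [hF]
  refine lintegral_row_le_of_le hn hL' hi ?_ ?_ ?_
  · intro R ω ω' hω
    have h1 : Stopping T L ω i S = Stopping T L ω' i S := past_stopping T L i S ω ω' hω
    have h2 : minSet L ω i = minSet L ω' i := past_minSet L i ω ω' hω
    simp only [F, h1, h2]
  · intro ω R
    simp only [F]
    split_ifs
    · exact stopWeight_nonneg hy _ _
    · exact le_rfl
  · intro ω
    have hcard := card_minSet (ω := ω) hn hL' i
    set M := minSet L ω i with hM
    have hML : M.card ≤ L := by rw [hcard]; exact hi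
    have hMc : Mᶜ.card = n - M.card := by rw [Finset.card_compl, Fintype.card_fin]
    have hq : L - M.card ≤ Mᶜ.card := by omega
    by_cases hs : Stopping T L ω i S
    swap
    · have : (fun Q => F ω (M ∪ Q)) = fun _ => 0 := by funext R; simp [F, hs]
      rw [this, subsetAvg_const hq]
      simp [stopPotential, hs]
    set d : ℝ := S.card / (y * (n / 2)) with hd
    have hd0 : 0 ≤ d := by positivity
    have h1 : subsetAvg Mᶜ (L - M.card) (fun Q => F ω (M ∪ Q)) ≤
        subsetAvg Mᶜ (L - M.card) (fun Q => ∏ j ∈ S, ((if j ∈ Q then 1 else 0) + d)) := by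
      refine subsetAvg_mono fun Q hQ => ?_
      rw [Finset.mem_powersetCard] at hQ
      rw [prod_ite_add]
      have e1 : (M ∪ Q) \ M = Q := by
        rw [Finset.union_sdiff_left, Finset.sdiff_eq_self_iff_disjoint]
        rw [Finset.disjoint_left]
        exact fun x hx hx' => Finset.mem_compl.1 (hQ.1 hx) hx'
      have e2 : Qᶜ ∩ S = S \ Q := by
        ext x; simp only [Finset.mem_inter, Finset.mem_compl, Finset.mem_sdiff]; tauto
      have e3 : Qᶜ.card = n - (L - M.card) := by
        rw [Finset.card_compl, Fintype.card_fin, hQ.2]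
      have h2 : F ω (M ∪ Q) ≤ stopWeight y Qᶜ.card (S \ Q).card := by
        simp only [F, ← hM, e1, e2]
        split_ifs
        · exact le_rfl
        · exact stopWeight_nonneg hy _ _
      refine h2.trans ?_
      have h3 : stopWeight y Qᶜ.card (S \ Q).card ≤ d ^ (S \ Q).card := by
        refine stopWeight_le_pow hy ?_ (Finset.card_le_card Finset.sdiff_subset) (by positivity) ?_
        · rw [← e2]; exact Finset.card_le_card Finset.inter_subset_left
        · rw [e3, Nat.cast_sub (by omega), Nat.cast_sub hML]
          have : (2 : ℝ) * L ≤ n := by exact_mod_cast hL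
          have : (0 : ℝ) ≤ M.card := Nat.cast_nonneg _
          linarith
      refine h3.trans ?_
      have : (1 : ℝ) ≤ (1 + d) ^ (Q ∩ S).card := one_le_pow₀ (by linarith)
      exact le_mul_of_one_le_left (by positivity) this
    refine h1.trans ((subsetAvg_prod_le S hq hd0 zero_le_one).trans ?_)
    have hp : stopPotential T L y S i ω = stopWeight y M.card (M ∩ S).card := by
      simp [stopPotential, hs, ← hM]
    have h4 := exp_neg_le_stopWeight (L := L) hy
      (Finset.card_le_card (Finset.inter_subset_left : M ∩ S ⊆ M)) hML
    have h5 : 1 ≤ Real.exp (y * L) * stopPotential T L y S i ω := by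
      rw [hp]
      calc (1 : ℝ) = Real.exp (y * L) * Real.exp (-(y * L)) := by rw [← Real.exp_add]; simp
        _ ≤ _ := mul_le_mul_of_nonneg_left h4 (Real.exp_pos _).le
    rw [mul_assoc]
    refine le_trans ?_ (le_mul_of_one_le_right (by positivity) h5)
    refine pow_le_pow_left₀ (by positivity) ?_ _
    have h6 : ((L - M.card : ℕ) : ℝ) / Mᶜ.card ≤ (L : ℝ) / n := by
      rcases Nat.eq_zero_or_pos Mᶜ.card with h0 | h0
      · rw [h0]; simp; positivity
      · rw [div_le_div_iff₀ (by exact_mod_cast h0) hn', hMc, Nat.cast_sub hML,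
          Nat.cast_sub (by omega)]
        have : (L : ℝ) ≤ n := by exact_mod_cast hL'
        have : (0 : ℝ) ≤ M.card := Nat.cast_nonneg _
        nlinarith
    linarith

theorem lintegral_stopPotential_le (hn : 0 < n) (hL : 2 * L ≤ n) {y : ℝ} (hy : 0 < y)
    (S : Finset (Fin n)) (i : ℕ) (hψ : 1 ≤ stopGen T L y) :
    ∫⁻ ω, ENNReal.ofReal (stopPotential T L y S i ω) ∂seedLaw n D ≤
      ENNReal.ofReal (stopGen T L y ^ i * (((L : ℝ) / n + S.card / (y * (n / 2))) ^ S.card *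
        Real.exp (y * L)) ^ (i * L / n) * (S.card / (y * n)) ^ S.card) := by
  have hn' : (0 : ℝ) < n := by exact_mod_cast hn
  have hprob : IsProbabilityMeasure (seedLaw n D) := by unfold seedLaw; infer_instance
  set B : ℝ := ((L : ℝ) / n + S.card / (y * (n / 2))) ^ S.card * Real.exp (y * L) with hB
  have hB0 : 0 ≤ B := by positivity
  have hψ0 := stopGen_nonneg hy T L
  induction i with
  | zero =>
    have h1 : ∀ ω : Sample n D, stopPotential T L y S 0 ω ≤ (S.card / (y * n)) ^ S.card := by
      intro ω
      have hM : minSet L ω 0 = Finset.univ := by ext j; simp [minSet, degrees]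
      have hs : Stopping T L ω 0 S := fun i hi => absurd hi (Nat.not_lt_zero i)
      simp only [stopPotential, hs, if_true, hM, Finset.univ_inter]
      exact stopWeight_le_pow hy (Finset.card_le_univ S) le_rfl hn' (by simp)
    calc _ ≤ ∫⁻ _, ENNReal.ofReal ((S.card / (y * n)) ^ S.card) ∂seedLaw n D :=
          lintegral_mono fun ω => ENNReal.ofReal_le_ofReal (h1 ω)
      _ = _ := by simp
  | succ i ih =>
    rcases lt_or_ge L (n - i * L % n) with hlt | hge
    · refine (lintegral_stopPotential_of_lt hn (by omega) hlt hy S).trans ?_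
      simp only [ENNReal.ofReal_mul hψ0]
      rw [lintegral_const_mul' _ _ ENNReal.ofReal_ne_top]
      refine (mul_le_mul_right ih _).trans ?_
      rw [← ENNReal.ofReal_mul hψ0, succ_mul_div_of_lt hn hlt]
      exact ENNReal.ofReal_le_ofReal (le_of_eq (by ring))
    · refine (lintegral_stopPotential_of_le hn hL hge hy S).trans ?_
      simp only [← hB, ENNReal.ofReal_mul hB0]
      rw [lintegral_const_mul' _ _ ENNReal.ofReal_ne_top]
      refine (mul_le_mul_right ih _).trans ?_
      rw [← ENNReal.ofReal_mul hB0, succ_mul_div_of_le hn (by omega) hge]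
      refine ENNReal.ofReal_le_ofReal ?_
      have h1 : stopGen T L y ^ i ≤ stopGen T L y ^ (i + 1) :=
        pow_le_pow_right₀ hψ (Nat.le_succ i)
      calc B * (stopGen T L y ^ i * B ^ (i * L / n) * (S.card / (y * n)) ^ S.card)
          = stopGen T L y ^ i * (B ^ (i * L / n + 1) * (S.card / (y * n)) ^ S.card) := by ring
        _ ≤ stopGen T L y ^ (i + 1) * (B ^ (i * L / n + 1) * (S.card / (y * n)) ^ S.card) :=
          mul_le_mul_of_nonneg_right h1 (by positivity)
        _ = _ := by ring

theorem one_le_stopGen {y : ℝ} (hy : 0 < y) : 1 ≤ stopGen T L y := by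
  unfold stopGen
  have := Finset.single_le_sum (f := fun a => if a = 0 ∨ T < a then (L.choose a : ℝ) * y ^ a else 0)
    (s := Finset.range (L + 1)) (fun a _ => by split_ifs <;> positivity)
    (Finset.mem_range.2 (Nat.succ_pos L))
  simpa using this

/-- Stirling-type estimate of the generating function at `y L = (T + 1) r / e`. -/
theorem stopGen_le (hT : 1 ≤ T) (hL : 0 < L) {r : ℝ} (hr0 : 0 < r) (hr1 : r ≤ 1) :
    stopGen T L ((T + 1) * r / Real.exp 1 / L) ≤ Real.exp (r ^ 2) := by
  have hL' : (0 : ℝ) < L := by exact_mod_cast hL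
  set y : ℝ := (T + 1) * r / Real.exp 1 / L with hy
  have hy0 : 0 < y := by positivity
  have hyL : y * L = (T + 1) * (r / Real.exp 1) := by rw [hy]; field_simp
  have hre : r / Real.exp 1 ≤ 1 := by
    rw [div_le_one (Real.exp_pos 1)]
    exact hr1.trans (Real.one_le_exp zero_le_one)
  have key : ∀ a ∈ Finset.range (L + 1), (if a = 0 ∨ T < a then (L.choose a : ℝ) * y ^ a else 0) ≤
      (if a = 0 then 1 else 0) +
        (r / Real.exp 1) ^ (T + 1) * (((T : ℝ) + 1) ^ a / (a.factorial : ℝ)) := by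
    intro a _
    have hpos : 0 ≤ (r / Real.exp 1) ^ (T + 1) * (((T : ℝ) + 1) ^ a / (a.factorial : ℝ)) := by
      positivity
    by_cases ha : a = 0
    · subst ha
      simp only [true_or, if_true, Nat.choose_zero_right, Nat.cast_one, pow_zero, mul_one]
      linarith
    · by_cases hTa : T < a
      · simp only [ha, hTa, or_true, if_true, if_false, zero_add]
        have h1 : (L.choose a : ℝ) * y ^ a ≤ (y * L) ^ a / (a.factorial : ℝ) := by
          calc (L.choose a : ℝ) * y ^ a ≤ (L : ℝ) ^ a / (a.factorial : ℝ) * y ^ a :=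
                mul_le_mul_of_nonneg_right (Nat.choose_le_pow_div a L) (by positivity)
            _ = _ := by rw [mul_pow]; ring
        refine h1.trans ?_
        rw [hyL, mul_pow]
        have h2 : (r / Real.exp 1) ^ a ≤ (r / Real.exp 1) ^ (T + 1) :=
          pow_le_pow_of_le_one (by positivity) hre hTa
        calc ((T : ℝ) + 1) ^ a * (r / Real.exp 1) ^ a / (a.factorial : ℝ)
            = (r / Real.exp 1) ^ a * (((T : ℝ) + 1) ^ a / (a.factorial : ℝ)) := by ring
          _ ≤ _ := mul_le_mul_of_nonneg_right h2 (by positivity)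
      · simp only [ha, hTa, or_self, if_false, zero_add]
        exact hpos
  have h3 : stopGen T L y ≤ 1 + (r / Real.exp 1) ^ (T + 1) *
      ∑ a ∈ Finset.range (L + 1), ((T : ℝ) + 1) ^ a / (a.factorial : ℝ) := by
    refine (Finset.sum_le_sum key).trans (le_of_eq ?_)
    rw [Finset.sum_add_distrib, ← Finset.mul_sum]
    simp
  have h4 := Real.sum_le_exp_of_nonneg (x := (T : ℝ) + 1) (by positivity) (L + 1)
  have h5 : (r / Real.exp 1) ^ (T + 1) * Real.exp ((T : ℝ) + 1) = r ^ (T + 1) := by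
    have : Real.exp ((T : ℝ) + 1) = Real.exp 1 ^ (T + 1) := by
      rw [← Real.exp_nat_mul]; push_cast; ring_nf
    rw [this, ← mul_pow, div_mul_cancel₀ _ (Real.exp_pos 1).ne']
  have h6 : r ^ (T + 1) ≤ r ^ 2 := pow_le_pow_of_le_one hr0.le hr1 (by omega)
  have h7 := mul_le_mul_of_nonneg_left h4 (by positivity : 0 ≤ (r / Real.exp 1) ^ (T + 1))
  have h8 := Real.add_one_le_exp (r ^ 2)
  linarith

open Classical in
/-- The probability that `S` is a stopping set after the smallest degree has become `d` and is
about to increase. -/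
theorem measure_stopping_le (hT : 1 ≤ T) (hL0 : 0 < L) (hL : 2 * L ≤ n) {S : Finset (Fin n)}
    (hS : T + 1 ≤ S.card) {r : ℝ} (hr0 : 0 < r) (hr1 : r ≤ 1)
    (hr : r ^ 2 = S.card * L / ((T + 1) * n)) {i d : ℕ} (hi : n - i * L % n ≤ L)
    (hd : i * L / n = d) :
    seedLaw n D {ω | Stopping T L ω i S} ≤ ENNReal.ofReal ((81 * r) ^ (S.card * (d + 1))) := by
  have hn : 0 < n := by omega
  have hn' : (0 : ℝ) < n := by exact_mod_cast hn
  have hL0' : (0 : ℝ) < L := by exact_mod_cast hL0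
  have he := Real.exp_pos 1
  have ht0 : (0 : ℝ) < S.card := by exact_mod_cast (by omega : 0 < S.card)
  -- with this `y`, the terms of `stopGen` with more than `T` columns sum up to at most `r ^ 2`
  set y : ℝ := (T + 1) * r / Real.exp 1 / L with hy
  have hy0 : 0 < y := by positivity
  have hyL : y * L = (T + 1) * r / Real.exp 1 := by rw [hy]; field_simp
  have hyL0 : 0 < y * L := by positivity
  have hTS : (T : ℝ) + 1 ≤ S.card := by exact_mod_cast hS
  have hyLt : y * L ≤ S.card := by
    rw [hyL, div_le_iff₀ he]
    have h1 : (1 : ℝ) ≤ Real.exp 1 := Real.one_le_exp zero_le_one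
    calc ((T : ℝ) + 1) * r ≤ S.card * 1 := mul_le_mul hTS hr1 hr0.le ht0.le
      _ ≤ S.card * Real.exp 1 := mul_le_mul_of_nonneg_left h1 ht0.le
  set W := stopPotential (D := D) T L y S i with hW
  have hind : ∀ ω : Sample n D, ω ∈ {ω | Stopping T L ω i S} →
      1 ≤ ENNReal.ofReal (Real.exp (y * L) * W ω) := by
    intro ω hω
    rw [ENNReal.one_le_ofReal]
    have hcard := card_minSet (ω := ω) hn (by omega : L ≤ n) i
    have h4 := exp_neg_le_stopWeight (L := L) hy0 (Finset.card_le_card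
      (Finset.inter_subset_left : minSet L ω i ∩ S ⊆ minSet L ω i)) (hcard.trans_le hi)
    have hω' : Stopping T L ω i S := hω
    simp only [hW, stopPotential, hω', if_true]
    calc (1 : ℝ) = Real.exp (y * L) * Real.exp (-(y * L)) := by rw [← Real.exp_add]; simp
      _ ≤ _ := mul_le_mul_of_nonneg_left h4 (Real.exp_pos _).le
  have h1 : seedLaw n D {ω | Stopping T L ω i S} ≤
      ∫⁻ ω, ENNReal.ofReal (Real.exp (y * L) * W ω) ∂seedLaw n D := by
    have hm : MeasurableSet {ω : Sample n D | Stopping T L ω i S} :=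
      (past_stopping T L i S).measurable (MeasurableSet.of_discrete (s := {p : Prop | p}))
    rw [← lintegral_indicator_one hm]
    refine lintegral_mono fun ω => ?_
    by_cases hω : ω ∈ {ω : Sample n D | Stopping T L ω i S}
    · rw [Set.indicator_of_mem hω]; exact hind ω hω
    · rw [Set.indicator_of_notMem hω]; exact zero_le
  refine h1.trans ?_
  simp only [ENNReal.ofReal_mul (Real.exp_pos (y * L)).le]
  rw [lintegral_const_mul' _ _ ENNReal.ofReal_ne_top]
  refine (mul_le_mul_right
    (lintegral_stopPotential_le hn hL hy0 S i (one_le_stopGen hy0)) _).trans ?_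
  rw [← ENNReal.ofReal_mul (Real.exp_pos _).le, hd]
  refine ENNReal.ofReal_le_ofReal ?_
  -- all factors are bounded in terms of `g = |S| / (y n)`
  set t := S.card with ht
  set g : ℝ := t / (y * n) with hg
  have hg0 : 0 < g := by positivity
  have hgr : g = Real.exp 1 * r := by
    have h2 : (t : ℝ) * L = r ^ 2 * ((T + 1) * n) := by
      rw [hr]; field_simp
    rw [hg, div_eq_iff (by positivity), hy]
    field_simp
    linarith
  have hB : (L : ℝ) / n + t / (y * (n / 2)) ≤ 3 * g := by
    have e1 : (L : ℝ) / n ≤ g := by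
      rw [hg, div_le_div_iff₀ hn' (by positivity)]
      nlinarith
    have e2 : (t : ℝ) / (y * (n / 2)) = 2 * g := by rw [hg]; field_simp
    linarith
  have hψ : stopGen T L y ^ i ≤ Real.exp t ^ (d + 1) := by
    have h2 := stopGen_le (L := L) hT hL0 hr0 hr1
    rw [← hy] at h2
    refine (pow_le_pow_left₀ (stopGen_nonneg hy0 T L) h2 i).trans ?_
    rw [← Real.exp_nat_mul, ← Real.exp_nat_mul]
    refine Real.exp_le_exp.2 ?_
    have h3 : i * L < (d + 1) * n := by
      rw [← hd, add_mul, one_mul, mul_comm (i * L / n)]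
      have := Nat.div_add_mod (i * L) n
      have := Nat.mod_lt (i * L) hn
      omega
    have h3' : (i : ℝ) * L ≤ (d + 1) * n := by exact_mod_cast h3.le
    have hT1 : (0 : ℝ) < T + 1 := by positivity
    rw [hr]
    have h4 : (i : ℝ) * (t * L / ((T + 1) * n)) = (i * L) * t / ((T + 1) * n) := by ring
    rw [h4, div_le_iff₀ (by positivity)]
    calc (i : ℝ) * L * t ≤ (d + 1) * n * t := mul_le_mul_of_nonneg_right h3' ht0.le
      _ ≤ (d + 1) * n * t * (T + 1) :=
        le_mul_of_one_le_right (by positivity) (by linarith [(Nat.cast_nonneg T : (0 : ℝ) ≤ T)])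
      _ = _ := by push_cast; ring
  have hexp : Real.exp (y * L) ≤ Real.exp t := Real.exp_le_exp.2 hyLt
  have he81 : 3 * Real.exp 1 ^ 3 ≤ 81 := by
    have : Real.exp 1 ≤ 3 := by linarith [Real.exp_one_lt_d9]
    have : Real.exp 1 ^ 3 ≤ 3 ^ 3 := pow_le_pow_left₀ he.le this 3
    linarith
  have hexpt : Real.exp (t : ℝ) = Real.exp 1 ^ t := by
    rw [← Real.exp_nat_mul, mul_one]
  have hBd : ((((L : ℝ) / n + t / (y * (n / 2))) ^ t * Real.exp (y * L))) ^ d ≤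
      ((3 * g) ^ t * Real.exp t) ^ d := by
    refine pow_le_pow_left₀ (by positivity) ?_ _
    exact mul_le_mul (pow_le_pow_left₀ (by positivity) hB _) hexp (Real.exp_pos _).le
      (by positivity)
  calc Real.exp (y * L) * (stopGen T L y ^ i * (((L : ℝ) / n + t / (y * (n / 2))) ^ t *
        Real.exp (y * L)) ^ d * g ^ t)
      ≤ Real.exp t * (Real.exp t ^ (d + 1) * ((3 * g) ^ t * Real.exp t) ^ d * (3 * g) ^ t) := by
        refine mul_le_mul hexp ?_ ?_ (Real.exp_pos _).le
        · refine mul_le_mul (mul_le_mul hψ hBd (by positivity) (by positivity)) ?_ (by positivity)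
            (by positivity)
          exact pow_le_pow_left₀ hg0.le (by linarith) _
        · have := stopGen_nonneg hy0 T L
          positivity
    _ = ((3 * g * Real.exp 1 ^ 2) ^ t) ^ (d + 1) := by
        rw [hexpt, mul_pow (3 * g) _ t, ← pow_mul (Real.exp 1) 2 t, mul_comm 2 t, pow_mul _ t 2]
        ring
    _ ≤ ((81 * r) ^ t) ^ (d + 1) := by
        refine pow_le_pow_left₀ (by positivity) (pow_le_pow_left₀ (by positivity) ?_ _) _
        rw [hgr]
        calc 3 * (Real.exp 1 * r) * Real.exp 1 ^ 2 = 3 * Real.exp 1 ^ 3 * r := by ring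
          _ ≤ 81 * r := mul_le_mul_of_nonneg_right he81 hr0.le
    _ = _ := by rw [← pow_mul]

end Potential

/-! ### Columns outside all rows with few nonzero columns -/

/-- Every row before `i` that meets `J` contains more than `T` columns of `K`. -/
def Unresolved {n D : ℕ} (T L : ℕ) (K : Finset (Fin n)) (i : ℕ) (J : Finset (Fin n))
    (ω : Sample n D) : Prop :=
  ∀ i' < i, (rowSupport L ω i' ∩ J).Nonempty → T < (rowSupport L ω i' ∩ K).card

section Unresolved

variable {n D L T : ℕ} {K : Finset (Fin n)}

theorem past_unresolved (T L i : ℕ) (K J : Finset (Fin n)) :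
    Past i fun ω : Sample n D => Unresolved T L K i J ω := by
  intro ω ω' hω
  simp only [Unresolved, eq_iff_iff]
  refine forall₂_congr fun i' hi' => ?_
  have h : rowSupport L ω i' = rowSupport L ω' i' := past_rowSupport L hi' ω ω' hω
  rw [h]

theorem unresolved_succ {ω : Sample n D} {i : ℕ} {J : Finset (Fin n)} :
    Unresolved T L K (i + 1) J ω ↔ Unresolved T L K i J ω ∧
      ((rowSupport L ω i ∩ J).Nonempty → T < (rowSupport L ω i ∩ K).card) := by
  unfold Unresolved
  constructor
  · exact fun h => ⟨fun i' hi' => h i' (by omega), h i (Nat.lt_succ_self i)⟩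
  · rintro ⟨h1, h2⟩ i' hi'
    rcases Nat.lt_succ_iff_lt_or_eq.1 hi' with h | rfl
    · exact h1 i' h
    · exact h2

theorem Unresolved.anti {ω : Sample n D} {i i' : ℕ} {J : Finset (Fin n)}
    (h : Unresolved T L K i J ω) (hi : i' ≤ i) : Unresolved T L K i' J ω :=
  fun a ha => h a (ha.trans_le hi)

theorem measurableSet_unresolved (i : ℕ) (J : Finset (Fin n)) :
    MeasurableSet {ω : Sample n D | Unresolved T L K i J ω} :=
  (past_unresolved T L i K J).measurable (MeasurableSet.of_discrete (s := {p : Prop | p}))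

theorem measurableSet_stopping (i : ℕ) (S : Finset (Fin n)) :
    MeasurableSet {ω : Sample n D | Stopping T L ω i S} :=
  (past_stopping T L i S).measurable (MeasurableSet.of_discrete (s := {p : Prop | p}))

theorem Stopping.unresolved {ω : Sample n D} {i : ℕ} {S : Finset (Fin n)}
    (h : Stopping T L ω i S) (hS : S ⊆ K) : Unresolved T L K i S ω := by
  intro i' hi' hne
  rcases h i' hi' with h0 | h0
  · exact absurd (Finset.card_eq_zero.1 h0) hne.ne_empty
  · exact h0.trans_le (Finset.card_le_card (Finset.inter_subset_inter_left hS))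

theorem succ_mul_mod_of_lt (hn : 0 < n) {i : ℕ} (h : L < n - i * L % n) :
    (i + 1) * L % n = i * L % n + L := by
  have h1 := succ_mul_div_of_lt hn h
  have h2 := Nat.div_add_mod (i * L) n
  have h3 := Nat.div_add_mod ((i + 1) * L) n
  rw [h1] at h3
  have h4 : (i + 1) * L = i * L + L := by ring
  omega

theorem succ_mul_mod_of_le (hn : 0 < n) (hL : L ≤ n) {i : ℕ} (h : n - i * L % n ≤ L) :
    (i + 1) * L % n = i * L % n + L - n := by
  have h1 := succ_mul_div_of_le hn hL h
  have h2 := Nat.div_add_mod (i * L) n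
  have h3 := Nat.div_add_mod ((i + 1) * L) n
  rw [h1, mul_add] at h3
  have h4 : (i + 1) * L = i * L + L := by ring
  omega

/-- The factor by which a column counts that has not been used since the smallest degree changed;
`e` is the number of columns used since then. It is smaller than `1` in anticipation of the
possibility that one of the rows with `e < n / 10`, which still choose among at least `9 n / 10`
columns, resolves the column, and increases to `1` as this possibility vanishes. -/
def freshFactor (p : ℝ) (n e : ℕ) : ℝ := 1 - p / 8 * (max 0 ((n : ℝ) / 10 - e) / n)

open Classical in
/-- The potential used to bound the probability that all columns in `J` remain unresolved. Its
expectation decreases by a constant factor for each column in `J` whenever the smallest degree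
changes, and does not increase otherwise. -/
def unresolvedPotential (T L : ℕ) (p : ℝ) (K J : Finset (Fin n)) (i : ℕ) (ω : Sample n D) : ℝ :=
  if Unresolved T L K i J ω then freshFactor p n (i * L % n) ^ (minSet L ω i ∩ J).card else 0

theorem freshFactor_le_one {p : ℝ} (hp : 0 ≤ p) (n e : ℕ) : freshFactor p n e ≤ 1 := by
  unfold freshFactor
  have : 0 ≤ p / 8 * (max 0 ((n : ℝ) / 10 - e) / n) := by positivity
  linarith

theorem le_freshFactor {p : ℝ} (hp : 0 ≤ p) (hn : 0 < n) (e : ℕ) :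
    1 - p / 80 ≤ freshFactor p n e := by
  unfold freshFactor
  have hn' : (0 : ℝ) < n := by exact_mod_cast hn
  have h1 : max 0 ((n : ℝ) / 10 - e) / n ≤ 1 / 10 := by
    rw [div_le_iff₀ hn']
    refine max_le (by positivity) ?_
    have : (0 : ℝ) ≤ e := Nat.cast_nonneg e
    linarith
  have := mul_le_mul_of_nonneg_left h1 (by positivity : 0 ≤ p / 8)
  linarith

theorem freshFactor_eq_one {p : ℝ} {e : ℕ} (h : n ≤ 10 * e) : freshFactor p n e = 1 := by
  unfold freshFactor
  have : (n : ℝ) ≤ 10 * e := by exact_mod_cast h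
  rw [max_eq_left (by linarith)]
  simp

/-- The elementary inequality behind the monotonicity of the potential: `h` is the probability
that a row contains a given column, and `h * p / 2` is a lower bound for the probability that it
resolves the column, corrected for the rows that contain several of `l` columns. -/
theorem pow_sub_le_pow {l : ℕ} {h p δ : ℝ} (hp : 0 < p) (hp1 : p ≤ 1) (hh : 0 ≤ h) (hh1 : h ≤ 1)
    (hδ0 : 0 ≤ δ) (hδ : δ ≤ p / 80) (hl : ((l : ℝ) - 1) * h ≤ p / 2) :
    ((1 - (1 - δ)) * h + (1 - δ)) ^ l - (1 - δ) ^ (l - 1) * (l * (h * p / 2)) ≤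
      (1 - δ - p / 8 * h) ^ l := by
  rcases Nat.eq_zero_or_pos l with rfl | hl0
  · simp
  set x : ℝ := 1 - δ with hx
  set a : ℝ := (1 - x) * h + x with ha
  have hx1 : 1 / 2 ≤ x := by rw [hx]; linarith
  have hxa : x ≤ a := by
    rw [ha]
    have : 0 ≤ (1 - x) * h := mul_nonneg (by rw [hx]; linarith) hh
    linarith
  have ha0 : 0 < a := by linarith
  have hax : a ≤ x * (1 + h) := by
    have : (1 - x) * h ≤ x * h := mul_le_mul_of_nonneg_right (by linarith) hh
    rw [ha]; linarith
  have hb0 : 0 ≤ p / 4 * h := by positivity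
  have hba : p / 4 * h ≤ a := by
    have : p / 4 * h ≤ 1 / 4 * 1 := mul_le_mul (by linarith) hh1 hh (by norm_num)
    linarith
  have hl1 : ((l - 1 : ℕ) : ℝ) = (l : ℝ) - 1 := by rw [Nat.cast_sub hl0, Nat.cast_one]
  have h1 : a ^ (l - 1) ≤ 2 * x ^ (l - 1) := by
    refine (pow_le_pow_left₀ ha0.le hax _).trans ?_
    rw [mul_pow, mul_comm]
    refine mul_le_mul_of_nonneg_right ?_ (by positivity)
    have h2 : (1 + h) ^ (l - 1) ≤ Real.exp h ^ (l - 1) :=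
      pow_le_pow_left₀ (by linarith) (by linarith [Real.add_one_le_exp h]) _
    refine h2.trans ?_
    rw [← Real.exp_nat_mul, hl1]
    have h3 : Real.exp (((l : ℝ) - 1) * h) ≤ Real.exp (1 / 2) :=
      Real.exp_le_exp.2 (by linarith)
    refine h3.trans ?_
    have h4 : Real.exp (1 / 2) ^ 2 = Real.exp 1 := by rw [← Real.exp_nat_mul]; norm_num
    have h5 := Real.exp_one_lt_d9
    nlinarith [Real.exp_pos (1 / 2)]
  have h2 : a ^ l - l * (p / 4 * h) * a ^ (l - 1) ≤ (a - p / 4 * h) ^ l := by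
    have hb : -1 ≤ -(p / 4 * h / a) := by
      rw [neg_le_neg_iff, div_le_one ha0]; exact hba
    have h3 := one_add_mul_le_pow (a := -(p / 4 * h / a)) (by linarith) l
    have h4 := mul_le_mul_of_nonneg_left h3 (pow_nonneg ha0.le l)
    have e1 : a ^ l * (1 + -(p / 4 * h / a)) ^ l = (a - p / 4 * h) ^ l := by
      rw [← mul_pow]; congr 1; field_simp; ring
    have e2 : a ^ l * (1 + l * -(p / 4 * h / a)) = a ^ l - l * (p / 4 * h) * a ^ (l - 1) := by
      obtain ⟨l', rfl⟩ : ∃ l', l = l' + 1 := ⟨l - 1, by omega⟩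
      rw [Nat.add_sub_cancel, pow_succ]
      field_simp
      ring
    rw [e1, e2] at h4
    exact h4
  have h3 : (l : ℝ) * (p / 4 * h) * a ^ (l - 1) ≤ x ^ (l - 1) * (l * (h * p / 2)) := by
    have := mul_le_mul_of_nonneg_left h1 (by positivity : 0 ≤ (l : ℝ) * (p / 4 * h))
    linarith
  have h4 : (a - p / 4 * h) ^ l ≤ (x - p / 8 * h) ^ l := by
    refine pow_le_pow_left₀ (by linarith) ?_ _
    have : (1 - x) * h ≤ p / 8 * h := mul_le_mul_of_nonneg_right (by rw [hx]; linarith) hh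
    rw [ha]; linarith
  linarith

/-- A row generated soon after the smallest degree has changed does not increase the expected
potential. -/
theorem lintegral_unresolvedPotential_of_fresh (hL0 : 0 < L) (hL : 20 * L ≤ n) {p : ℝ}
    (hp : 0 < p) (hp1 : p ≤ 1)
    (hgood : ∀ M : Finset (Fin n), 9 * n ≤ 10 * M.card → ∀ j ∈ M, j ∈ K →
      (L : ℝ) / M.card * p ≤
        subsetAvg M L fun Q => if j ∈ Q ∧ (Q ∩ K).card ≤ T then 1 else 0)
    {J : Finset (Fin n)} (hJ : J ⊆ K) (hJn : 4 * ((J.card : ℝ) - 1) * L ≤ p * n)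
    {i : ℕ} (hi : 10 * (i * L % n) < n) :
    ∫⁻ ω, ENNReal.ofReal (unresolvedPotential T L p K J (i + 1) ω) ∂seedLaw n D ≤
      ∫⁻ ω, ENNReal.ofReal (unresolvedPotential T L p K J i ω) ∂seedLaw n D := by
  classical
  have hn : 0 < n := by omega
  have hn' : (0 : ℝ) < n := by exact_mod_cast hn
  have hLn : L ≤ n := by omega
  have hi' : L < n - i * L % n := by omega
  set x := freshFactor p n ((i + 1) * L % n) with hx
  have hx1 : x ≤ 1 := freshFactor_le_one hp.le _ _
  have hx0 : 1 - p / 80 ≤ x := le_freshFactor hp.le hn _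
  have hxpos : 0 < x := by linarith
  let F : Sample n D → Finset (Fin n) → ℝ := fun ω R =>
    if Unresolved T L K i J ω ∧ ((R ∩ J).Nonempty → T < (R ∩ K).card) then
      x ^ ((minSet L ω i \ R) ∩ J).card else 0
  have hF : ∀ ω, unresolvedPotential T L p K J (i + 1) ω = F ω (rowSupport L ω i) := by
    intro ω
    simp only [unresolvedPotential, F, unresolved_succ, minSet_succ_of_lt hn hLn hi', ← hx]
  simp only [hF]
  refine lintegral_row_le_of_lt hn hLn hi' ?_ ?_ ?_
  · intro R ω ω' hω
    have h1 : Unresolved T L K i J ω = Unresolved T L K i J ω' := past_unresolved T L i K J ω ω' hω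
    have h2 : minSet L ω i = minSet L ω' i := past_minSet L i ω ω' hω
    simp only [F, h1, h2]
  · intro ω R
    simp only [F]
    split_ifs <;> positivity
  · intro ω
    have hcard := card_minSet (ω := ω) hn hLn i
    set M := minSet L ω i with hM
    have hLM : L ≤ M.card := by rw [hcard]; exact hi'.le
    by_cases hs : Unresolved T L K i J ω
    swap
    · have : F ω = fun _ => 0 := by funext R; simp [F, hs]
      rw [this, subsetAvg_const hLM]
      simp [unresolvedPotential, hs]
    have hΦ : unresolvedPotential T L p K J i ω = freshFactor p n (i * L % n) ^ (M ∩ J).card := by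
      simp [unresolvedPotential, hs, ← hM]
    rw [hΦ]
    set J' := M ∩ J with hJ'
    have hJ'M : J' ⊆ M := Finset.inter_subset_left
    have hJ'K : J' ⊆ K := Finset.inter_subset_right.trans hJ
    set l := J'.card with hl
    have hlJ : l ≤ J.card := Finset.card_le_card Finset.inter_subset_right
    have hM0 : (0 : ℝ) < M.card := by
      have : 0 < M.card := by omega
      exact_mod_cast this
    set h : ℝ := (L : ℝ) / M.card with hh
    have hh0 : 0 ≤ h := by positivity
    have hh1 : h ≤ 1 := by
      rw [hh, div_le_one hM0]; exact_mod_cast hLM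
    have hMn : (9 : ℝ) * n ≤ 10 * M.card := by
      have : 9 * n ≤ 10 * M.card := by omega
      exact_mod_cast this
    -- a resolving row that contains one column of `J` makes `F` vanish; rows that contain several
    -- such columns are subtracted with their number of ordered pairs of these
    have hpt : ∀ R ∈ M.powersetCard L, F ω R ≤
        (∏ j ∈ J', ((if j ∈ R then 1 - x else 0) + x)) -
        x ^ (l - 1) * ((∑ j ∈ J', if j ∈ R ∧ (R ∩ K).card ≤ T then (1 : ℝ) else 0) -
          ∑ j ∈ J', ∑ j' ∈ J'.erase j, if j ∈ R ∧ j' ∈ R then (1 : ℝ) else 0) := by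
      intro R hR
      rw [Finset.mem_powersetCard] at hR
      rw [prod_ite_add, sub_add_cancel, one_pow, one_mul]
      set a := (R ∩ J').card with ha
      have hRJ : R ∩ J = R ∩ J' := by
        rw [hJ', ← Finset.inter_assoc, Finset.inter_eq_left.2 hR.1]
      have e0 : (M \ R) ∩ J = J' \ R := by
        ext y; simp only [hJ', Finset.mem_inter, Finset.mem_sdiff]; tauto
      have e1 : ∑ j ∈ J', ∑ j' ∈ J'.erase j, (if j ∈ R ∧ j' ∈ R then (1 : ℝ) else 0) =
          a * ((a : ℝ) - 1) := by
        have : ∀ j ∈ J', ∑ j' ∈ J'.erase j, (if j ∈ R ∧ j' ∈ R then (1 : ℝ) else 0) =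
            if j ∈ R then (a : ℝ) - 1 else 0 := by
          intro j hj
          by_cases hjR : j ∈ R
          · simp only [hjR, true_and, if_true]
            rw [Finset.sum_boole]
            have e2 : (J'.erase j).filter (· ∈ R) = (R ∩ J').erase j := by
              ext y; simp only [Finset.mem_filter, Finset.mem_erase, Finset.mem_inter]; tauto
            have hjm : j ∈ R ∩ J' := Finset.mem_inter.2 ⟨hjR, hj⟩
            rw [e2, Finset.card_erase_of_mem hjm, Nat.cast_sub (Finset.card_pos.2 ⟨j, hjm⟩),
              Nat.cast_one]
          · simp [hjR]
        rw [Finset.sum_congr rfl this, ← Finset.sum_filter, Finset.sum_const, nsmul_eq_mul,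
          Finset.filter_mem_eq_inter, Finset.inter_comm]
      have e3 : ∑ j ∈ J', (if j ∈ R ∧ (R ∩ K).card ≤ T then (1 : ℝ) else 0) =
          if (R ∩ K).card ≤ T then (a : ℝ) else 0 := by
        by_cases hg : (R ∩ K).card ≤ T
        · simp only [hg, and_true, if_true]
          rw [Finset.sum_boole, Finset.filter_mem_eq_inter, Finset.inter_comm]
        · simp [hg]
      rw [e1, e3]
      simp only [F, hs, true_and, ← hM, e0, hRJ]
      have ha01 : (0 : ℝ) ≤ a * ((a : ℝ) - 1) := by
        rcases Nat.eq_zero_or_pos a with h0 | h0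
        · simp [h0]
        · have : (1 : ℝ) ≤ a := by exact_mod_cast h0
          exact mul_nonneg (by linarith) (by linarith)
      have hxl : 0 ≤ x ^ (l - 1) := by positivity
      by_cases hg : (R ∩ K).card ≤ T
      · rw [if_pos hg]
        rcases Nat.lt_trichotomy a 1 with h0 | h0 | h0
        · have h0' : a = 0 := by omega
          rw [h0']
          simp only [Nat.cast_zero, zero_mul, sub_zero, mul_zero]
          split_ifs
          · exact le_rfl
          · positivity
        · have hne : (R ∩ J').Nonempty := Finset.card_pos.1 (by omega)
          have : ¬ ((R ∩ J').Nonempty → T < (R ∩ K).card) := by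
            intro h; exact absurd (h hne) (by omega)
          rw [if_neg this, h0]
          have : (J' \ R).card = l - 1 := by
            have := Finset.card_sdiff_add_card_inter J' R
            rw [Finset.inter_comm] at this
            omega
          rw [this]
          simp
        · have hne : (R ∩ J').Nonempty := Finset.card_pos.1 (by omega)
          have : ¬ ((R ∩ J').Nonempty → T < (R ∩ K).card) := by
            intro h; exact absurd (h hne) (by omega)
          rw [if_neg this]
          have h2 : (2 : ℝ) ≤ a := by exact_mod_cast h0
          have h3 : (a : ℝ) - a * (a - 1) ≤ 0 := by nlinarith
          have h4 := mul_nonpos_of_nonneg_of_nonpos hxl h3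
          have h5 : 0 ≤ x ^ (J' \ R).card := by positivity
          linarith
      · rw [if_neg hg, zero_sub]
        have h4 := mul_nonneg hxl ha01
        split_ifs
        · linarith
        · have h5 : 0 ≤ x ^ (J' \ R).card := by positivity
          linarith
    refine (subsetAvg_mono hpt).trans ?_
    rw [subsetAvg_sub, subsetAvg_mul_left, subsetAvg_sub, subsetAvg_sum, subsetAvg_sum]
    have h1 := subsetAvg_prod_le J' hLM hxpos.le (sub_nonneg.2 hx1)
    have h2 : (l : ℝ) * (h * p) ≤ ∑ j ∈ J', subsetAvg M L fun Q =>
        if j ∈ Q ∧ (Q ∩ K).card ≤ T then 1 else 0 := by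
      rw [hl, ← nsmul_eq_mul]
      refine Finset.card_nsmul_le_sum _ _ _ fun j hj => ?_
      exact hgood M (by omega) j (hJ'M hj) (hJ'K hj)
    have h3 : ∑ j ∈ J', subsetAvg M L (fun Q => ∑ j' ∈ J'.erase j,
        if j ∈ Q ∧ j' ∈ Q then (1 : ℝ) else 0) ≤ l * (((l : ℝ) - 1) * (h * h)) := by
      rw [hl, ← nsmul_eq_mul]
      refine Finset.sum_le_card_nsmul _ _ _ fun j hj => ?_
      rw [subsetAvg_sum]
      have hc : ((J'.erase j).card : ℝ) = (J'.card : ℝ) - 1 := by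
        rw [Finset.card_erase_of_mem hj, Nat.cast_sub (Finset.card_pos.2 ⟨j, hj⟩), Nat.cast_one]
      rw [← hc, ← nsmul_eq_mul]
      refine Finset.sum_le_card_nsmul _ _ _ fun j' hj' => ?_
      have := subsetAvg_superset_le (C := M) (q := L) {j, j'} hLM
      simp only [Finset.insert_subset_iff, Finset.singleton_subset_iff] at this
      rw [Finset.card_pair (Finset.ne_of_mem_erase hj').symm, ← hh, sq] at this
      exact this
    have hlh : ((l : ℝ) - 1) * h ≤ p / 2 := by
      rcases Nat.eq_zero_or_pos l with h0 | h0
      · rw [h0]; simp only [Nat.cast_zero]; nlinarith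
      rw [hh, mul_div_assoc', div_le_iff₀ hM0]
      have h6 : ((l : ℝ) - 1) * L ≤ ((J.card : ℝ) - 1) * L := by
        have : (l : ℝ) ≤ J.card := by exact_mod_cast hlJ
        exact mul_le_mul_of_nonneg_right (by linarith) (Nat.cast_nonneg _)
      nlinarith
    have h4 : x ^ (l - 1) * (l * (h * p / 2)) ≤ x ^ (l - 1) * (
        (∑ j ∈ J', subsetAvg M L fun Q => if j ∈ Q ∧ (Q ∩ K).card ≤ T then 1 else 0) -
        ∑ j ∈ J', subsetAvg M L (fun Q => ∑ j' ∈ J'.erase j,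
          if j ∈ Q ∧ j' ∈ Q then (1 : ℝ) else 0)) := by
      refine mul_le_mul_of_nonneg_left ?_ (by positivity)
      have h7 : (l : ℝ) * (((l : ℝ) - 1) * (h * h)) ≤ l * (p / 2 * h) := by
        refine mul_le_mul_of_nonneg_left ?_ (Nat.cast_nonneg _)
        rw [← mul_assoc]
        exact mul_le_mul_of_nonneg_right hlh hh0
      linarith
    have h5 := pow_sub_le_pow (l := l) (h := h) (p := p) (δ := 1 - x) hp hp1 hh0 hh1 (by linarith)
      (by linarith) hlh
    simp only [sub_sub_cancel] at h5
    have h6 : (x - p / 8 * h) ^ l ≤ freshFactor p n (i * L % n) ^ l := by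
      have h7 : p / 8 * h ≤ 1 / 8 * 1 := mul_le_mul (by linarith) hh1 hh0 (by norm_num)
      refine pow_le_pow_left₀ (by linarith) ?_ _
      rw [hx, succ_mul_mod_of_lt hn hi']
      unfold freshFactor
      have h8 : max 0 ((n : ℝ) / 10 - (i * L % n : ℕ)) / n ≤
          max 0 ((n : ℝ) / 10 - ((i * L % n + L : ℕ) : ℝ)) / n + h := by
        have h9 : (L : ℝ) / n ≤ h := by
          rw [hh]
          refine div_le_div_of_nonneg_left (Nat.cast_nonneg _) hM0 ?_
          have : M.card ≤ n := by omega
          exact_mod_cast this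
        refine le_trans ?_ (add_le_add_right h9 _)
        rw [← add_div]
        refine div_le_div_of_nonneg_right ?_ hn'.le
        refine max_le (by positivity) ?_
        push_cast
        have := le_max_right 0 ((n : ℝ) / 10 - (((i * L % n : ℕ) : ℝ) + L))
        linarith
      have h10 := mul_le_mul_of_nonneg_left h8 (by positivity : 0 ≤ p / 8)
      linarith
    linarith

theorem unresolvedPotential_le_indicator {p : ℝ} (hp : 0 ≤ p) (hp1 : p ≤ 1) (hn : 0 < n)
    {J : Finset (Fin n)} {i : ℕ} (ω : Sample n D) :
    0 ≤ unresolvedPotential T L p K J i ω ∧ unresolvedPotential T L p K J i ω ≤ 1 := by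
  unfold unresolvedPotential
  have h1 := le_freshFactor hp hn (i * L % n)
  have h2 := freshFactor_le_one hp n (i * L % n)
  have h0 : 0 ≤ freshFactor p n (i * L % n) := by linarith
  split_ifs
  · exact ⟨by positivity, pow_le_one₀ h0 h2⟩
  · exact ⟨le_rfl, zero_le_one⟩

/-- A row generated long after the last change of the smallest degree does not increase the
potential. -/
theorem unresolvedPotential_succ_le (hn : 0 < n) {p : ℝ}
    {J : Finset (Fin n)} {i : ℕ} (hi : n ≤ 10 * (i * L % n)) (hi' : L < n - i * L % n)
    (ω : Sample n D) :
    unresolvedPotential T L p K J (i + 1) ω ≤ unresolvedPotential T L p K J i ω := by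
  unfold unresolvedPotential
  have hm := succ_mul_mod_of_lt hn hi'
  rw [freshFactor_eq_one hi, freshFactor_eq_one (by omega : n ≤ 10 * ((i + 1) * L % n)), one_pow,
    one_pow]
  by_cases h : Unresolved T L K (i + 1) J ω
  · rw [if_pos h, if_pos (h.anti (Nat.le_succ i))]
  · rw [if_neg h]
    split_ifs <;> norm_num

/-- A change of the smallest degree decreases the expected potential by a constant factor for each
column in `J`. -/
theorem lintegral_unresolvedPotential_of_le (hL0 : 0 < L) (hL : 20 * L ≤ n) {p : ℝ}
    (hp : 0 < p) (hp1 : p ≤ 1) {J : Finset (Fin n)} {i : ℕ} (hi : n - i * L % n ≤ L) :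
    ∫⁻ ω, ENNReal.ofReal (unresolvedPotential T L p K J (i + 1) ω) ∂seedLaw n D ≤
      ∫⁻ ω, ENNReal.ofReal ((1 - p / 320) ^ J.card * unresolvedPotential T L p K J i ω)
        ∂seedLaw n D := by
  classical
  have hn : 0 < n := by omega
  have hn' : (0 : ℝ) < n := by exact_mod_cast hn
  have hLn : L ≤ n := by omega
  set x := freshFactor p n ((i + 1) * L % n) with hx
  have hx1 : x ≤ 1 := freshFactor_le_one hp.le _ _
  have hx0 : 1 - p / 80 ≤ x := le_freshFactor hp.le hn _
  have hxpos : 0 < x := by linarith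
  let F : Sample n D → Finset (Fin n) → ℝ := fun ω R =>
    if Unresolved T L K i J ω ∧ ((R ∩ J).Nonempty → T < (R ∩ K).card) then
      x ^ ((R \ minSet L ω i)ᶜ ∩ J).card else 0
  have hF : ∀ ω, unresolvedPotential T L p K J (i + 1) ω = F ω (rowSupport L ω i) := by
    intro ω
    simp only [unresolvedPotential, F, unresolved_succ, minSet_succ_of_le hn hLn hi, ← hx]
  simp only [hF]
  refine lintegral_row_le_of_le hn hLn hi ?_ ?_ ?_
  · intro R ω ω' hω
    have h1 : Unresolved T L K i J ω = Unresolved T L K i J ω' := past_unresolved T L i K J ω ω' hω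
    have h2 : minSet L ω i = minSet L ω' i := past_minSet L i ω ω' hω
    simp only [F, h1, h2]
  · intro ω R
    simp only [F]
    split_ifs <;> positivity
  · intro ω
    have hcard := card_minSet (ω := ω) hn hLn i
    set M := minSet L ω i with hM
    have hML : M.card ≤ L := by rw [hcard]; exact hi
    have hMc : Mᶜ.card = n - M.card := by rw [Finset.card_compl, Fintype.card_fin]
    have hq : L - M.card ≤ Mᶜ.card := by omega
    by_cases hs : Unresolved T L K i J ω
    swap
    · have : (fun Q => F ω (M ∪ Q)) = fun _ => 0 := by funext R; simp [F, hs]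
      rw [this, subsetAvg_const hq]
      simp [unresolvedPotential, hs]
    have hmod := Nat.mod_lt (i * L) hn
    have hΦ : unresolvedPotential T L p K J i ω = 1 := by
      simp only [unresolvedPotential, hs, if_true]
      rw [freshFactor_eq_one (by omega), one_pow]
    rw [hΦ, mul_one]
    have h1 : subsetAvg Mᶜ (L - M.card) (fun Q => F ω (M ∪ Q)) ≤
        subsetAvg Mᶜ (L - M.card) (fun Q => ∏ j ∈ J, ((if j ∈ Q then 1 - x else 0) + x)) := by
      refine subsetAvg_mono fun Q hQ => ?_
      rw [Finset.mem_powersetCard] at hQ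
      rw [prod_ite_add, sub_add_cancel, one_pow, one_mul]
      have e1 : (M ∪ Q) \ M = Q := by
        rw [Finset.union_sdiff_left, Finset.sdiff_eq_self_iff_disjoint]
        rw [Finset.disjoint_left]
        exact fun x hx hx' => Finset.mem_compl.1 (hQ.1 hx) hx'
      have e2 : Qᶜ ∩ J = J \ Q := by
        ext x; simp only [Finset.mem_inter, Finset.mem_compl, Finset.mem_sdiff]; tauto
      simp only [F, ← hM, e1, e2]
      split_ifs
      · exact le_rfl
      · positivity
    refine h1.trans ((subsetAvg_prod_le J hq hxpos.le (sub_nonneg.2 hx1)).trans ?_)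
    refine pow_le_pow_left₀
      (add_nonneg (mul_nonneg (sub_nonneg.2 hx1) (by positivity)) hxpos.le) ?_ _
    have hMn : M.card ≤ n := by omega
    have h20 : (20 : ℝ) * L ≤ n := by exact_mod_cast hL
    have h6 : ((L - M.card : ℕ) : ℝ) / Mᶜ.card ≤ 1 / 20 := by
      have hpos : 0 < Mᶜ.card := by omega
      rw [div_le_div_iff₀ (by exact_mod_cast hpos) (by norm_num), hMc, Nat.cast_sub hML,
        Nat.cast_sub hMn]
      have : (0 : ℝ) ≤ M.card := Nat.cast_nonneg _
      linarith
    have h7 : p / 160 ≤ 1 - x := by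
      rw [hx, succ_mul_mod_of_le hn hLn hi]
      unfold freshFactor
      have h8 : 1 / 20 ≤ max 0 ((n : ℝ) / 10 - ((i * L % n + L - n : ℕ) : ℝ)) / n := by
        rw [le_div_iff₀ hn']
        refine le_trans ?_ (le_max_right _ _)
        have : ((i * L % n + L - n : ℕ) : ℝ) ≤ L := by
          have : i * L % n + L - n ≤ L := by omega
          exact_mod_cast this
        linarith
      have := mul_le_mul_of_nonneg_left h8 (by positivity : 0 ≤ p / 8)
      linarith
    have h9 : (1 - x) * (((L - M.card : ℕ) : ℝ) / Mᶜ.card) ≤ (1 - x) * (1 / 20) :=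
      mul_le_mul_of_nonneg_left h6 (sub_nonneg.2 hx1)
    linarith

/-- The probability that all columns in `J` are unresolved decays exponentially in the number of
columns and in the smallest degree. -/
theorem measure_unresolved_le (hL0 : 0 < L) (hL : 20 * L ≤ n) {p : ℝ} (hp : 0 < p) (hp1 : p ≤ 1)
    (hgood : ∀ M : Finset (Fin n), 9 * n ≤ 10 * M.card → ∀ j ∈ M, j ∈ K →
      (L : ℝ) / M.card * p ≤
        subsetAvg M L fun Q => if j ∈ Q ∧ (Q ∩ K).card ≤ T then 1 else 0)
    {J : Finset (Fin n)} (hJ : J ⊆ K) (hJn : 4 * ((J.card : ℝ) - 1) * L ≤ p * n)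
    {i d : ℕ} (hi : n - i * L % n ≤ L) (hd : i * L / n = d) :
    seedLaw n D {ω | Unresolved T L K i J ω} ≤ ENNReal.ofReal ((1 - p / 320) ^ (J.card * d)) := by
  classical
  have hn : 0 < n := by omega
  have hLn : L ≤ n := by omega
  have hprob : IsProbabilityMeasure (seedLaw n D) := by unfold seedLaw; infer_instance
  have hη : 0 ≤ (1 - p / 320) ^ J.card := pow_nonneg (by linarith) _
  have key : ∀ i : ℕ, ∫⁻ ω, ENNReal.ofReal (unresolvedPotential T L p K J i ω) ∂seedLaw n D ≤
      ENNReal.ofReal (((1 - p / 320) ^ J.card) ^ (i * L / n)) := by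
    intro i
    induction i with
    | zero =>
      calc _ ≤ ∫⁻ _, 1 ∂seedLaw n D := by
            refine lintegral_mono fun ω => ?_
            rw [ENNReal.ofReal_le_one]
            exact (unresolvedPotential_le_indicator hp.le hp1 hn ω).2
        _ = _ := by simp
    | succ i ih =>
      rcases lt_or_ge L (n - i * L % n) with hlt | hge
      · rw [succ_mul_div_of_lt hn hlt]
        refine le_trans ?_ ih
        rcases lt_or_ge (10 * (i * L % n)) n with hf | hf
        · exact lintegral_unresolvedPotential_of_fresh hL0 hL hp hp1 hgood hJ hJn hf
        · exact lintegral_mono fun ω => ENNReal.ofReal_le_ofReal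
            (unresolvedPotential_succ_le hn hf hlt ω)
      · rw [succ_mul_div_of_le hn hLn hge, pow_succ']
        refine (lintegral_unresolvedPotential_of_le hL0 hL hp hp1 hge).trans ?_
        simp only [ENNReal.ofReal_mul hη]
        rw [lintegral_const_mul' _ _ ENNReal.ofReal_ne_top]
        exact mul_le_mul_right ih _
  rw [pow_mul, ← hd]
  refine le_trans ?_ (key i)
  rw [← lintegral_indicator_one (measurableSet_unresolved i J)]
  refine lintegral_mono fun ω => ?_
  by_cases hω : ω ∈ {ω : Sample n D | Unresolved T L K i J ω}
  · rw [Set.indicator_of_mem hω]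
    have hω' : Unresolved T L K i J ω := hω
    simp only [unresolvedPotential, hω', if_true]
    have hmod := Nat.mod_lt (i * L) hn
    rw [freshFactor_eq_one (by omega), one_pow]
    simp
  · rw [Set.indicator_of_notMem hω]; exact zero_le

open Classical in
/-- The nonzero columns that lie in no row with at most `T` nonzero columns before `i`. -/
def unresolvedSet (T L : ℕ) (K : Finset (Fin n)) (i : ℕ) (ω : Sample n D) : Finset (Fin n) :=
  K.filter fun j => Unresolved T L K i {j} ω

theorem unresolved_iff_subset {ω : Sample n D} {i : ℕ} {J : Finset (Fin n)} (hJ : J ⊆ K) :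
    Unresolved T L K i J ω ↔ J ⊆ unresolvedSet T L K i ω := by
  constructor
  · intro h j hj
    simp only [unresolvedSet, Finset.mem_filter]
    refine ⟨hJ hj, fun i' hi' hne => h i' hi' ?_⟩
    exact hne.mono (Finset.inter_subset_inter_left (Finset.singleton_subset_iff.2 hj))
  · intro h i' hi' ⟨j, hj⟩
    rw [Finset.mem_inter] at hj
    have h1 := h hj.2
    simp only [unresolvedSet, Finset.mem_filter] at h1
    exact h1.2 i' hi' ⟨j, by simp [hj.1]⟩

/-- Markov's inequality for the number of subsets of unresolved columns with `l` elements. -/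
theorem measure_card_unresolvedSet_le {i l u : ℕ} {a : ℝ} (hlu : l ≤ u)
    (h : ∀ J ⊆ K, J.card = l →
      seedLaw n D {ω | Unresolved T L K i J ω} ≤ ENNReal.ofReal a) :
    seedLaw n D {ω | u ≤ (unresolvedSet T L K i ω).card} ≤
      ENNReal.ofReal ((K.card.choose l : ℝ) / (u.choose l : ℝ) * a) := by
  classical
  have hu : (0 : ℝ) < u.choose l := by exact_mod_cast Nat.choose_pos hlu
  have h1 : ENNReal.ofReal (u.choose l : ℝ) *
      seedLaw n D {ω | u ≤ (unresolvedSet T L K i ω).card} ≤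
      ENNReal.ofReal ((K.card.choose l : ℝ) * a) := by
    calc _ ≤ ∫⁻ ω, ∑ J ∈ K.powersetCard l, Set.indicator {ω | Unresolved T L K i J ω} 1 ω
          ∂seedLaw n D := by
          have hm : AEMeasurable (fun ω => ∑ J ∈ K.powersetCard l,
              Set.indicator {ω | Unresolved T L K i J ω} (1 : Sample n D → ℝ≥0∞) ω)
              (seedLaw n D) :=
            (Finset.measurable_fun_sum _ fun J _ =>
              (measurable_one.indicator (measurableSet_unresolved i J))).aemeasurable
          refine le_trans ?_ (mul_meas_ge_le_lintegral₀ hm (ENNReal.ofReal (u.choose l : ℝ)))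
          refine mul_le_mul_right (measure_mono fun ω hω => ?_) _
          have hω' : u ≤ (unresolvedSet T L K i ω).card := hω
          show _ ≤ ∑ J ∈ K.powersetCard l,
            Set.indicator {ω | Unresolved T L K i J ω} (1 : Sample n D → ℝ≥0∞) ω
          have e1 : ∑ J ∈ K.powersetCard l, Set.indicator {ω | Unresolved T L K i J ω}
              (1 : Sample n D → ℝ≥0∞) ω = ((unresolvedSet T L K i ω).card.choose l : ℝ≥0∞) := by
            have e2 : ∀ J ∈ K.powersetCard l, Set.indicator {ω | Unresolved T L K i J ω}
                (1 : Sample n D → ℝ≥0∞) ω = if J ⊆ unresolvedSet T L K i ω then 1 else 0 := by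
              intro J hJ
              rw [Finset.mem_powersetCard] at hJ
              rw [Set.indicator_apply]
              simp only [Set.mem_ofPred_eq, unresolved_iff_subset hJ.1, Pi.one_apply]
            rw [Finset.sum_congr rfl e2, Finset.sum_boole]
            have e3 : (K.powersetCard l).filter (· ⊆ unresolvedSet T L K i ω) =
                (unresolvedSet T L K i ω).powersetCard l := by
              ext J
              simp only [Finset.mem_filter, Finset.mem_powersetCard]
              have : unresolvedSet T L K i ω ⊆ K := Finset.filter_subset _ _
              exact ⟨fun h => ⟨h.2, h.1.2⟩, fun h => ⟨⟨h.1.trans this, h.2⟩, h.1⟩⟩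
            rw [e3, Finset.card_powersetCard]
          rw [e1, ENNReal.ofReal_natCast]
          exact_mod_cast Nat.choose_le_choose l hω'
      _ = ∑ J ∈ K.powersetCard l, seedLaw n D {ω | Unresolved T L K i J ω} := by
          rw [lintegral_finsetSum _ fun J _ =>
            measurable_one.indicator (measurableSet_unresolved i J)]
          exact Finset.sum_congr rfl fun J _ =>
            lintegral_indicator_one (measurableSet_unresolved i J)
      _ ≤ ∑ J ∈ K.powersetCard l, ENNReal.ofReal a := by
          refine Finset.sum_le_sum fun J hJ => ?_
          rw [Finset.mem_powersetCard] at hJ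
          exact h J hJ.1 hJ.2
      _ = _ := by
          rw [Finset.sum_const, Finset.card_powersetCard, nsmul_eq_mul,
            ENNReal.ofReal_mul (Nat.cast_nonneg _), ENNReal.ofReal_natCast]
  rw [div_mul_eq_mul_div, ENNReal.ofReal_div_of_pos hu, ENNReal.le_div_iff_mul_le
    (Or.inl (by simpa using (Nat.choose_pos hlu).ne')) (Or.inl ENNReal.ofReal_ne_top), mul_comm]
  exact h1

end Unresolved

/-! ### Resolving a given column within two rows -/

/-- The indicator function of the supports that contain `j` and at most `T` elements of `K`. -/
def resolves {α : Type*} [DecidableEq α] (T : ℕ) (K : Finset α) (j : α) (R : Finset α) : ℝ :=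
  if j ∈ R ∧ (R ∩ K).card ≤ T then 1 else 0

section Resolve

variable {n D L T : ℕ} {K : Finset (Fin n)} {ω : Sample n D}

theorem rowAvg_sub_mul (i : ℕ) (c a : ℝ) (f : Finset (Fin n) → ℝ) :
    rowAvg L ω i (fun R => c * (1 - a * f R)) = c * (1 - a * rowAvg L ω i f) := by
  have h : (Fintype.card (Equiv.Perm (Fin n)) : ℝ) ≠ 0 := by exact_mod_cast Fintype.card_pos.ne'
  unfold rowAvg
  rw [← Finset.mul_sum, Finset.sum_sub_distrib, ← Finset.mul_sum]
  simp only [Finset.sum_const, Finset.card_univ, nsmul_eq_mul, mul_one]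
  field_simp

open Classical in
theorem measure_unresolved_eq (i : ℕ) (j : Fin n) (c : ℝ) :
    ∫⁻ ω, ENNReal.ofReal ((if Unresolved T L K i {j} ω then 1 else 0) * c) ∂seedLaw n D =
      ENNReal.ofReal c * seedLaw n D {ω | Unresolved T L K i {j} ω} := by
  rw [← lintegral_indicator_one (measurableSet_unresolved i {j}), ← lintegral_const_mul _
    (measurable_one.indicator (measurableSet_unresolved i {j}))]
  refine lintegral_congr fun ω => ?_
  by_cases h : Unresolved T L K i {j} ω <;> simp [h]

open Classical in
/-- A lower bound for the conditional probability that row `i` resolves `j`. -/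
theorem measure_unresolved_succ_le_lintegral {i : ℕ} {j : Fin n} {r : Sample n D → ℝ}
    (h : ∀ ω, r ω ≤ rowAvg L ω i (resolves T K j)) :
    seedLaw n D {ω | Unresolved T L K (i + 1) {j} ω} ≤
      ∫⁻ ω, ENNReal.ofReal ((if Unresolved T L K i {j} ω then 1 else 0) * (1 - r ω))
        ∂seedLaw n D := by
  classical
  have h1 : seedLaw n D {ω | Unresolved T L K (i + 1) {j} ω} ≤
      ∫⁻ ω, ENNReal.ofReal ((if Unresolved T L K i {j} ω then 1 else 0) *
        (1 - 1 * resolves T K j (rowSupport L ω i))) ∂seedLaw n D := by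
    rw [← lintegral_indicator_one (measurableSet_unresolved (i + 1) {j})]
    refine lintegral_mono fun ω => ?_
    rw [Set.indicator_apply]
    simp only [Set.mem_ofPred_eq, Pi.one_apply]
    split_ifs with h1 h2
    · have h3 := (unresolved_succ.1 h1).2
      rw [resolves, if_neg]
      · simp
      · rintro ⟨h4, h5⟩
        have := h3 ⟨j, by simp [h4]⟩
        omega
    · exact absurd (unresolved_succ.1 h1).1 h2
    · exact zero_le
    · exact zero_le
  refine h1.trans (lintegral_row_le
    (F := fun ω R => (if Unresolved T L K i {j} ω then 1 else 0) * (1 - 1 * resolves T K j R))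
    ?_ ?_ ?_)
  · intro R a b hab
    have h2 := past_unresolved T L i K {j} a b hab
    simp only at h2 ⊢
    simp only [h2]
  · intro ω R
    unfold resolves
    split_ifs <;> norm_num
  · intro ω
    show rowAvg L ω i (fun R => (if Unresolved T L K i {j} ω then 1 else 0) *
      (1 - 1 * resolves T K j R)) ≤ _
    rw [rowAvg_sub_mul, one_mul]
    have h2 : (0 : ℝ) ≤ if Unresolved T L K i {j} ω then 1 else 0 := by split_ifs <;> norm_num
    exact mul_le_mul_of_nonneg_left (by linarith [h ω]) h2

theorem measure_unresolved_succ_le {i : ℕ} {j : Fin n} {p : ℝ}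
    (h : ∀ ω : Sample n D, p ≤ rowAvg L ω i (resolves T K j)) :
    seedLaw n D {ω | Unresolved T L K (i + 1) {j} ω} ≤
      ENNReal.ofReal (1 - p) * seedLaw n D {ω | Unresolved T L K i {j} ω} := by
  rw [← measure_unresolved_eq]
  exact measure_unresolved_succ_le_lintegral h

open Classical in
/-- If row `i` is `good` with probability at least `b`, and the next row then resolves `j` with
probability at least `a`, then `j` is resolved by the two rows with probability at least
`a * b`. -/
theorem measure_unresolved_add_two_le {i : ℕ} {j : Fin n} {a b : ℝ} (ha : 0 ≤ a) (ha1 : a ≤ 1)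
    {good : Sample n D → Finset (Fin n) → Prop} [∀ ω R, Decidable (good ω R)]
    (hgood : ∀ R, Past i fun ω => good ω R)
    (hb : ∀ ω : Sample n D, b ≤ rowAvg L ω i fun R => if good ω R then 1 else 0)
    (h : ∀ ω : Sample n D, good ω (rowSupport L ω i) →
      a ≤ rowAvg L ω (i + 1) (resolves T K j)) :
    seedLaw n D {ω | Unresolved T L K (i + 2) {j} ω} ≤
      ENNReal.ofReal (1 - a * b) * seedLaw n D {ω | Unresolved T L K i {j} ω} := by
  have h1 : seedLaw n D {ω | Unresolved T L K (i + 1 + 1) {j} ω} ≤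
      ∫⁻ ω, ENNReal.ofReal ((if Unresolved T L K (i + 1) {j} ω then 1 else 0) *
        (1 - a * if good ω (rowSupport L ω i) then 1 else 0)) ∂seedLaw n D := by
    refine measure_unresolved_succ_le_lintegral
      (r := fun ω => a * if good ω (rowSupport L ω i) then 1 else 0) fun ω => ?_
    split_ifs with hg
    · rw [mul_one]; exact h ω hg
    · rw [mul_zero]
      refine div_nonneg (Finset.sum_nonneg fun π _ => ?_) (Nat.cast_nonneg _)
      unfold resolves
      split_ifs <;> norm_num
  refine h1.trans ?_
  rw [← measure_unresolved_eq]
  have h2 : ∫⁻ ω, ENNReal.ofReal ((if Unresolved T L K (i + 1) {j} ω then 1 else 0) *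
        (1 - a * if good ω (rowSupport L ω i) then 1 else 0)) ∂seedLaw n D ≤
      ∫⁻ ω, ENNReal.ofReal ((if Unresolved T L K i {j} ω then 1 else 0) *
        (1 - a * if good ω (rowSupport L ω i) then 1 else 0)) ∂seedLaw n D := by
    refine lintegral_mono fun ω => ENNReal.ofReal_le_ofReal
      (mul_le_mul_of_nonneg_right ?_ ?_)
    · by_cases h3 : Unresolved T L K (i + 1) {j} ω
      · rw [if_pos h3, if_pos (h3.anti (Nat.le_succ i))]
      · rw [if_neg h3]; split_ifs <;> norm_num
    · split_ifs <;> linarith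
  refine h2.trans (lintegral_row_le
    (F := fun ω R => (if Unresolved T L K i {j} ω then 1 else 0) *
      (1 - a * if good ω R then 1 else 0)) ?_ ?_ ?_)
  · intro R x y hxy
    have h3 := past_unresolved T L i K {j} x y hxy
    have h4 := hgood R x y hxy
    simp only at h3 h4 ⊢
    simp only [h3, h4]
  · intro ω R
    refine mul_nonneg (by split_ifs <;> norm_num) ?_
    split_ifs <;> linarith
  · intro ω
    show rowAvg L ω i (fun R => (if Unresolved T L K i {j} ω then 1 else 0) *
      (1 - a * if good ω R then 1 else 0)) ≤ _
    rw [rowAvg_sub_mul]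
    have h3 : (0 : ℝ) ≤ if Unresolved T L K i {j} ω then 1 else 0 := by split_ifs <;> norm_num
    refine mul_le_mul_of_nonneg_left ?_ h3
    linarith [mul_le_mul_of_nonneg_left (hb ω) ha]

/-- If within each block of `W` rows there are rows which resolve `j` with conditional probability
at least `p`, then the probability that `j` is never resolved decays geometrically. -/
theorem measure_unresolved_le_pow {j : Fin n} {W : ℕ} {p : ℝ} (hp : p ≤ 1)
    (h : ∀ t, ∃ i i', W * t ≤ i ∧ i' ≤ W * (t + 1) ∧
      seedLaw n D {ω | Unresolved T L K i' {j} ω} ≤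
        ENNReal.ofReal (1 - p) * seedLaw n D {ω | Unresolved T L K i {j} ω}) (d : ℕ) :
    seedLaw n D {ω | Unresolved T L K (W * d) {j} ω} ≤ ENNReal.ofReal ((1 - p) ^ d) := by
  induction d with
  | zero =>
    have : IsProbabilityMeasure (seedLaw n D) := by unfold seedLaw; infer_instance
    simpa using prob_le_one
  | succ d ih =>
    obtain ⟨i, i', h1, h2, h3⟩ := h d
    calc _ ≤ seedLaw n D {ω | Unresolved T L K i' {j} ω} :=
          measure_mono fun ω (hω : Unresolved T L K _ {j} ω) => hω.anti h2
      _ ≤ _ := h3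
      _ ≤ ENNReal.ofReal (1 - p) * seedLaw n D {ω | Unresolved T L K (W * d) {j} ω} := by
          refine mul_le_mul_right (measure_mono fun ω (hω : Unresolved T L K _ {j} ω) => ?_) _
          exact hω.anti h1
      _ ≤ ENNReal.ofReal (1 - p) * ENNReal.ofReal ((1 - p) ^ d) := by gcongr
      _ = _ := by rw [← ENNReal.ofReal_mul (by linarith), pow_succ']

/-- Two consecutive rows, of which the first one exhausts the columns of smallest degree and the
second one does not. -/
theorem measure_unresolved_of_le_of_lt (hn : 0 < n) (hL : L < n) {i : ℕ} {j : Fin n} {a : ℝ}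
    (ha : 0 ≤ a) (ha1 : a ≤ 1)
    (hi : n - i * L % n ≤ L) (hi' : L < n - (i + 1) * L % n)
    (h : ∀ C : Finset (Fin n), C.card = n - (i + 1) * L % n → j ∈ C →
      a ≤ subsetAvg C L (resolves T K j)) :
    seedLaw n D {ω | Unresolved T L K (i + 2) {j} ω} ≤
      ENNReal.ofReal (1 - a * (((n : ℝ) - L) / n)) *
        seedLaw n D {ω | Unresolved T L K i {j} ω} := by
  have hn' : (0 : ℝ) < n := by exact_mod_cast hn
  have hL' : (L : ℝ) < n := by exact_mod_cast hL
  refine measure_unresolved_add_two_le ha ha1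
    (good := fun ω R => j ∈ (R \ minSet L ω i)ᶜ) ?_ ?_ ?_
  · intro R x y hxy
    have h1 := past_minSet L i x y hxy
    simp only at h1 ⊢
    rw [h1]
  · intro ω
    rw [rowAvg_of_le hn hL.le hi]
    set M := minSet L ω i with hM
    have hc : M.card = n - i * L % n := card_minSet hn hL.le i
    have hcard : Mᶜ.card = n - M.card := by rw [Finset.card_compl, Fintype.card_fin]
    have hMn : (M.card : ℝ) ≤ n := by rw [hc]; exact_mod_cast Nat.sub_le _ _
    have hML : (M.card : ℝ) ≤ L := by rw [hc]; exact_mod_cast hi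
    have hb1 : ((n : ℝ) - L) / n ≤ 1 := by
      rw [div_le_one hn']
      linarith [Nat.cast_nonneg (α := ℝ) L]
    by_cases hj : j ∈ M
    · have : ∀ Q ∈ Mᶜ.powersetCard (L - M.card), (1 : ℝ) ≤
          (if j ∈ ((M ∪ Q) \ M)ᶜ then 1 else 0) := by
        intro Q _
        rw [if_pos]
        simp [hj]
      refine hb1.trans (le_trans (le_of_eq ?_) (subsetAvg_mono this))
      rw [subsetAvg_const]
      rw [hcard]; omega
    · have hjC : j ∈ Mᶜ := Finset.mem_compl.2 hj
      have : ∀ Q ∈ Mᶜ.powersetCard (L - M.card), (1 : ℝ) - (if j ∈ Q then 1 else 0) ≤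
          (if j ∈ ((M ∪ Q) \ M)ᶜ then 1 else 0) := by
        intro Q _
        by_cases hq : j ∈ Q
        · rw [if_pos hq]; split_ifs <;> norm_num
        · rw [if_neg hq, if_pos]
          · norm_num
          · simp [hj, hq]
      refine le_trans ?_ (subsetAvg_mono this)
      rw [subsetAvg_sub, subsetAvg_const (by rw [hcard]; omega),
        subsetAvg_mem hjC (by rw [hcard]; omega), hcard, Nat.cast_sub (by omega),
        Nat.cast_sub (by omega)]
      have h0 : (0 : ℝ) < n - M.card := by linarith
      rw [one_sub_div h0.ne', div_le_div_iff₀ hn' h0]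
      nlinarith [Nat.cast_nonneg (α := ℝ) M.card]
  · intro ω hg
    rw [rowAvg_of_lt hn hL.le hi']
    refine h _ (card_minSet hn hL.le _) ?_
    rw [minSet_succ_of_le hn hL.le hi]
    exact hg

/-- Two consecutive rows, of which the second one exhausts the columns of smallest degree and the
first one does not. If only few columns of smallest degree remain after the first row, then most
likely `j` and most elements of `K` are not among these. -/
theorem measure_unresolved_of_lt_of_le (hn : 0 < n) (hL0 : 0 < L) (hL : L < n) {i ν : ℕ}
    {j : Fin n} {a : ℝ} (ha : 0 ≤ a) (ha1 : a ≤ 1) (hν : ν ≤ T)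
    (hi : L < n - i * L % n) (hi' : n - (i + 1) * L % n ≤ L)
    (h : ∀ C : Finset (Fin n), C.card = (i + 1) * L % n → j ∈ C →
      a ≤ subsetAvg C (L - (n - (i + 1) * L % n)) (resolves (T - ν) K j)) :
    seedLaw n D {ω | Unresolved T L K (i + 2) {j} ω} ≤
      ENNReal.ofReal (1 - a * (1 - (1 + (K.card : ℝ) / (ν + 1)) *
        ((n - (i + 1) * L % n : ℕ) / L))) *
        seedLaw n D {ω | Unresolved T L K i {j} ω} := by
  have hLr : (0 : ℝ) < L := by exact_mod_cast hL0
  refine measure_unresolved_add_two_le ha ha1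
    (good := fun ω R => j ∉ minSet L ω i \ R ∧ ((minSet L ω i \ R) ∩ K).card ≤ ν) ?_ ?_ ?_
  · intro R x y hxy
    have h1 := past_minSet L i x y hxy
    simp only at h1 ⊢
    rw [h1]
  · intro ω
    rw [rowAvg_of_lt hn hL.le hi]
    set M := minSet L ω i with hM
    have hc : M.card = n - i * L % n := card_minSet hn hL.le i
    have hmod := succ_mul_mod_of_lt hn hi
    have hlt := Nat.mod_lt ((i + 1) * L) hn
    have hMc : M.card = L + (n - (i + 1) * L % n) := by omega
    have hLM : L ≤ M.card := by omega
    -- Markov's inequality for the numbers of elements of `{j}` and of `K` outside the row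
    have hpt : ∀ R ∈ M.powersetCard L, (1 : ℝ) - (∑ x ∈ M ∩ {j}, (1 - if x ∈ R then 1 else 0) +
        ((ν : ℝ) + 1)⁻¹ * ∑ x ∈ M ∩ K, (1 - if x ∈ R then 1 else 0)) ≤
        if j ∉ M \ R ∧ ((M \ R) ∩ K).card ≤ ν then 1 else 0 := by
      intro R _
      have e : ∀ A : Finset (Fin n), ∑ x ∈ M ∩ A, ((1 : ℝ) - if x ∈ R then 1 else 0) =
          (((M \ R) ∩ A).card : ℝ) := by
        intro A
        have : ∀ x ∈ M ∩ A, ((1 : ℝ) - if x ∈ R then 1 else 0) = if x ∉ R then 1 else 0 := by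
          intro x _
          split_ifs <;> norm_num
        rw [Finset.sum_congr rfl this, Finset.sum_boole]
        congr 2
        ext x
        simp only [Finset.mem_filter, Finset.mem_inter, Finset.mem_sdiff]
        tauto
      rw [e, e]
      split_ifs with hg
      · have : 0 ≤ ((ν : ℝ) + 1)⁻¹ * (((M \ R) ∩ K).card : ℝ) := by positivity
        have : (0 : ℝ) ≤ (((M \ R) ∩ {j}).card : ℝ) := by positivity
        linarith
      · rw [not_and_or, not_not, not_le] at hg
        have h0 : 0 ≤ ((ν : ℝ) + 1)⁻¹ * (((M \ R) ∩ K).card : ℝ) := by positivity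
        have h0' : (0 : ℝ) ≤ (((M \ R) ∩ {j}).card : ℝ) := by positivity
        rcases hg with hg | hg
        · have : (1 : ℝ) ≤ (((M \ R) ∩ {j}).card : ℝ) := by
            exact_mod_cast Finset.card_pos.2 ⟨j, by simpa using hg⟩
          linarith
        · have h1 : (ν : ℝ) + 1 ≤ (((M \ R) ∩ K).card : ℝ) := by exact_mod_cast hg
          have h2 := mul_le_mul_of_nonneg_left h1 (by positivity : (0 : ℝ) ≤ ((ν : ℝ) + 1)⁻¹)
          rw [inv_mul_cancel₀ (by positivity)] at h2
          linarith
    refine le_trans ?_ (subsetAvg_mono hpt)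
    have hsum : ∀ A : Finset (Fin n),
        subsetAvg M L (fun R => ∑ x ∈ M ∩ A, ((1 : ℝ) - if x ∈ R then 1 else 0)) ≤
        A.card * ((n - (i + 1) * L % n : ℕ) / L) := by
      intro A
      rw [subsetAvg_sum]
      have : ∀ x ∈ M ∩ A, subsetAvg M L (fun R => (1 : ℝ) - if x ∈ R then 1 else 0) ≤
          ((n - (i + 1) * L % n : ℕ) : ℝ) / L := by
        intro x hx
        rw [subsetAvg_sub, subsetAvg_const hLM, subsetAvg_mem (Finset.mem_inter.1 hx).1 hLM, hMc,
          Nat.cast_add, one_sub_div (by positivity), div_le_div_iff₀ (by positivity) hLr]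
        nlinarith [Nat.cast_nonneg (α := ℝ) (n - (i + 1) * L % n)]
      refine (Finset.sum_le_sum this).trans ?_
      rw [Finset.sum_const, nsmul_eq_mul]
      refine mul_le_mul_of_nonneg_right ?_ (by positivity)
      exact_mod_cast Finset.card_le_card Finset.inter_subset_right
    rw [subsetAvg_sub, subsetAvg_const hLM, subsetAvg_add, subsetAvg_mul_left]
    have h1 := hsum {j}
    have h2 := mul_le_mul_of_nonneg_left (hsum K) (by positivity : (0 : ℝ) ≤ ((ν : ℝ) + 1)⁻¹)
    rw [Finset.card_singleton] at h1
    push_cast at h1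
    have e : (1 + (K.card : ℝ) / (ν + 1)) * ((n - (i + 1) * L % n : ℕ) / L) =
      1 * ((n - (i + 1) * L % n : ℕ) / L) +
        ((ν : ℝ) + 1)⁻¹ * (K.card * ((n - (i + 1) * L % n : ℕ) / L)) := by
      field_simp
    rw [e]
    linarith
  · rintro ω ⟨hg1, hg2⟩
    rw [rowAvg_of_le hn hL.le hi']
    set M := minSet L ω (i + 1) with hM
    have hMeq : M = minSet L ω i \ rowSupport L ω i := minSet_succ_of_lt hn hL.le hi
    rw [← hMeq] at hg1 hg2
    have hc : M.card = n - (i + 1) * L % n := card_minSet hn hL.le _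
    have hlt := Nat.mod_lt ((i + 1) * L) hn
    have h1 := h Mᶜ (by rw [Finset.card_compl, Fintype.card_fin, hc]; omega)
      (Finset.mem_compl.2 hg1)
    rw [← hc] at h1
    refine h1.trans (subsetAvg_mono fun Q _ => ?_)
    unfold resolves
    by_cases hq : j ∈ Q ∧ (Q ∩ K).card ≤ T - ν
    · rw [if_pos hq, if_pos]
      refine ⟨Finset.mem_union_right _ hq.1, ?_⟩
      rw [Finset.union_inter_distrib_right]
      have := Finset.card_union_le (M ∩ K) (Q ∩ K)
      omega
    · rw [if_neg hq]; split_ifs <;> norm_num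

end Resolve

/-! ### Windows of rows for measurement degrees of the order of the length -/

/-- The conditions on the parameters of the measurement that remain when decoding is not trivial:
the measurement degree `L` and the number `k` of nonzero entries exceed `T`, and the sparsity is
at most about `(T + 2) / (2 L)`. The inequality is a form of
`(L - 1) * (-log (1 - k / n)) < (T + 2) / 2` without logarithms. -/
structure Admissible (T n L k : ℕ) : Prop where
  one_le : 1 ≤ T
  lt_degree : T < L
  degree_le : L ≤ n
  lt_sparsity : T < k
  sparsity_lt : k < n
  degree_mul : 4 * ((L : ℝ) - 1) * k < (T + 2) * (2 * n - k)

section Admissible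

variable {T n L k : ℕ}

/-- There is a row that contains a given column of `K` and at most `T` elements of `K`. -/
theorem Admissible.add_le (h : Admissible T n L k) : k + L ≤ n + T := by
  by_contra hc
  push Not at hc
  obtain ⟨u, hu⟩ : ∃ u, n = k + u := ⟨n - k, by have := h.sparsity_lt; omega⟩
  have h1 : (u : ℝ) + T ≤ (L : ℝ) - 1 := by
    have : u + T + 1 ≤ L := by omega
    have : (u : ℝ) + T + 1 ≤ L := by exact_mod_cast this
    linarith
  have h2 := h.degree_mul
  have hnu : (n : ℝ) = k + u := by exact_mod_cast hu
  have hT : (1 : ℝ) ≤ T := by exact_mod_cast h.one_le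
  have hk : (T : ℝ) + 1 ≤ k := by exact_mod_cast h.lt_sparsity
  have hu1 : (1 : ℝ) ≤ u := by
    have : 1 ≤ u := by have := h.sparsity_lt; omega
    exact_mod_cast this
  rw [hnu] at h2
  have h3 : 4 * ((u : ℝ) + T) * k ≤ 4 * ((L : ℝ) - 1) * k := by gcongr
  have h4 : 0 ≤ (u : ℝ) * (2 * k - T - 2) := mul_nonneg (by linarith) (by linarith)
  have h5 : 0 < (k : ℝ) * (3 * T - 2) := mul_pos (by linarith) (by linarith)
  nlinarith

theorem Admissible.degree_sub_one_le (h : Admissible T n L k) :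
    4 * ((L : ℝ) - 1) * k ≤ (T + 2) * (2 * n) := by
  have := h.degree_mul
  have h1 : (0 : ℝ) ≤ (T + 2) * k := by positivity
  linarith

theorem Admissible.degree_lt (h : Admissible T n L k) : (L : ℝ) < 3 / 4 * n + 1 := by
  have h1 := h.degree_mul
  have hT : (1 : ℝ) ≤ T := by exact_mod_cast h.one_le
  have hk : (T : ℝ) + 1 ≤ k := by exact_mod_cast h.lt_sparsity
  have hL : (T : ℝ) + 1 ≤ L := by exact_mod_cast h.lt_degree
  have hn : (k : ℝ) < n := by exact_mod_cast h.sparsity_lt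
  have h2 : 4 * ((L : ℝ) - 1) * (T + 1) ≤ 4 * ((L : ℝ) - 1) * k :=
    mul_le_mul_of_nonneg_left hk (by linarith)
  by_contra hc
  push Not at hc
  have h3 : 4 * (3 / 4 * n : ℝ) * (T + 1) ≤ 4 * ((L : ℝ) - 1) * (T + 1) := by
    gcongr
    linarith
  have h4 : 0 ≤ (n : ℝ) * (T - 1) := mul_nonneg (by linarith) (by linarith)
  have h5 : 0 ≤ ((T : ℝ) + 2) * k := by positivity
  nlinarith

theorem Admissible.sparsity_le (h : Admissible T n L k) (hn : n ≤ 20 * L) :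
    k ≤ 20 * (T + 2) := by
  have h1 := h.degree_sub_one_le
  have hT : (1 : ℝ) ≤ T := by exact_mod_cast h.one_le
  have hL : (T : ℝ) + 1 ≤ L := by exact_mod_cast h.lt_degree
  have hn' : (n : ℝ) ≤ 20 * L := by exact_mod_cast hn
  have h2 : ((T : ℝ) + 2) * (2 * n) ≤ (T + 2) * (2 * (20 * (2 * (L - 1)))) := by
    gcongr
    linarith
  have h3 : ((L : ℝ) - 1) * k ≤ (L - 1) * (20 * (T + 2)) := by linarith
  have h4 : (k : ℝ) ≤ 20 * (T + 2) := le_of_mul_le_mul_left h3 (by linarith)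
  exact_mod_cast h4

end Admissible

section Windows

variable {n D L T : ℕ}

/-- The last row before every column has been used `d + 1` times. -/
theorem row_before_wrap (hL0 : 0 < L) (hL : L ≤ n) (d : ℕ) :
    ((d + 1) * n - 1) / L * L / n = d ∧ n - ((d + 1) * n - 1) / L * L % n ≤ L := by
  have h1 := Nat.div_add_mod ((d + 1) * n - 1) L
  have h2 := Nat.mod_lt ((d + 1) * n - 1) hL0
  set i := ((d + 1) * n - 1) / L
  have hi : i * L = L * i := mul_comm _ _
  have hd : (d + 1) * n = d * n + n := by ring
  have hdiv : i * L / n = d := by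
    refine Nat.div_eq_of_lt_le ?_ ?_ <;> omega
  refine ⟨hdiv, ?_⟩
  have h3 := Nat.div_add_mod (i * L) n
  rw [hdiv, mul_comm n d] at h3
  omega

theorem exists_row_of_le (hL0 : 0 < L) (hL : L ≤ n) {c : ℕ} (hn : n ≤ c * L) (i₀ : ℕ) :
    ∃ i, i₀ ≤ i ∧ i ≤ i₀ + c ∧ n - i * L % n ≤ L := by
  have hn0 : 0 < n := by omega
  refine ⟨((i₀ * L / n + 1) * n - 1) / L, ?_, ?_, (row_before_wrap hL0 hL _).2⟩
  · rw [Nat.le_div_iff_mul_le hL0]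
    have h1 := Nat.div_add_mod (i₀ * L) n
    have h2 := Nat.mod_lt (i₀ * L) hn0
    have h3 : (i₀ * L / n + 1) * n = n * (i₀ * L / n) + n := by ring
    omega
  · refine Nat.div_le_of_le_mul ?_
    have h1 := Nat.div_mul_le_self (i₀ * L) n
    have h3 : (i₀ * L / n + 1) * n = i₀ * L / n * n + n := by ring
    have h4 : L * (i₀ + c) = i₀ * L + c * L := by ring
    omega

theorem exists_row_of_lt (hL : 5 * L ≤ 4 * n) (hL0 : 0 < L) (i₀ : ℕ) :
    ∃ i, i₀ ≤ i ∧ i ≤ i₀ + 10 ∧ L < n - i * L % n := by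
  by_contra hc
  push Not at hc
  have hn0 : 0 < n := by omega
  have h : ∀ t ≤ 10, (i₀ + t) * L / n = i₀ * L / n + t := by
    intro t ht
    induction t with
    | zero => simp
    | succ t ih =>
      have h1 := succ_mul_div_of_le hn0 (by omega) (hc (i₀ + t) (by omega) (by omega))
      rw [← add_assoc, h1, ih (by omega)]
      ring
  have h1 := h 10 le_rfl
  have h2 := Nat.div_mul_le_self ((i₀ + 10) * L) n
  rw [h1] at h2
  have h3 := Nat.div_add_mod (i₀ * L) n
  have h4 := Nat.mod_lt (i₀ * L) hn0
  have h5 : (i₀ * L / n + 10) * n = n * (i₀ * L / n) + 10 * n := by ring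
  have h6 : (i₀ + 10) * L = i₀ * L + 10 * L := by ring
  omega

/-- Within a bounded number of rows there are two consecutive ones for which the smallest degree
changes in the first one and which leave much room for the second one, or for which it changes
in the second one, and for which the first one uses most columns of smallest degree. -/
theorem exists_window (hL0 : 0 < L) (hL : 5 * L ≤ 4 * n) (hn : n ≤ 20 * L) {δ : ℝ} (hδ : 0 < δ)
    (hδ1 : δ ≤ 1 / 20) (i₀ : ℕ) :
    ∃ i, i₀ ≤ i ∧ i + 2 ≤ i₀ + 30 ∧
      ((n - i * L % n ≤ L ∧ (L : ℝ) + δ * n ≤ (n - (i + 1) * L % n : ℕ) ∧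
          (1 + δ) * n ≤ 2 * ((n - (i + 1) * L % n : ℕ) : ℝ)) ∨
        (L < n - i * L % n ∧ n - (i + 1) * L % n ≤ L ∧
          ((n - (i + 1) * L % n : ℕ) : ℝ) ≤ δ * n ∧ (n : ℝ) ≤ 11 / 5 * L)) := by
  have hn0 : 0 < n := by omega
  have hLn : L ≤ n := by omega
  have hn0' : (0 : ℝ) < n := by exact_mod_cast hn0
  have hLr : (0 : ℝ) < L := by exact_mod_cast hL0
  rcases le_or_gt (2 * L) n with h2 | h2
  · obtain ⟨i, hi1, hi2, hi⟩ := exists_row_of_le hL0 hLn hn (i₀ + 1)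
    obtain ⟨i, rfl⟩ : ∃ i', i = i' + 1 := ⟨i - 1, by omega⟩
    have hm := succ_mul_mod_of_le hn0 hLn hi
    have hlt := Nat.mod_lt ((i + 1) * L) hn0
    have hm' : n - (i + 1 + 1) * L % n = n - L + (n - (i + 1) * L % n) := by omega
    have h2r : 2 * (L : ℝ) ≤ n := by exact_mod_cast h2
    by_cases hc : 11 / 5 * (L : ℝ) ≤ n ∨ δ * n ≤ ((n - (i + 1) * L % n : ℕ) : ℝ)
    · refine ⟨i + 1, by omega, by omega, Or.inl ⟨hi, ?_⟩⟩
      rw [hm', Nat.cast_add, Nat.cast_sub hLn]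
      rcases hc with hc | hc
      · have : (0 : ℝ) ≤ ((n - (i + 1) * L % n : ℕ) : ℝ) := by positivity
        constructor <;> nlinarith
      · constructor <;> linarith
    · rw [not_or, not_le, not_le] at hc
      have hni : L < n - i * L % n := by
        by_contra hcon
        have hm2 := succ_mul_mod_of_le hn0 hLn (not_lt.1 hcon)
        have hlt2 := Nat.mod_lt (i * L) hn0
        omega
      exact ⟨i, by omega, by omega, Or.inr ⟨hni, hi, hc.2.le, hc.1.le⟩⟩
  · obtain ⟨i, hi1, hi2, hi⟩ := exists_row_of_lt hL hL0 (i₀ + 1)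
    have hm := succ_mul_mod_of_lt hn0 hi
    have h2r : (n : ℝ) < 2 * L := by exact_mod_cast h2
    by_cases hc : (L : ℝ) + δ * n ≤ ((n - i * L % n : ℕ) : ℝ)
    · obtain ⟨i, rfl⟩ : ∃ i', i = i' + 1 := ⟨i - 1, by omega⟩
      have hni : n - i * L % n ≤ L := by
        by_contra hcon
        have hm2 := succ_mul_mod_of_lt hn0 (not_le.1 hcon)
        omega
      refine ⟨i, by omega, by omega, Or.inl ⟨hni, hc, ?_⟩⟩
      have : 0 < δ * n := by positivity
      linarith
    · refine ⟨i, by omega, by omega, Or.inr ⟨hi, by omega, ?_, by linarith⟩⟩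
      rw [not_le] at hc
      have h3 : n - i * L % n = L + (n - (i + 1) * L % n) := by omega
      rw [h3, Nat.cast_add] at hc
      linarith

variable {K : Finset (Fin n)}

/-- When all columns have the same degree, the next row is a uniformly distributed subset of all
columns, so that it is a particular one with probability at least `2 ^ (-n)`. -/
theorem Admissible.le_rowAvg (h : Admissible T n L K.card) {j : Fin n} (hj : j ∈ K)
    (ω : Sample n D) (q : ℕ) : (1 / 2 : ℝ) ^ n ≤ rowAvg L ω (n * q) (resolves T K j) := by
  have h1 := h.add_le
  have h2 := h.lt_sparsity
  have h3 := h.lt_degree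
  have hT := h.one_le
  have hn : 0 < n := by omega
  have hmod : n * q * L % n = 0 := by rw [mul_assoc]; exact Nat.mul_mod_right _ _
  have hM : minSet L ω (n * q) = Finset.univ := by
    rw [← Finset.card_eq_iff_eq_univ, card_minSet hn h.degree_le, hmod, Fintype.card_fin,
      Nat.sub_zero]
  rw [rowAvg_of_lt hn h.degree_le (by omega), hM]
  -- a row within `A ∪ Kᶜ`, where `A ⊆ K` has `T` elements
  obtain ⟨A, hjA, hAK, hA⟩ := Finset.exists_subsuperset_card_eq (s := {j}) (t := K) (n := T)
    (by simpa using hj) (by simpa using hT) h2.le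
  obtain ⟨R, hjR, hRA, hR⟩ := Finset.exists_subsuperset_card_eq (s := {j}) (t := A ∪ Kᶜ) (n := L)
    (hjA.trans Finset.subset_union_left) (by rw [Finset.card_singleton]; omega) (by
      rw [Finset.card_union_of_disjoint, Finset.card_compl, Fintype.card_fin, hA]
      · omega
      · exact (disjoint_compl_right (a := K)).mono_left hAK)
  have hres : resolves T K j R = 1 := by
    rw [resolves, if_pos]
    refine ⟨hjR (Finset.mem_singleton_self j), ?_⟩
    rw [← hA]
    refine Finset.card_le_card fun x hx => ?_
    rw [Finset.mem_inter] at hx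
    have := hRA hx.1
    simp only [Finset.mem_union, Finset.mem_compl] at this
    tauto
  have hch : (0 : ℝ) < (n.choose L : ℝ) := by exact_mod_cast Nat.choose_pos h.degree_le
  rw [subsetAvg, Finset.card_univ, Fintype.card_fin, le_div_iff₀ hch]
  have hle : (n.choose L : ℝ) ≤ 2 ^ n := by exact_mod_cast Nat.choose_le_two_pow n L
  calc (1 / 2 : ℝ) ^ n * (n.choose L : ℝ) ≤ (1 / 2 : ℝ) ^ n * 2 ^ n := by gcongr
    _ = 1 := by rw [← mul_pow]; norm_num
    _ = resolves T K j R := hres.symm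
    _ ≤ _ := Finset.single_le_sum (f := fun Q => resolves T K j Q)
      (fun Q _ => by unfold resolves; split_ifs <;> norm_num)
      (by rw [Finset.mem_powersetCard]; exact ⟨Finset.subset_univ _, hR⟩)

theorem Admissible.measure_unresolved_le_of_length_le (h : Admissible T n L K.card) {j : Fin n}
    (hj : j ∈ K) {n₀ : ℕ} (hn₀ : n ≤ n₀) (d : ℕ) :
    seedLaw n D {ω | Unresolved T L K (n₀ * d) {j} ω} ≤
      ENNReal.ofReal ((1 - (1 / 2) ^ n₀) ^ d) := by
  have hn : 0 < n := by have := h.sparsity_lt; omega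
  refine measure_unresolved_le_pow (pow_le_one₀ (by norm_num) (by norm_num)) (fun t => ?_) d
  have h1 := Nat.div_add_mod (n₀ * t + n - 1) n
  have h2 := Nat.mod_lt (n₀ * t + n - 1) hn
  have h3 : n₀ * (t + 1) = n₀ * t + n₀ := by ring
  refine ⟨n * ((n₀ * t + n - 1) / n), n * ((n₀ * t + n - 1) / n) + 1, by omega, by omega, ?_⟩
  refine measure_unresolved_succ_le fun ω => le_trans ?_ (h.le_rowAvg hj ω _)
  exact pow_le_pow_of_le_one (by norm_num) (by norm_num) hn₀

/-- Within a window of rows, `j` is resolved with a probability that is bounded from below. -/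
def ResolvesInWindow (T L D : ℕ) (K : Finset (Fin n)) (j : Fin n) (p : ℝ) : Prop :=
  ∀ i₀, ∃ i i', i₀ ≤ i ∧ i' ≤ i₀ + 30 ∧
    seedLaw n D {ω | Unresolved T L K i' {j} ω} ≤
      ENNReal.ofReal (1 - p) * seedLaw n D {ω | Unresolved T L K i {j} ω}

/-- The window lemma reduces to lower bounds for the probability that a single row resolves `j`: for
a row among the columns in `C`, or for a row that consists of `n₁` columns outside `C`, of which at
most `ν` are in `K`, and of a random subset of `C`. -/
theorem Admissible.resolvesInWindow_of (h : Admissible T n L K.card) (hn : n ≤ 20 * L) {j : Fin n}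
    (hnL : 5 * L ≤ 4 * n) {δ a p : ℝ} {ν : ℕ} (hν : ν ≤ T)
    (hδ : 0 < δ) (hδ1 : δ ≤ 1 / 20) (ha : 0 ≤ a) (ha1 : a ≤ 1) (hp : p ≤ a / 5)
    (hδν : (n : ℝ) ≤ 11 / 5 * L → (1 + (K.card : ℝ) / (ν + 1)) * (11 / 5 * δ) ≤ 4 / 5)
    (h1 : ∀ C : Finset (Fin n), j ∈ C → (L : ℝ) + δ * n ≤ C.card → (1 + δ) * n ≤ 2 * (C.card : ℝ) →
      a ≤ subsetAvg C L (resolves T K j))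
    (h2 : ∀ (C : Finset (Fin n)) (n₁ : ℕ), j ∈ C → C.card + n₁ = n → n₁ ≤ L → (n₁ : ℝ) ≤ δ * n →
      (n : ℝ) ≤ 11 / 5 * L → a ≤ subsetAvg C (L - n₁) (resolves (T - ν) K j)) :
    ResolvesInWindow T L D K j p := by
  intro i₀
  have hL0 : 0 < L := by have := h.lt_degree; omega
  have hn0 : 0 < n := by omega
  have hn' : (0 : ℝ) < n := by exact_mod_cast hn0
  have hL' : (0 : ℝ) < L := by exact_mod_cast hL0
  have hnL' : 5 * (L : ℝ) ≤ 4 * n := by exact_mod_cast hnL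
  obtain ⟨i, hi0, hi2, ⟨hi, hP1, hP2⟩ | ⟨hi, hi', hn1, hLn⟩⟩ := exists_window hL0 hnL hn hδ hδ1 i₀
  · refine ⟨i, i + 2, hi0, hi2, (measure_unresolved_of_le_of_lt (j := j) hn0 (by omega) ha ha1 hi
      ?_ fun C hC hj => h1 C hj (by rw [hC]; exact hP1) (by rw [hC]; exact hP2)).trans ?_⟩
    · have : (L : ℝ) < (n - (i + 1) * L % n : ℕ) := by
        have : 0 < δ * n := by positivity
        linarith
      exact_mod_cast this
    · refine mul_le_mul_left (ENNReal.ofReal_le_ofReal ?_) _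
      have : 1 / 5 ≤ ((n : ℝ) - L) / n := by rw [div_le_div_iff₀ (by norm_num) hn']; linarith
      nlinarith
  · refine ⟨i, i + 2, hi0, hi2, (measure_unresolved_of_lt_of_le (j := j) hn0 hL0 (by omega) ha ha1
      hν hi hi' fun C hC hj => h2 C _ hj ?_ hi' hn1 hLn).trans ?_⟩
    · have := Nat.mod_lt ((i + 1) * L) hn0
      omega
    · refine mul_le_mul_left (ENNReal.ofReal_le_ofReal ?_) _
      have h3 : ((n - (i + 1) * L % n : ℕ) : ℝ) / L ≤ 11 / 5 * δ := by
        rw [div_le_iff₀ hL']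
        nlinarith
      have h4 : (1 + (K.card : ℝ) / (ν + 1)) * (((n - (i + 1) * L % n : ℕ) : ℝ) / L) ≤
          (1 + (K.card : ℝ) / (ν + 1)) * (11 / 5 * δ) :=
        mul_le_mul_of_nonneg_left h3 (by positivity)
      have h5 := hδν hLn
      nlinarith

/-- For large `T`, a row among slightly more than `n / 2` columns has fewer than `T` elements in `K`
in the mean. -/
theorem Admissible.resolvesInWindow_of_le (h : Admissible T n L K.card) (hn : n ≤ 20 * L)
    {j : Fin n} (hj : j ∈ K) (hT : 1000 ≤ T) : ResolvesInWindow T L D K j (1 / 100000) := by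
  have hL1 := h.lt_degree
  have hLn := h.degree_le
  have hTr : (1000 : ℝ) ≤ T := by exact_mod_cast hT
  have hLr : (T : ℝ) + 1 ≤ L := by exact_mod_cast hL1
  have hnr : (L : ℝ) ≤ n := by exact_mod_cast hLn
  have hd := h.degree_sub_one_le
  have hkr : (T : ℝ) + 1 ≤ K.card := by exact_mod_cast h.lt_sparsity
  have hL20 : (n : ℝ) ≤ 20 * L := by exact_mod_cast hn
  have hLlt := h.degree_lt
  have hk1 : ((K.card : ℝ) - 1) * (L - 1) ≤ (T + 2) * n / 2 := by nlinarith
  refine h.resolvesInWindow_of hn ?_ (δ := 1 / 20) (a := 1 / 5000) (ν := T / 4) (by omega)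
    (by norm_num) le_rfl (by norm_num) (by norm_num) (by norm_num) ?_ ?_ ?_
  · have : 5 * (L : ℝ) ≤ 4 * n := by linarith
    exact_mod_cast this
  · intro hn2
    have hν : ((T : ℝ) + 1) / 4 ≤ ((T / 4 : ℕ) : ℝ) + 1 := by
      rw [div_le_iff₀ (by norm_num)]
      have : T + 1 ≤ (T / 4 + 1) * 4 := by omega
      exact_mod_cast this
    have hk : (K.card : ℝ) ≤ 111 / 100 * (T + 2) := by
      refine le_of_mul_le_mul_left ?_ (by linarith : (0 : ℝ) < L - 1)
      nlinarith
    have : (K.card : ℝ) / ((T / 4 : ℕ) + 1) ≤ 5 := by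
      rw [div_le_iff₀ (by positivity)]
      linarith
    nlinarith
  · intro C hjC hC1 hC2
    have hCL : L ≤ C.card := by
      have : (L : ℝ) ≤ C.card := by linarith
      exact_mod_cast this
    have hC0 : (0 : ℝ) < C.card := by linarith
    have hCn : (C.card : ℝ) ≤ n := by exact_mod_cast (Finset.card_le_univ C).trans (by simp)
    refine le_trans ?_ (le_subsetAvg_of_markov (p := 1 / 200) hjC hj h.one_le (by omega) hCL
      (by omega) ?_)
    · have : 1 / 20 ≤ (L : ℝ) / C.card := by
        rw [div_le_div_iff₀ (by norm_num) hC0]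
        linarith
      linarith
    · refine hk1.trans ?_
      have h3 : (514 / 1000 : ℝ) * n ≤ C.card - 1 := by linarith
      have h4 : (1 - 1 / 200) * (T : ℝ) * (514 / 1000 * n) ≤ (1 - 1 / 200) * T * (C.card - 1) := by
        gcongr
      nlinarith
  · intro C n₁ hjC hC hn1 hn1' hn2
    have hCr : (C.card : ℝ) + n₁ = n := by exact_mod_cast hC
    have hq : ((L - n₁ : ℕ) : ℝ) = L - n₁ := Nat.cast_sub hn1
    have hlt : (n₁ : ℝ) < L := by nlinarith
    have hlt' : n₁ < L := by exact_mod_cast hlt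
    have hC0 : (0 : ℝ) < C.card := by linarith
    have hC2 : 2 ≤ C.card := by
      have : (2 : ℝ) ≤ C.card := by linarith
      exact_mod_cast this
    refine le_trans ?_ (le_subsetAvg_of_markov (p := 1 / 100) hjC hj (by omega) (by omega)
      (by omega) hC2 ?_)
    · have : 1 / 20 ≤ ((L - n₁ : ℕ) : ℝ) / C.card := by
        rw [div_le_div_iff₀ (by norm_num) hC0, hq]
        linarith
      linarith
    · rw [hq]
      have h4 : ((K.card : ℝ) - 1) * (L - n₁ - 1) ≤ (K.card - 1) * (L - 1) := by
        have := Nat.cast_nonneg (α := ℝ) n₁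
        refine mul_le_mul_of_nonneg_left (by linarith) (by linarith)
      have h5 : (3 / 4 : ℝ) * T ≤ ((T - T / 4 : ℕ) : ℝ) := by
        have : 3 * T ≤ 4 * (T - T / 4) := by omega
        have : (3 : ℝ) * T ≤ 4 * ((T - T / 4 : ℕ) : ℝ) := by exact_mod_cast this
        linarith
      have h6 : (9 / 10 : ℝ) * n ≤ C.card - 1 := by linarith
      have h7 : (1 - 1 / 100) * (3 / 4 * (T : ℝ)) * (9 / 10 * n) ≤
          (1 - 1 / 100) * ((T - T / 4 : ℕ) : ℝ) * (C.card - 1) := by gcongr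
      refine h4.trans (hk1.trans (le_trans ?_ h7))
      nlinarith

/-- For small `T` and large `n`, the size of `K` is bounded, and a row may avoid all but one of its
elements. The bound `k₀` is a variable so that the power in the conclusion is not evaluated. -/
theorem Admissible.resolvesInWindow_of_lt {k₀ : ℕ} (hk₀ : k₀ = 20 * 1002)
    (h : Admissible T n L K.card) (hn : n ≤ 20 * L)
    {j : Fin n} (hj : j ∈ K) (hT : T < 1000) (hn₀ : 10 ^ 11 ≤ n) :
    ResolvesInWindow T L D K j (1 / 100 * (1 / 2000000) ^ k₀) := by
  have hL1 := h.lt_degree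
  have hLn := h.degree_le
  have hLr : (T : ℝ) + 1 ≤ L := by exact_mod_cast hL1
  have hnr : (L : ℝ) ≤ n := by exact_mod_cast hLn
  have hkk : K.card ≤ k₀ := by have := h.sparsity_le hn; omega
  have hkk' : (K.card : ℝ) ≤ 20040 := by
    have : K.card ≤ 20040 := by omega
    exact_mod_cast this
  have hn0r : (10 : ℝ) ^ 11 ≤ n := by exact_mod_cast hn₀
  have hL20 : (n : ℝ) ≤ 20 * L := by exact_mod_cast hn
  have hLlt := h.degree_lt
  have hT0 := Nat.cast_nonneg (α := ℝ) T
  have hpow : ∀ x : ℝ, 1 / 2000000 ≤ x → (1 / 2000000 : ℝ) ^ k₀ ≤ x ^ K.card := fun x hx =>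
    (pow_le_pow_of_le_one (by norm_num) (by norm_num) hkk).trans
      (pow_le_pow_left₀ (by norm_num) hx _)
  have hk0 : (0 : ℝ) ≤ (1 / 2000000) ^ k₀ := by positivity
  have hk1 : (1 / 2000000 : ℝ) ^ k₀ ≤ 1 := pow_le_one₀ (by norm_num) (by norm_num)
  refine h.resolvesInWindow_of hn ?_ (δ := 1 / 1000000) (a := 1 / 20 * (1 / 2000000) ^ k₀) (ν := 0)
    (by omega) (by norm_num) (by norm_num) (by linarith) (by linarith) (by linarith) ?_ ?_ ?_
  · have : 5 * (L : ℝ) ≤ 4 * n := by linarith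
    exact_mod_cast this
  · intro _
    rw [Nat.cast_zero, zero_add, div_one]
    linarith
  · intro C hjC hC1 hC2
    have hC0 : (0 : ℝ) < C.card := by linarith
    have hCn : (C.card : ℝ) ≤ n := by exact_mod_cast (Finset.card_le_univ C).trans (by simp)
    have hKC : (L : ℝ) + K.card ≤ C.card := by linarith
    have hKC' : L + K.card ≤ C.card := by exact_mod_cast hKC
    refine le_trans ?_ (le_subsetAvg_of_avoid (q := L) hjC hj h.one_le (by omega) (by omega)
      (by omega))
    have h1 : 1 / 20 ≤ (L : ℝ) / C.card := by
      rw [div_le_div_iff₀ (by norm_num) hC0]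
      linarith
    have h2 : (1 / 2000000 : ℝ) ≤ 1 - ((L : ℝ) - 1) / (C.card - K.card) := by
      have h0 : (0 : ℝ) < C.card - K.card := by linarith
      rw [one_sub_div h0.ne', div_le_div_iff₀ (by norm_num) h0]
      have := Nat.cast_nonneg (α := ℝ) K.card
      linarith
    exact mul_le_mul h1 (hpow _ h2) hk0 (by positivity)
  · intro C n₁ hjC hC hn1 hn1' hn2
    have hCr : (C.card : ℝ) + n₁ = n := by exact_mod_cast hC
    have hq : ((L - n₁ : ℕ) : ℝ) = L - n₁ := Nat.cast_sub hn1
    have hlt : (n₁ : ℝ) < L := by linarith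
    have hlt' : n₁ < L := by exact_mod_cast hlt
    have hC0 : (0 : ℝ) < C.card := by linarith
    have hKC : (L : ℝ) - n₁ + K.card ≤ C.card := by linarith
    have hKC' : L - n₁ + K.card ≤ C.card := by
      have : ((L - n₁ + K.card : ℕ) : ℝ) ≤ C.card := by rw [Nat.cast_add, hq]; exact hKC
      exact_mod_cast this
    rw [Nat.sub_zero]
    refine le_trans ?_ (le_subsetAvg_of_avoid (q := L - n₁) hjC hj h.one_le (by omega) (by omega)
      (by omega))
    have h1 : 1 / 20 ≤ ((L - n₁ : ℕ) : ℝ) / C.card := by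
      rw [div_le_div_iff₀ (by norm_num) hC0, hq]
      linarith
    have h2 : (1 / 2000000 : ℝ) ≤ 1 - (((L - n₁ : ℕ) : ℝ) - 1) / (C.card - K.card) := by
      have h0 : (0 : ℝ) < C.card - K.card := by linarith
      rw [one_sub_div h0.ne', div_le_div_iff₀ (by norm_num) h0, hq]
      have := Nat.cast_nonneg (α := ℝ) K.card
      have := Nat.cast_nonneg (α := ℝ) n₁
      linarith
    exact mul_le_mul h1 (hpow _ h2) hk0 (by positivity)

end Windows

/-- If the measurement degree is of the order of the length, the probability that a given column
remains unresolved decays geometrically, at an absolute rate. -/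
theorem exists_measure_unresolved_le : ∃ (W : ℕ) (p : ℝ), 0 < W ∧ 0 < p ∧ p ≤ 1 ∧
    ∀ {T n L D : ℕ} {K : Finset (Fin n)}, Admissible T n L K.card → n ≤ 20 * L → ∀ j ∈ K, ∀ d : ℕ,
      seedLaw n D {ω | Unresolved T L K (W * d) {j} ω} ≤ ENNReal.ofReal ((1 - p) ^ d) := by
  obtain ⟨k₀, hk₀⟩ : ∃ k₀ : ℕ, k₀ = 20 * 1002 := ⟨_, rfl⟩
  obtain ⟨n₀, hn₀⟩ : ∃ n₀ : ℕ, n₀ = 10 ^ 11 := ⟨_, rfl⟩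
  set p₁ : ℝ := (1 / 2) ^ n₀ with hp₁
  set p₂ : ℝ := 1 / 100 * (1 / 2000000) ^ k₀ with hp₂
  have hp₁0 : 0 < p₁ := by positivity
  have hp₂0 : 0 < p₂ := by positivity
  set p : ℝ := min p₁ (min p₂ (1 / 100000)) with hp
  have hpa : p ≤ p₁ := min_le_left _ _
  have hpb : p ≤ p₂ := (min_le_right _ _).trans (min_le_left _ _)
  have hpc : p ≤ 1 / 100000 := (min_le_right _ _).trans (min_le_right _ _)
  have hp₁1 : p₁ ≤ 1 := pow_le_one₀ (by norm_num) (by norm_num)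
  have hp1 : p ≤ 1 := by linarith
  have hn₀' : 30 ≤ n₀ := by rw [hn₀]; norm_num
  refine ⟨n₀, p, by omega, lt_min hp₁0 (lt_min hp₂0 (by norm_num)), hp1, ?_⟩
  intro T n L D K h hn j hj d
  rcases le_or_gt n n₀ with hle | hlt
  · refine (h.measure_unresolved_le_of_length_le hj hle d).trans (ENNReal.ofReal_le_ofReal ?_)
    exact pow_le_pow_left₀ (by linarith) (by linarith) d
  · have hwin : ∃ p', p ≤ p' ∧ ResolvesInWindow T L D K j p' := by
      rcases le_or_gt 1000 T with hT | hT
      · exact ⟨_, hpc, h.resolvesInWindow_of_le hn hj hT⟩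
      · exact ⟨_, hpb, h.resolvesInWindow_of_lt hk₀ hn hj hT (by omega)⟩
    obtain ⟨p', hpp, hw⟩ := hwin
    refine measure_unresolved_le_pow hp1 (fun t => ?_) d
    obtain ⟨i, i', h1, h2, h3⟩ := hw (n₀ * t)
    have h4 : n₀ * (t + 1) = n₀ * t + n₀ := by ring
    refine ⟨i, i', h1, by omega, h3.trans (mul_le_mul_left (ENNReal.ofReal_le_ofReal ?_) _)⟩
    linarith

/-! ### Small measurement degrees -/

/-- The decoder gets stuck: there is a nonempty stopping set within `K`. -/
def Stuck {n D : ℕ} (T L : ℕ) (K : Finset (Fin n)) (m : ℕ) (ω : Sample n D) : Prop :=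
  ∃ S ⊆ K, S.Nonempty ∧ Stopping T L ω m S

section Stuck

variable {n D L T : ℕ} {K : Finset (Fin n)}

theorem measurableSet_stuck (m : ℕ) : MeasurableSet {ω : Sample n D | Stuck T L K m ω} := by
  have : {ω : Sample n D | Stuck T L K m ω} =
      ⋃ S ∈ {S : Finset (Fin n) | S ⊆ K ∧ S.Nonempty}, {ω | Stopping T L ω m S} := by
    ext ω
    simp [Stuck, and_assoc]
  rw [this]
  exact MeasurableSet.biUnion (Set.to_countable _) fun S _ => measurableSet_stopping m S

/-- Once all columns are covered, a nonempty stopping set has more than `T` elements. -/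
theorem Stopping.lt_card {ω : Sample n D} {m : ℕ} {S : Finset (Fin n)} (h : Stopping T L ω m S)
    (hL : L ≤ n) (hm : n ≤ m * L) (hS : S.Nonempty) : T < S.card := by
  obtain ⟨j, hj⟩ := hS
  obtain ⟨i, hi, hji⟩ := exists_mem_rowSupport (ω := ω) (Fin.pos j) hL hm j
  rcases h i hi with h0 | h0
  · rw [Finset.card_eq_zero] at h0
    exact absurd (Finset.mem_inter.2 ⟨hji, hj⟩) (by rw [h0]; exact Finset.notMem_empty j)
  · exact h0.trans_le (Finset.card_le_card Finset.inter_subset_right)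

end Stuck

theorem choose_le_three_mul_div_pow (k : ℕ) {t : ℕ} (ht : 0 < t) :
    (k.choose t : ℝ) ≤ (3 * k / t) ^ t := by
  have ht' : (0 : ℝ) < t := by exact_mod_cast ht
  have h1 : (k.choose t : ℝ) ≤ (k : ℝ) ^ t / t.factorial := Nat.choose_le_pow_div t k
  have h2 := Real.pow_div_factorial_le_exp (t : ℝ) ht'.le t
  have h3 : Real.exp t ≤ 3 ^ t := by
    rw [← Real.exp_one_pow]
    exact pow_le_pow_left₀ (Real.exp_pos 1).le (by linarith [Real.exp_one_lt_d9]) t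
  have hf : (0 : ℝ) < t.factorial := by exact_mod_cast Nat.factorial_pos t
  refine h1.trans ?_
  rw [div_pow, mul_pow, div_le_div_iff₀ hf (by positivity)]
  rw [div_le_iff₀ hf] at h2
  have h4 : (t : ℝ) ^ t ≤ 3 ^ t * t.factorial := h2.trans (by gcongr)
  calc (k : ℝ) ^ t * (t : ℝ) ^ t ≤ (k : ℝ) ^ t * (3 ^ t * t.factorial) := by gcongr
    _ = _ := by ring

theorem exp_neg_two_mul_le {y : ℝ} (hy0 : 0 ≤ y) (hy : y ≤ 1 / 2) :
    Real.exp (-(2 * y)) ≤ 1 - y := by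
  rw [Real.exp_neg, inv_le_comm₀ (Real.exp_pos _) (by linarith)]
  refine le_trans ?_ (Real.add_one_le_exp (2 * y))
  rw [inv_le_iff_one_le_mul₀ (by linarith)]
  nlinarith

section Sparse

variable {n D L T : ℕ} {K : Finset (Fin n)}

/-- A random row that contains a given column of `K` has at most `T` elements in `K`, with a
probability that is bounded from below. -/
theorem Admissible.le_subsetAvg (h : Admissible T n L K.card) (hn : 20 * L ≤ n)
    {M : Finset (Fin n)} (hM : 9 * n ≤ 10 * M.card) {j : Fin n} (hjM : j ∈ M) (hj : j ∈ K) :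
    (L : ℝ) / M.card * Real.exp (-94) ≤
      subsetAvg M L fun Q => if j ∈ Q ∧ (Q ∩ K).card ≤ T then 1 else 0 := by
  have hL1 := h.lt_degree
  have hTr : (1 : ℝ) ≤ T := by exact_mod_cast h.one_le
  have hLr : (T : ℝ) + 1 ≤ L := by exact_mod_cast hL1
  have hnr : 20 * (L : ℝ) ≤ n := by exact_mod_cast hn
  have hMr : 9 * (n : ℝ) ≤ 10 * M.card := by exact_mod_cast hM
  have hd := h.degree_sub_one_le
  have hkr : (T : ℝ) + 1 ≤ K.card := by exact_mod_cast h.lt_sparsity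
  rcases le_or_gt 3 T with hT | hT
  · have hT3 : (3 : ℝ) ≤ T := by exact_mod_cast hT
    have he : Real.exp (-94) ≤ 1 / 20 := by
      have := Real.add_one_le_exp (94 : ℝ)
      rw [Real.exp_neg]
      rw [inv_le_comm₀ (Real.exp_pos _) (by norm_num)]
      linarith
    refine le_trans ?_ (le_subsetAvg_of_markov (p := 1 / 20) hjM hj h.one_le (by omega) (by omega)
      (by omega) ?_)
    · gcongr
    · have h3 : (88 / 100 : ℝ) * n ≤ M.card - 1 := by linarith
      have h4 : (1 - 1 / 20) * (T : ℝ) * (88 / 100 * n) ≤ (1 - 1 / 20) * T * (M.card - 1) := by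
        gcongr
      nlinarith
  · have hd' := h.degree_mul
    have hT2 : (T : ℝ) ≤ 2 := by exact_mod_cast (by omega : T ≤ 2)
    have hk0 : (0 : ℝ) ≤ K.card := Nat.cast_nonneg _
    have hL0 : (0 : ℝ) ≤ (L : ℝ) - 1 := by linarith
    have hkn : 7 * (K.card : ℝ) < 6 * n := by
      have : 4 * (T : ℝ) * K.card ≤ 4 * ((L : ℝ) - 1) * K.card := by gcongr; linarith
      have h1 : 0 ≤ ((T : ℝ) - 1) * K.card := mul_nonneg (by linarith) hk0
      have h2 : 0 ≤ (2 - (T : ℝ)) * K.card := mul_nonneg (by linarith) hk0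
      have h1' : 0 ≤ ((T : ℝ) - 1) * n := mul_nonneg (by linarith) (by linarith)
      have h2' : 0 ≤ (2 - (T : ℝ)) * n := mul_nonneg (by linarith) (by linarith)
      rcases (by have := h.one_le; omega : T = 1 ∨ T = 2) with rfl | rfl <;> push_cast at * <;>
        linarith
    -- `M` has twice as many columns outside `K` as the row has columns other than `j`
    have hhalf : 2 * ((L : ℝ) - 1) ≤ M.card - K.card := by
      rcases le_or_gt ((K.card : ℝ) * 2) n with hkn2 | hkn2
      · linarith
      · have hL3 : L ≤ 3 := by
          have h1 : 4 * ((L : ℝ) - 1) * (n / 2) ≤ 4 * ((L : ℝ) - 1) * K.card := by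
            gcongr; linarith
          have h2 : ((T : ℝ) + 2) * (2 * n - K.card) ≤ 4 * (2 * n - n / 2) := by
            refine mul_le_mul (by linarith) (by linarith) (by linarith) (by norm_num)
          have h3 : ((L : ℝ) - 1) * n < 3 * n := by linarith
          have h4 : (L : ℝ) - 1 < 3 := lt_of_mul_lt_mul_right h3 (by linarith)
          have h5 : (L : ℝ) < 4 := by linarith
          have : L < 4 := by exact_mod_cast h5
          omega
        have hkn' : 7 * K.card < 6 * n := by exact_mod_cast hkn
        have hT1 := h.one_le
        have hL23 : L = 2 ∨ L = 3 := by omega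
        rcases hL23 with rfl | rfl
        · have h2 : K.card + 2 ≤ M.card := by omega
          have : (K.card : ℝ) + 2 ≤ M.card := by exact_mod_cast h2
          push_cast
          linarith
        · have h60 : 60 ≤ n := hn
          rcases (by omega : T = 1 ∨ T = 2) with rfl | rfl <;> push_cast at * <;>
            linarith
    have hpos : (0 : ℝ) < (M.card : ℝ) - K.card := by linarith
    have hKM : K.card < M.card := by
      have : (K.card : ℝ) < M.card := by linarith
      exact_mod_cast this
    have hLM : L ≤ M.card - K.card := by
      have : (L : ℝ) + K.card ≤ M.card := by linarith
      have : L + K.card ≤ M.card := by exact_mod_cast this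
      omega
    refine le_trans ?_ (le_subsetAvg_of_avoid hjM hj h.one_le (by omega) hKM hLM)
    have hy : ((L : ℝ) - 1) / (M.card - K.card) ≤ 1 / 2 := by
      rw [div_le_iff₀ hpos]; linarith
    have hy0 : 0 ≤ ((L : ℝ) - 1) / (M.card - K.card) := div_nonneg hL0 hpos.le
    refine mul_le_mul_of_nonneg_left ?_ (by positivity)
    calc Real.exp (-94) ≤ Real.exp (-(2 * (((L : ℝ) - 1) / (M.card - K.card)))) ^ K.card := by
          rw [← Real.exp_nat_mul, Real.exp_le_exp]
          have h1 : (K.card : ℝ) * ((L - 1) / (M.card - K.card)) ≤ 47 := by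
            rw [← mul_div_assoc, div_le_iff₀ hpos]
            have h2 : ((T : ℝ) + 2) * (2 * n) ≤ 4 * (2 * n) := by gcongr; linarith
            nlinarith
          linarith
      _ ≤ _ := pow_le_pow_left₀ (Real.exp_pos _).le (exp_neg_two_mul_le hy0 hy) _

theorem Admissible.sparsity_mul_le (h : Admissible T n L K.card) :
    (K.card : ℝ) * L ≤ 2 * (T + 1) * n := by
  have hd := h.degree_sub_one_le
  have hTr : (1 : ℝ) ≤ T := by exact_mod_cast h.one_le
  have hLr : (T : ℝ) + 1 ≤ L := by exact_mod_cast h.lt_degree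
  have hn : (0 : ℝ) ≤ n := Nat.cast_nonneg n
  have hk : (0 : ℝ) ≤ K.card := Nat.cast_nonneg _
  have h1 : (K.card : ℝ) * L ≤ K.card * (2 * (L - 1)) := by gcongr; linarith
  nlinarith

theorem natCast_le_two_pow (t : ℕ) : (t : ℝ) ≤ 2 ^ t := by
  exact_mod_cast (Nat.lt_two_pow_self (n := t)).le

/-- The expected number of small stopping sets with `t` elements. -/
theorem choose_mul_pow_le {k t e : ℕ} {r : ℝ} (ht : 0 < t) (hL0 : 0 < L) (hn : 0 < n)
    (hk : (k : ℝ) * L ≤ 2 * (T + 1) * n) (hr0 : 0 < r) (hr : 81 * r ≤ 1 / 100000)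
    (hr2 : r ^ 2 = t * L / ((T + 1) * n)) :
    (k.choose t : ℝ) * (81 * r) ^ (t * (e + 3 + 1)) ≤
      2 * 10 ^ 9 * (L / n) * (1 / 100000) ^ e * (1 / 2) ^ t := by
  have hn' : (0 : ℝ) < n := by exact_mod_cast hn
  have hL' : (0 : ℝ) < L := by exact_mod_cast hL0
  have ht' : (0 : ℝ) < t := by exact_mod_cast ht
  have hT' : (0 : ℝ) < (T : ℝ) + 1 := by positivity
  -- `k.choose t ≤ (6 / r ^ 2) ^ t`, and `39366 = 6 * 81 ^ 2`
  set z : ℝ := 39366 * (81 * r) ^ (e + 2) with hz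
  have hz0 : 0 ≤ z := by positivity
  have h1 : (k.choose t : ℝ) * (81 * r) ^ (t * (e + 3 + 1)) ≤ z ^ t := by
    have h2 : (3 * k / t : ℝ) ≤ 6 / r ^ 2 := by
      rw [hr2, div_div_eq_mul_div, div_le_div_iff₀ ht' (by positivity)]
      nlinarith
    calc (k.choose t : ℝ) * (81 * r) ^ (t * (e + 3 + 1))
        ≤ (6 / r ^ 2) ^ t * (81 * r) ^ (t * (e + 3 + 1)) := by
          gcongr
          exact (choose_le_three_mul_div_pow k ht).trans (by gcongr)
      _ = z ^ t := by
          rw [mul_comm t, pow_mul, ← mul_pow, hz]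
          congr 1
          field_simp
          ring
  have hz1 : z ≤ 39366 * 6561 * (t * (L / n)) * (1 / 100000) ^ e := by
    have h2 : (81 * r) ^ e ≤ (1 / 100000) ^ e := pow_le_pow_left₀ (by positivity) hr e
    have h3 : r ^ 2 ≤ t * (L / n) := by
      rw [hr2, ← mul_div_assoc]
      exact div_le_div_of_nonneg_left (by positivity) hn'
        (le_mul_of_one_le_left hn'.le (by linarith [Nat.cast_nonneg (α := ℝ) T]))
    calc z = 39366 * 6561 * r ^ 2 * (81 * r) ^ e := by rw [hz]; ring
      _ ≤ _ := by gcongr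
  have hz2 : z ≤ 1 / 4 := by
    have h2 : (81 * r) ^ (e + 2) ≤ (81 * r) ^ 2 :=
      pow_le_pow_of_le_one (by positivity) (hr.trans (by norm_num)) (by omega)
    have h3 : (81 * r) ^ 2 ≤ (1 / 100000) ^ 2 := pow_le_pow_left₀ (by positivity) hr 2
    have : z ≤ 39366 * (1 / 100000) ^ 2 := by rw [hz]; gcongr; exact h2.trans h3
    exact this.trans (by norm_num)
  obtain ⟨s, rfl⟩ : ∃ s, t = s + 1 := ⟨t - 1, by omega⟩
  refine h1.trans ?_
  calc z ^ (s + 1) ≤ (1 / 4) ^ s * (39366 * 6561 * ((s + 1 : ℕ) * (L / n)) * (1 / 100000) ^ e) := by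
        rw [pow_succ]
        exact mul_le_mul (pow_le_pow_left₀ hz0 hz2 s) hz1 hz0 (by positivity)
    _ ≤ (1 / 4) ^ s * (39366 * 6561 * (2 ^ (s + 1) * (L / n)) * (1 / 100000) ^ e) := by
        gcongr
        exact natCast_le_two_pow _
    _ = 4 * 39366 * 6561 * (L / n) * (1 / 100000) ^ e * (1 / 2) ^ (s + 1) := by
        have : (1 / 4 : ℝ) ^ s = (1 / 2) ^ s * (1 / 2) ^ s := by rw [← mul_pow]; norm_num
        rw [this, pow_succ, pow_succ]
        have h5 : (2 : ℝ) ^ s * (1 / 2) ^ s = 1 := by rw [← mul_pow]; norm_num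
        linear_combination (1 / 2 : ℝ) ^ s * (39366 * 6561 * 2 * (L / n) * (1 / 100000) ^ e) * h5
    _ ≤ _ :=
        mul_le_mul_of_nonneg_right (mul_le_mul_of_nonneg_right (mul_le_mul_of_nonneg_right
          (by norm_num) (by positivity)) (by positivity)) (by positivity)

/-- It is unlikely that there are small stopping sets. The threshold is such that
`81 * r ≤ 1 / 100000`, where `r ^ 2 = |S| * L / ((T + 1) * n)`. -/
theorem measure_exists_small_stopping_le (h : Admissible T n L K.card) (hn : 20 * L ≤ n)
    {i e : ℕ} (hi : n - i * L % n ≤ L) (hd : i * L / n = e + 3) :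
    seedLaw n D {ω | ∃ S ⊆ K, T < S.card ∧
        (S.card : ℝ) * L ≤ (1 / 8100000) ^ 2 * ((T + 1) * n) ∧ Stopping T L ω i S} ≤
      ENNReal.ofReal (4 * 10 ^ 9 * (L / n) * (1 / 100000) ^ e) := by
  classical
  have hL0 : 0 < L := by have := h.lt_degree; omega
  have hn0 : 0 < n := by omega
  have hn' : (0 : ℝ) < n := by exact_mod_cast hn0
  have hL' : (0 : ℝ) < L := by exact_mod_cast hL0
  set I := K.powerset.filter fun S => T < S.card ∧
    (S.card : ℝ) * L ≤ (1 / 8100000) ^ 2 * ((T + 1) * n) with hI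
  set R : ℕ → ℝ := fun t => √(t * L / ((T + 1) * n)) with hR
  set c : ℕ → ℝ := fun t => if (0 < t ∧ (t : ℝ) * L ≤ (1 / 8100000) ^ 2 * ((T + 1) * n)) then
    (81 * R t) ^ (t * (e + 3 + 1)) else 0 with hc
  have hc0 : ∀ t, 0 ≤ c t := by
    intro t
    simp only [hc]
    split_ifs
    · have : 0 ≤ R t := Real.sqrt_nonneg _
      positivity
    · exact le_rfl
  have hR1 : ∀ t : ℕ, (t : ℝ) * L ≤ (1 / 8100000) ^ 2 * ((T + 1) * n) → R t ≤ 1 / 8100000 := by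
    intro t ht
    refine Real.sqrt_le_iff.2 ⟨by norm_num, ?_⟩
    rw [div_le_iff₀ (by positivity)]
    exact ht
  have hsub : {ω : Sample n D | ∃ S ⊆ K, T < S.card ∧
      (S.card : ℝ) * L ≤ (1 / 8100000) ^ 2 * ((T + 1) * n) ∧ Stopping T L ω i S} ⊆
      ⋃ S ∈ I, {ω | Stopping T L ω i S} := by
    rintro ω ⟨S, h1, h2, h3, h4⟩
    refine Set.mem_biUnion (x := S) ?_ h4
    simp only [hI, Finset.coe_filter, Finset.mem_powerset]
    exact ⟨h1, h2, h3⟩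
  have hstep : ∀ S ∈ I, seedLaw n D {ω | Stopping T L ω i S} ≤ ENNReal.ofReal (c S.card) := by
    intro S hS
    rw [hI, Finset.mem_filter] at hS
    have hS0 : (0 : ℝ) < S.card := by exact_mod_cast (by omega : 0 < S.card)
    have hr1 := hR1 _ hS.2.2
    refine (measure_stopping_le h.one_le hL0 (by omega) hS.2.1 (r := R S.card)
      (Real.sqrt_pos.2 (by positivity)) (hr1.trans (by norm_num)) (Real.sq_sqrt (by positivity))
      hi hd).trans (le_of_eq ?_)
    simp only [hc]
    rw [if_pos ⟨by omega, hS.2.2⟩]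
  calc seedLaw n D _ ≤ seedLaw n D (⋃ S ∈ I, {ω | Stopping T L ω i S}) := measure_mono hsub
    _ ≤ ∑ S ∈ I, seedLaw n D {ω | Stopping T L ω i S} := measure_biUnion_finset_le _ _
    _ ≤ ∑ S ∈ I, ENNReal.ofReal (c S.card) := Finset.sum_le_sum hstep
    _ = ENNReal.ofReal (∑ S ∈ I, c S.card) :=
        (ENNReal.ofReal_sum_of_nonneg fun S _ => hc0 _).symm
    _ ≤ ENNReal.ofReal (∑ S ∈ K.powerset, c S.card) :=
        ENNReal.ofReal_le_ofReal (Finset.sum_le_sum_of_subset_of_nonneg (Finset.filter_subset _ _)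
          fun S _ _ => hc0 _)
    _ ≤ _ := ENNReal.ofReal_le_ofReal ?_
  rw [Finset.sum_powerset_apply_card]
  calc ∑ t ∈ Finset.range (K.card + 1), K.card.choose t • c t
      ≤ ∑ t ∈ Finset.range (K.card + 1),
        2 * 10 ^ 9 * (L / n) * (1 / 100000) ^ e * (1 / 2 : ℝ) ^ t := by
        refine Finset.sum_le_sum fun t _ => ?_
        rw [nsmul_eq_mul]
        simp only [hc]
        split_ifs with ht
        · have ht0 : (0 : ℝ) < t := by exact_mod_cast ht.1
          have := hR1 t ht.2
          exact choose_mul_pow_le ht.1 hL0 hn0 h.sparsity_mul_le (Real.sqrt_pos.2 (by positivity))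
            (by linarith) (Real.sq_sqrt (by positivity))
        · rw [mul_zero]; positivity
    _ = 2 * 10 ^ 9 * (L / n) * (1 / 100000) ^ e *
          ∑ t ∈ Finset.range (K.card + 1), (1 / 2 : ℝ) ^ t := by
        rw [Finset.mul_sum]
    _ ≤ 2 * 10 ^ 9 * (L / n) * (1 / 100000) ^ e * 2 := by
        gcongr
        exact sum_geometric_two_le _
    _ = _ := by ring

/-- It is unlikely that there are large stopping sets. -/
theorem measure_exists_large_stopping_le (h : Admissible T n L K.card) (hn : 20 * L ≤ n)
    {i d l u : ℕ} (hi : n - i * L % n ≤ L) (hd : i * L / n = d) (hlu : l ≤ u)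
    (hu : (u : ℝ) * L < (1 / 8100000) ^ 2 * ((T + 1) * n) + L)
    (hl : 4 * ((l : ℝ) - 1) * L ≤ Real.exp (-94) * n) :
    seedLaw n D {ω | ∃ S ⊆ K, (1 / 8100000) ^ 2 * ((T + 1) * n) < (S.card : ℝ) * L ∧
        Stopping T L ω i S} ≤
      ENNReal.ofReal ((K.card.choose l : ℝ) / (u.choose l : ℝ) *
        (1 - Real.exp (-94) / 320) ^ (l * d)) := by
  have hL0 : 0 < L := by have := h.lt_degree; omega
  have hL' : (0 : ℝ) < L := by exact_mod_cast hL0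
  refine le_trans (measure_mono ?_) (measure_card_unresolvedSet_le (T := T) (L := L) (K := K)
    (i := i) hlu fun J hJ hJl => ?_)
  · rintro ω ⟨S, hSK, hS, hstopping⟩
    have h1 := (unresolved_iff_subset hSK).1 (hstopping.unresolved hSK)
    refine le_trans ?_ (Finset.card_le_card h1)
    have h2 : ((u : ℝ) - 1) * L < S.card * L := by linarith
    have h3 : (u : ℝ) - 1 < S.card := lt_of_mul_lt_mul_right h2 hL'.le
    have h4 : (u : ℝ) < S.card + 1 := by linarith
    have h5 : u < S.card + 1 := by exact_mod_cast h4
    omega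
  · rw [← hJl]
    refine measure_unresolved_le hL0 hn (Real.exp_pos _) ?_
      (fun M hM j hjM hj => h.le_subsetAvg hn hM hjM hj) hJ (by rw [hJl]; exact hl) hi hd
    exact Real.exp_le_one_iff.2 (by norm_num)

theorem setOf_stuck_subset {i : ℕ} (hL : L ≤ n) (hi : n ≤ i * L) :
    {ω : Sample n D | Stuck T L K i ω} ⊆
      {ω | ∃ S ⊆ K, T < S.card ∧
        (S.card : ℝ) * L ≤ (1 / 8100000) ^ 2 * ((T + 1) * n) ∧ Stopping T L ω i S} ∪
      {ω | ∃ S ⊆ K, (1 / 8100000) ^ 2 * ((T + 1) * n) < (S.card : ℝ) * L ∧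
        Stopping T L ω i S} := by
  rintro ω ⟨S, hSK, hS0, hS⟩
  rcases le_or_gt ((S.card : ℝ) * L) ((1 / 8100000) ^ 2 * ((T + 1) * n)) with h | h
  · exact Or.inl ⟨S, hSK, hS.lt_card hL hi hS0, h, hS⟩
  · exact Or.inr ⟨S, hSK, h, hS⟩

end Sparse

/-! ### Numbers of rows with which the decoder does not get stuck -/

section Rows

variable {n D L T : ℕ} {K : Finset (Fin n)}

theorem row_before_wrap_cast_le (hL0 : 0 < L) (d : ℕ) :
    ((((d + 1) * n - 1) / L : ℕ) : ℝ) ≤ (d + 1) * (n / L) := by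
  have hL' : (0 : ℝ) < L := by exact_mod_cast hL0
  have h1 : ((d + 1) * n - 1) / L * L ≤ (d + 1) * n :=
    (Nat.div_mul_le_self _ _).trans (Nat.sub_le _ _)
  have h2 : ((((d + 1) * n - 1) / L : ℕ) : ℝ) * L ≤ (d + 1) * n := by exact_mod_cast h1
  rw [← mul_div_assoc, le_div_iff₀ hL']
  exact h2

theorem le_row_before_wrap_mul (hL0 : 0 < L) (hL : L ≤ n) (d : ℕ) :
    n ≤ ((d + 2) * n - 1) / L * L := by
  have h := (row_before_wrap hL0 hL (d + 1)).1
  rw [show d + 1 + 1 = d + 2 from rfl] at h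
  have h2 := Nat.div_mul_le_self (((d + 2) * n - 1) / L * L) n
  rw [h] at h2
  have : (d + 1) * n = d * n + n := by ring
  omega

theorem choose_div_choose_le_pow {k u l : ℕ} (h : 2 * l ≤ u) :
    (k.choose l : ℝ) / (u.choose l : ℝ) ≤ (2 * k / u) ^ l := by
  rcases Nat.eq_zero_or_pos l with rfl | hl
  · simp
  have hu : (0 : ℝ) < u := by exact_mod_cast (by omega : 0 < u)
  have hc : (0 : ℝ) < u.choose l := by exact_mod_cast Nat.choose_pos (by omega)
  have hf : (0 : ℝ) < l.factorial := by exact_mod_cast Nat.factorial_pos l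
  have h1 : (k.choose l : ℝ) ≤ (k : ℝ) ^ l / l.factorial := Nat.choose_le_pow_div l k
  have h2 : ((u + 1 - l : ℕ) : ℝ) ^ l / l.factorial ≤ (u.choose l : ℝ) := Nat.pow_le_choose l u
  have h3 : (u / 2 : ℝ) ≤ ((u + 1 - l : ℕ) : ℝ) := by
    rw [div_le_iff₀ (by norm_num)]
    exact_mod_cast (by omega : u ≤ (u + 1 - l) * 2)
  have h4 : (u / 2 : ℝ) ^ l / l.factorial ≤ (u.choose l : ℝ) := le_trans (by gcongr) h2
  rw [div_le_iff₀ hc]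
  calc (k.choose l : ℝ) ≤ (k : ℝ) ^ l / l.factorial := h1
    _ = (2 * k / u) ^ l * ((u / 2) ^ l / l.factorial) := by
        rw [← mul_div_assoc, ← mul_pow]
        congr 2
        field_simp
    _ ≤ _ := by gcongr

/-- The threshold for the number of elements of a large stopping set. -/
theorem Admissible.threshold (h : Admissible T n L K.card) {u : ℕ}
    (hu : u = ⌈(1 / 8100000 : ℝ) ^ 2 * ((T + 1) * n) / L⌉₊) :
    (0 : ℝ) < u ∧ (u : ℝ) * L < (1 / 8100000) ^ 2 * ((T + 1) * n) + L ∧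
      (K.card : ℝ) / u ≤ 2 * 8100000 ^ 2 := by
  have hL0 : 0 < L := by have := h.lt_degree; omega
  have hn0 : 0 < n := by have := h.degree_le; omega
  have hn' : (0 : ℝ) < n := by exact_mod_cast hn0
  have hL' : (0 : ℝ) < L := by exact_mod_cast hL0
  have hx : 0 < (1 / 8100000 : ℝ) ^ 2 * ((T + 1) * n) / L := by positivity
  have h1 := Nat.le_ceil ((1 / 8100000 : ℝ) ^ 2 * ((T + 1) * n) / L)
  have h2 := Nat.ceil_lt_add_one hx.le
  rw [← hu] at h1 h2
  have hu0 : (0 : ℝ) < u := hx.trans_le h1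
  refine ⟨hu0, ?_, ?_⟩
  · have := mul_lt_mul_of_pos_right h2 hL'
    rwa [add_mul, one_mul, div_mul_cancel₀ _ hL'.ne'] at this
  · rw [div_le_iff₀ hu0]
    have h3 := h.sparsity_mul_le
    rw [div_le_iff₀ hL'] at h1
    refine le_of_mul_le_mul_right ?_ hL'
    nlinarith

theorem Admissible.measure_stuck_le (h : Admissible T n L K.card) (hn : 20 * L ≤ n) (e : ℕ)
    {l u : ℕ} (hu : u = ⌈(1 / 8100000 : ℝ) ^ 2 * ((T + 1) * n) / L⌉₊) (hlu : l ≤ u)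
    (hl : 4 * ((l : ℝ) - 1) * L ≤ Real.exp (-94) * n) :
    seedLaw n D {ω | Stuck T L K (((e + 3 + 1) * n - 1) / L) ω} ≤
      ENNReal.ofReal (4 * 10 ^ 9 * (L / n) * (1 / 100000) ^ e) +
      ENNReal.ofReal ((K.card.choose l : ℝ) / (u.choose l : ℝ) *
        (1 - Real.exp (-94) / 320) ^ (l * (e + 3))) := by
  have hL0 : 0 < L := by have := h.lt_degree; omega
  obtain ⟨h1, h2⟩ := row_before_wrap (n := n) hL0 h.degree_le (e + 3)
  refine (measure_mono (setOf_stuck_subset h.degree_le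
    (le_row_before_wrap_mul hL0 h.degree_le (e + 2)))).trans ((measure_union_le _ _).trans ?_)
  exact add_le_add (measure_exists_small_stopping_le h hn h2 h1)
    (measure_exists_large_stopping_le h hn h2 h1 hlu (h.threshold hu).2.1 hl)

end Rows

theorem exp_neg_div_mem : 0 < Real.exp (-94) / 320 ∧ Real.exp (-94) / 320 ≤ 1 / 320 := by
  have h : Real.exp (-94) ≤ 1 := Real.exp_le_one_iff.2 (by norm_num)
  exact ⟨by positivity, by linarith⟩

/-- The probability that the decoder is stuck decays geometrically in the number of rows. -/
theorem exists_measure_stuck_le : ∃ B a θ : ℝ, 0 < B ∧ 0 ≤ a ∧ 0 ≤ θ ∧ θ < 1 ∧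
    ∀ {T n L D : ℕ} {K : Finset (Fin n)}, Admissible T n L K.card → ∃ m : ℕ → ℕ, ∀ e : ℕ,
      n ≤ m e * L ∧ (m e : ℝ) ≤ B * (n / L) * (e + 1) ∧
      seedLaw n D {ω | Stuck T L K (m e) ω} ≤ ENNReal.ofReal (a * θ ^ e) := by
  obtain ⟨W, p, hW, hp0, hp1, hWp⟩ := exists_measure_unresolved_le
  set η : ℝ := 1 - Real.exp (-94) / 320 with hη
  obtain ⟨hx0, hx1⟩ := exp_neg_div_mem
  have hη0 : 1 / 100000 ≤ η := by linarith
  have hη1 : η < 1 := by linarith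
  have hW' : (1 : ℝ) ≤ W := by exact_mod_cast hW
  refine ⟨20 * W, 30 + (4 * 10 ^ 9 + 2 * 8100000 ^ 2), max η (1 - p), by positivity, by positivity,
    le_max_of_le_left (by linarith), max_lt hη1 (by linarith), ?_⟩
  intro T n L D K h
  have hL0 : 0 < L := by have := h.lt_degree; omega
  have hLn := h.degree_le
  have hn0 : 0 < n := by omega
  have hn' : (0 : ℝ) < n := by exact_mod_cast hn0
  have hL' : (0 : ℝ) < L := by exact_mod_cast hL0
  have hnL : 1 ≤ (n : ℝ) / L := by rw [one_le_div hL']; exact_mod_cast hLn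
  rcases le_or_gt n (20 * L) with hn | hn
  · refine ⟨fun e => W * (e + 20), fun e => ?_⟩
    have hcov : n ≤ W * (e + 20) * L := by
      refine hn.trans (Nat.mul_le_mul_right L ?_)
      calc 20 ≤ 1 * (e + 20) := by omega
        _ ≤ _ := Nat.mul_le_mul_right _ hW
    refine ⟨hcov, ?_, ?_⟩
    · push_cast
      have he : (0 : ℝ) ≤ e := Nat.cast_nonneg e
      calc (W : ℝ) * (e + 20) ≤ 20 * W * 1 * (e + 1) := by nlinarith
        _ ≤ _ := by gcongr
    · have h1 : seedLaw n D {ω | Stuck T L K (W * (e + 20)) ω} ≤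
          seedLaw n D {ω | T + 1 ≤ (unresolvedSet T L K (W * (e + 20)) ω).card} := by
        refine measure_mono ?_
        rintro ω ⟨S, hSK, hS0, hS⟩
        have h2 := hS.lt_card hLn hcov hS0
        exact le_trans h2 (Finset.card_le_card
          ((unresolved_iff_subset hSK).1 (hS.unresolved hSK)))
      refine h1.trans ((measure_card_unresolvedSet_le (l := 1) (a := (1 - p) ^ (e + 20)) (by omega)
        fun J hJ hJ1 => ?_).trans (ENNReal.ofReal_le_ofReal ?_))
      · obtain ⟨j, rfl⟩ := Finset.card_eq_one.1 hJ1
        exact hWp h hn j (hJ (Finset.mem_singleton_self j)) _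
      · rw [Nat.choose_one_right, Nat.choose_one_right]
        have h2 : (K.card : ℝ) / ((T + 1 : ℕ) : ℝ) ≤ 30 := by
          rw [div_le_iff₀ (by positivity)]
          have h3 := h.sparsity_le hn
          have h4 := h.one_le
          exact_mod_cast (by omega : K.card ≤ 30 * (T + 1))
        have h3 : (1 - p) ^ (e + 20) ≤ (max η (1 - p)) ^ e :=
          (pow_le_pow_of_le_one (by linarith) (by linarith) (by omega : e ≤ e + 20)).trans
            (pow_le_pow_left₀ (by linarith) (le_max_right _ _) e)
        refine mul_le_mul (h2.trans ?_) h3 (pow_nonneg (by linarith) _) (by positivity)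
        norm_num
  · refine ⟨fun e => ((e + 3 + 1) * n - 1) / L, fun e => ⟨le_row_before_wrap_mul hL0 hLn _, ?_, ?_⟩⟩
    · have h1 := row_before_wrap_cast_le (n := n) hL0 (e + 3)
      refine h1.trans ?_
      push_cast
      have he : (0 : ℝ) ≤ e := Nat.cast_nonneg e
      have h2 : (e : ℝ) + 3 + 1 ≤ 20 * W * (e + 1) := by nlinarith
      calc ((e : ℝ) + 3 + 1) * (n / L) ≤ 20 * W * (e + 1) * (n / L) := by gcongr
        _ = _ := by ring
    · obtain ⟨u, hu⟩ : ∃ u, u = ⌈(1 / 8100000 : ℝ) ^ 2 * ((T + 1) * n) / L⌉₊ := ⟨_, rfl⟩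
      obtain ⟨hu0, -, hku⟩ := h.threshold hu
      have hu1 : 1 ≤ u := by exact_mod_cast hu0
      refine (h.measure_stuck_le (by omega) e hu hu1 ?_).trans ?_
      · have : 0 ≤ Real.exp (-94) * n := by positivity
        push_cast
        linarith
      · rw [← ENNReal.ofReal_add (by positivity)
          (mul_nonneg (by positivity) (pow_nonneg (by linarith) _)),
          Nat.choose_one_right, Nat.choose_one_right]
        refine ENNReal.ofReal_le_ofReal ?_
        have hθ : η ≤ max η (1 - p) := le_max_left _ _
        have h1 : 4 * 10 ^ 9 * ((L : ℝ) / n) * (1 / 100000) ^ e ≤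
            4 * 10 ^ 9 * 1 * (max η (1 - p)) ^ e := by
          gcongr
          · rw [div_le_one hn']; exact_mod_cast hLn
          · linarith
        have h2 : (K.card : ℝ) / u * η ^ (1 * (e + 3)) ≤
            2 * 8100000 ^ 2 * (max η (1 - p)) ^ e := by
          refine mul_le_mul hku ?_ (pow_nonneg (by linarith) _) (by positivity)
          exact (pow_le_pow_of_le_one (by linarith) (by linarith) (by omega)).trans
            (pow_le_pow_left₀ (by linarith) hθ e)
        have h3 : 0 ≤ (max η (1 - p)) ^ e := pow_nonneg (le_max_of_le_left (by linarith)) _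
        linarith

/-- For signals with many nonzero entries, the decoder is most likely not stuck. -/
theorem exists_measure_stuck_le_of_sparsity : ∃ B : ℝ, 0 < B ∧ ∀ (T : ℕ) (ε : ℝ), 0 < ε →
    ∃ k₀ : ℕ, ∀ {n L D : ℕ} {K : Finset (Fin n)}, Admissible T n L K.card → k₀ ≤ K.card →
      ∃ m : ℕ, n ≤ m * L ∧ (m : ℝ) ≤ B * (n / L) ∧
        seedLaw n D {ω | Stuck T L K m ω} ≤ ENNReal.ofReal ε := by
  set η : ℝ := 1 - Real.exp (-94) / 320 with hη
  obtain ⟨hx0, hx1⟩ := exp_neg_div_mem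
  have hη0 : 0 < η := by linarith
  have hη1 : η < 1 := by linarith
  -- the smallest degree at which large stopping sets become unlikely
  obtain ⟨e, he⟩ := exists_pow_lt_of_lt_one (by norm_num : (0 : ℝ) < 1 / (8 * 8100000 ^ 2)) hη1
  refine ⟨e + 4, by positivity, fun T ε hε => ?_⟩
  obtain ⟨l, hl⟩ := exists_pow_lt_of_lt_one (by linarith : (0 : ℝ) < ε / 2)
    (by norm_num : (1 / 2 : ℝ) < 1)
  obtain ⟨N, hN⟩ := exists_nat_ge (max (8 * 10 ^ 9 / ε)
    (max (4 * l / Real.exp (-94)) (2 * l * 8100000 ^ 2)))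
  refine ⟨2 * (T + 1) * N + (20 * (T + 2) + 1), fun {n L D K} h hk => ?_⟩
  have hN1 : 8 * 10 ^ 9 / ε ≤ N := (le_max_left _ _).trans hN
  have hN2 : 4 * l / Real.exp (-94) ≤ N := ((le_max_left _ _).trans (le_max_right _ _)).trans hN
  have hN3 : 2 * l * 8100000 ^ 2 ≤ (N : ℝ) := ((le_max_right _ _).trans (le_max_right _ _)).trans hN
  have hL0 : 0 < L := by have := h.lt_degree; omega
  have hLn := h.degree_le
  have hn0 : 0 < n := by omega
  have hn' : (0 : ℝ) < n := by exact_mod_cast hn0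
  have hL' : (0 : ℝ) < L := by exact_mod_cast hL0
  have hnL : ¬ n ≤ 20 * L := by
    intro hc
    have := h.sparsity_le hc
    omega
  have hNL : (N : ℝ) * L ≤ n := by
    have h1 := h.sparsity_mul_le
    have h2 : 2 * ((T : ℝ) + 1) * N ≤ K.card := by
      exact_mod_cast (by omega : 2 * (T + 1) * N ≤ K.card)
    have h3 : 2 * ((T : ℝ) + 1) * N * L ≤ 2 * (T + 1) * n := (by gcongr : _ ≤ _).trans h1
    have h4 : 2 * ((T : ℝ) + 1) * (N * L) ≤ 2 * (T + 1) * n := by linarith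
    exact le_of_mul_le_mul_left h4 (by positivity)
  obtain ⟨u, hu⟩ : ∃ u, u = ⌈(1 / 8100000 : ℝ) ^ 2 * ((T + 1) * n) / L⌉₊ := ⟨_, rfl⟩
  obtain ⟨hu0, -, hku⟩ := h.threshold hu
  have hlu : 2 * l ≤ u := by
    have h1 : (2 * l : ℝ) ≤ u := by
      refine le_trans ?_ ((Nat.le_ceil _).trans_eq (by rw [hu]))
      rw [le_div_iff₀ hL']
      have h2 : 2 * l * 8100000 ^ 2 * (L : ℝ) ≤ n := (by gcongr : _ ≤ _).trans hNL
      have h3 : (n : ℝ) ≤ (T + 1) * n :=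
        le_mul_of_one_le_left hn'.le (by linarith [Nat.cast_nonneg (α := ℝ) T])
      linarith
    exact_mod_cast h1
  refine ⟨((e + 3 + 1) * n - 1) / L, le_row_before_wrap_mul hL0 hLn _, ?_, ?_⟩
  · have h1 := row_before_wrap_cast_le (n := n) hL0 (e + 3)
    refine h1.trans (le_of_eq ?_)
    push_cast
    ring
  · refine (h.measure_stuck_le (by omega) e hu (by omega : l ≤ u) ?_).trans ?_
    · rw [div_le_iff₀ (Real.exp_pos _)] at hN2
      have h2 : 4 * l * (L : ℝ) ≤ N * Real.exp (-94) * L := by gcongr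
      have h3 : (N : ℝ) * L * Real.exp (-94) ≤ n * Real.exp (-94) := by gcongr
      linarith
    · rw [← ENNReal.ofReal_add (by positivity)
        (mul_nonneg (by positivity) (pow_nonneg (by linarith) _))]
      refine ENNReal.ofReal_le_ofReal ?_
      have h1 : 4 * 10 ^ 9 * ((L : ℝ) / n) * (1 / 100000) ^ e ≤ ε / 2 := by
        have h2 : (1 / 100000 : ℝ) ^ e ≤ 1 := pow_le_one₀ (by norm_num) (by norm_num)
        have h3 : 4 * 10 ^ 9 * ((L : ℝ) / n) ≤ ε / 2 := by
          rw [← mul_div_assoc, div_le_iff₀ hn']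
          rw [div_le_iff₀ hε] at hN1
          have h4 : 8 * 10 ^ 9 * (L : ℝ) ≤ N * ε * L := by gcongr
          have h5 : (N : ℝ) * L * ε ≤ n * ε := by gcongr
          linarith
        calc _ ≤ 4 * 10 ^ 9 * ((L : ℝ) / n) * 1 := by gcongr
          _ ≤ _ := by linarith
      have h2 : (K.card.choose l : ℝ) / (u.choose l : ℝ) * η ^ (l * (e + 3)) ≤ ε / 2 := by
        have h3 : (2 * K.card / u : ℝ) ≤ 4 * 8100000 ^ 2 := by
          rw [mul_div_assoc]; linarith
        have h4 : η ^ (e + 3) ≤ 1 / (8 * 8100000 ^ 2) :=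
          (pow_le_pow_of_le_one hη0.le hη1.le (by omega)).trans he.le
        calc _ ≤ (2 * K.card / u : ℝ) ^ l * (η ^ (e + 3)) ^ l := by
              rw [mul_comm l, pow_mul]
              gcongr
              exact choose_div_choose_le_pow hlu
          _ = (2 * K.card / u * η ^ (e + 3)) ^ l := by rw [mul_pow]
          _ ≤ (4 * 8100000 ^ 2 * (1 / (8 * 8100000 ^ 2))) ^ l := by gcongr
          _ = (1 / 2) ^ l := by norm_num
          _ ≤ _ := hl.le
      linarith

/-! ### The minimum number of measurements -/

section Final

variable {n D L T k : ℕ} {w : Fin D → ℝ} {b : Fin n → ℝ}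

theorem minMeasurements_le_of_not_stuck (hb : IsBinarySignal k b) (hw : UniquelyDecodable w)
    (hLD : L ≤ D) (hL : L ≤ n) (hn : 0 < n) {ω : Sample n D} {m : ℕ} (hm : n ≤ m * L)
    (h : ¬ Stuck T L (support b) m ω) : minMeasurements T w hLD b ω ≤ m := by
  refine iInf₂_le m (reconstructs_of_no_stopping hb hw
    (fun j => exists_mem_rowSupport hn hL hm j) fun S hS hS0 hstopping => h ⟨S, hS, hS0, hstopping⟩)

/-- There are no stopping sets within `K` if all columns are covered and `T` is not smaller than the
measurement degree or the size of `K`. -/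
theorem not_stuck_of_le {K : Finset (Fin n)} (hL : L ≤ n) (h : L ≤ T ∨ K.card ≤ T)
    {ω : Sample n D} {m : ℕ} (hm : n ≤ m * L) : ¬ Stuck T L K m ω := by
  rintro ⟨S, hSK, ⟨j, hj⟩, hS⟩
  have h1 := hS.lt_card hL hm ⟨j, hj⟩
  have h2 := Finset.card_le_card hSK
  obtain ⟨i, hi, hji⟩ := exists_mem_rowSupport (ω := ω) (Fin.pos j) hL hm j
  have h3 := card_rowSupport (ω := ω) hL i
  rcases hS i hi with h0 | h0
  · rw [Finset.card_eq_zero] at h0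
    exact absurd (Finset.mem_inter.2 ⟨hji, hj⟩) (by rw [h0]; exact Finset.notMem_empty j)
  · have h4 : (rowSupport L ω i ∩ S).card ≤ (rowSupport L ω i).card :=
      Finset.card_le_card Finset.inter_subset_left
    omega

/-- If the probability to be stuck decays geometrically, the expected number of measurements is
finite. -/
theorem lintegral_minMeasurements_le (hb : IsBinarySignal k b) (hw : UniquelyDecodable w)
    (hLD : L ≤ D) (hL : L ≤ n) (hn : 0 < n) {m : ℕ → ℕ} {y a θ : ℝ} (hy : 0 ≤ y) (ha : 0 ≤ a)
    (hθ : 0 ≤ θ) (hθ1 : θ < 1) (h : ∀ e : ℕ, n ≤ m e * L ∧ (m e : ℝ) ≤ y * (e + 1) ∧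
      seedLaw n D {ω | Stuck T L (support b) (m e) ω} ≤ ENNReal.ofReal (a * θ ^ e)) :
    ∫⁻ ω, (minMeasurements T w hLD b ω : ℝ≥0∞) ∂seedLaw n D ≤
      ENNReal.ofReal (y * (1 + a / (1 - θ))) := by
  have hprob : IsProbabilityMeasure (seedLaw n D) := by unfold seedLaw; infer_instance
  have hmeas : ∀ e, Measurable
      ({ω : Sample n D | Stuck T L (support b) (m e) ω}.indicator (1 : Sample n D → ℝ≥0∞)) :=
    fun e => measurable_one.indicator (measurableSet_stuck _)
  have hpt : ∀ ω : Sample n D, (minMeasurements T w hLD b ω : ℝ≥0∞) ≤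
      ENNReal.ofReal y * (1 + ∑' e, {ω | Stuck T L (support b) (m e) ω}.indicator 1 ω) := by
    intro ω
    by_cases hex : ∃ e, ¬ Stuck T L (support b) (m e) ω
    · -- the first time at which the decoder is not stuck
      classical
      have h1 := Nat.find_spec hex
      set e := Nat.find hex with he
      have h2 := minMeasurements_le_of_not_stuck hb hw hLD hL hn (h e).1 h1
      have h3 : (minMeasurements T w hLD b ω : ℝ≥0∞) ≤ ((m e : ℕ) : ℝ≥0∞) := by
        exact_mod_cast h2
      have h4 : ((m e : ℕ) : ℝ≥0∞) ≤ ENNReal.ofReal y * (1 + (e : ℝ≥0∞)) := by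
        rw [← ENNReal.ofReal_natCast, ← ENNReal.ofReal_natCast, ← ENNReal.ofReal_one,
          ← ENNReal.ofReal_add zero_le_one (Nat.cast_nonneg e), ← ENNReal.ofReal_mul hy]
        refine ENNReal.ofReal_le_ofReal ?_
        rw [add_comm (1 : ℝ)]
        exact (h e).2.1
      refine h3.trans (h4.trans ?_)
      gcongr
      refine le_trans ?_ (ENNReal.sum_le_tsum (Finset.range e))
      rw [Finset.sum_congr rfl (g := fun _ => (1 : ℝ≥0∞))]
      · simp
      · intro e' he'
        have := Nat.find_min hex (Finset.mem_range.1 he')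
        rw [not_not] at this
        exact Set.indicator_of_mem (s := {ω | Stuck T L (support b) (m e') ω}) this _
    · push Not at hex
      have h1 : ∑' e, {ω | Stuck T L (support b) (m e) ω}.indicator (1 : Sample n D → ℝ≥0∞) ω =
          ⊤ := by
        have : ∀ e, {ω | Stuck T L (support b) (m e) ω}.indicator (1 : Sample n D → ℝ≥0∞) ω = 1 :=
          fun e => Set.indicator_of_mem (s := {ω | Stuck T L (support b) (m e) ω}) (hex e) _
        simp only [this]
        exact ENNReal.tsum_const_eq_top_of_ne_zero one_ne_zero
      have hy0 : 0 < y := by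
        have h2 := (h 0).2.1
        have h3 : 0 < m 0 := Nat.pos_of_ne_zero fun h0 => by
          have := (h 0).1
          rw [h0] at this
          omega
        have : (0 : ℝ) < m 0 := by exact_mod_cast h3
        push_cast at h2
        linarith
      rw [h1, add_top, ENNReal.mul_top (by simpa using hy0)]
      exact le_top
  have hsum : Summable fun e => a * θ ^ e := (summable_geometric_of_lt_one hθ hθ1).mul_left a
  calc ∫⁻ ω, (minMeasurements T w hLD b ω : ℝ≥0∞) ∂seedLaw n D
      ≤ ∫⁻ ω, ENNReal.ofReal y *
        (1 + ∑' e, {ω | Stuck T L (support b) (m e) ω}.indicator 1 ω) ∂seedLaw n D :=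
        lintegral_mono hpt
    _ = ENNReal.ofReal y *
        (1 + ∑' e, seedLaw n D {ω | Stuck T L (support b) (m e) ω}) := by
        have hm' : Measurable fun ω : Sample n D =>
            ∑' e, {ω | Stuck T L (support b) (m e) ω}.indicator (1 : Sample n D → ℝ≥0∞) ω :=
          Measurable.tsum hmeas
        rw [lintegral_const_mul _ (hm'.const_add 1),
          lintegral_add_left measurable_const, lintegral_const, measure_univ, mul_one,
          lintegral_tsum fun e => (hmeas e).aemeasurable]
        congr 2
        refine tsum_congr fun e => lintegral_indicator_one (measurableSet_stuck _)
    _ ≤ ENNReal.ofReal y * (1 + ∑' e, ENNReal.ofReal (a * θ ^ e)) := by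
        gcongr with e
        exact (h e).2.2
    _ = ENNReal.ofReal (y * (1 + a / (1 - θ))) := by
        rw [← ENNReal.ofReal_tsum_of_nonneg (fun e => by positivity) hsum, tsum_mul_left,
          tsum_geometric_of_lt_one hθ hθ1, ← ENNReal.ofReal_one,
          ← ENNReal.ofReal_add zero_le_one (mul_nonneg ha (inv_nonneg.2 (by linarith))),
          ← ENNReal.ofReal_mul hy, div_eq_mul_inv]

end Final

section OptDegree

variable {T n k : ℕ}

theorem neg_log_pos (hk : 0 < k) (hkn : k < n) : 0 < -Real.log (1 - (k : ℝ) / n) := by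
  have hk' : (0 : ℝ) < k := by exact_mod_cast hk
  have hkn' : (k : ℝ) < n := by exact_mod_cast hkn
  have hn' : (0 : ℝ) < n := by linarith
  have h1 : (k : ℝ) / n < 1 := by rwa [div_lt_one hn']
  have h2 : 0 < (k : ℝ) / n := by positivity
  linarith [Real.log_neg (by linarith : (0 : ℝ) < 1 - (k : ℝ) / n) (by linarith)]

theorem optDegree_eq (T : ℕ) (s : ℝ) :
    optDegree T s = ⌈((T : ℝ) + 2) / (2 * -Real.log (1 - s))⌉₊ := by
  rw [optDegree, mul_neg, div_neg, neg_div]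

theorem optDegree_pos (hk : 0 < k) (hkn : k < n) : 0 < optDegree T ((k : ℝ) / n) := by
  have := neg_log_pos hk hkn
  rw [optDegree_eq, Nat.ceil_pos]
  positivity

/-- The lower bound `n / L` does not exceed the order of magnitude of the upper bound. -/
theorem div_optDegree_le (hk : 0 < k) (hkn : k < n) :
    (n : ℝ) / optDegree T ((k : ℝ) / n) ≤
      -(2 * n * Real.log (1 - (k : ℝ) / n)) / (T + 2) := by
  have hx := neg_log_pos hk hkn
  have hL : (0 : ℝ) < optDegree T ((k : ℝ) / n) := by exact_mod_cast optDegree_pos hk hkn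
  have h1 : ((T : ℝ) + 2) / (2 * -Real.log (1 - (k : ℝ) / n)) ≤ optDegree T ((k : ℝ) / n) := by
    rw [optDegree_eq]
    exact Nat.le_ceil _
  rw [div_le_iff₀ (by positivity)] at h1
  rw [div_le_div_iff₀ hL (by positivity)]
  have : (0 : ℝ) ≤ n := Nat.cast_nonneg n
  nlinarith

theorem admissible_optDegree (hT : 1 ≤ T) (hk : 0 < k) (hkn : k < n)
    (hLn : optDegree T ((k : ℝ) / n) ≤ n) (hTL : T < optDegree T ((k : ℝ) / n)) (hTk : T < k) :
    Admissible T n (optDegree T ((k : ℝ) / n)) k := by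
  refine ⟨hT, hTL, hLn, hTk, hkn, ?_⟩
  have hx := neg_log_pos hk hkn
  have hk' : (0 : ℝ) < k := by exact_mod_cast hk
  have hkn' : (k : ℝ) < n := by exact_mod_cast hkn
  have hn' : (0 : ℝ) < n := by linarith
  -- `2 y / (2 + y) ≤ log (1 + y)` for `y = k / (n - k)`
  have h2 : 2 * (k : ℝ) / (2 * n - k) ≤ -Real.log (1 - (k : ℝ) / n) := by
    have h3 := Real.le_log_one_add_of_nonneg (x := (k : ℝ) / (n - k))
      (div_nonneg hk'.le (by linarith))
    have h4 : 1 + (k : ℝ) / (n - k) = (1 - (k : ℝ) / n)⁻¹ := by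
      have : (n : ℝ) - k ≠ 0 := by linarith
      field_simp
      ring
    have h5 : 2 * ((k : ℝ) / (n - k)) / (k / (n - k) + 2) = 2 * k / (2 * n - k) := by
      have h6 : (0 : ℝ) < n - k := by linarith
      have h7 : (0 : ℝ) < 2 * n - k := by linarith
      have h8 : (k : ℝ) / (n - k) + 2 = (2 * n - k) / (n - k) := by
        field_simp
        ring
      rw [h8]
      field_simp
    rw [h4, Real.log_inv, h5] at h3
    exact h3
  have h6 : (optDegree T ((k : ℝ) / n) : ℝ) - 1 <
      ((T : ℝ) + 2) / (2 * -Real.log (1 - (k : ℝ) / n)) := by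
    rw [optDegree_eq]
    linarith [Nat.ceil_lt_add_one
      (by positivity : 0 ≤ ((T : ℝ) + 2) / (2 * -Real.log (1 - (k : ℝ) / n)))]
  rw [lt_div_iff₀ (by positivity)] at h6
  have h7 : (0 : ℝ) < 2 * n - k := by linarith
  rw [div_le_iff₀ h7] at h2
  have h8 : (0 : ℝ) ≤ (optDegree T ((k : ℝ) / n) : ℝ) - 1 := by
    have : (1 : ℝ) ≤ optDegree T ((k : ℝ) / n) := by exact_mod_cast optDegree_pos hk hkn
    linarith
  have h9 := mul_le_mul_of_nonneg_left h2 h8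
  have h10 := mul_lt_mul_of_pos_right h6 h7
  nlinarith

theorem exists_cover {L : ℕ} (hL0 : 0 < L) (hL : L ≤ n) :
    ∃ m : ℕ, n ≤ m * L ∧ (m : ℝ) ≤ 2 * (n / L) := by
  have hL' : (0 : ℝ) < L := by exact_mod_cast hL0
  have hc := Nat.div_add_mod n L
  have hlt := Nat.mod_lt n hL0
  refine ⟨n / L + 1, ?_, ?_⟩
  · rw [add_mul, one_mul, mul_comm]; omega
  · have h1 : 1 ≤ (n : ℝ) / L := by rw [one_le_div hL']; exact_mod_cast hL
    have h2 : ((n / L : ℕ) : ℝ) ≤ (n : ℝ) / L := Nat.cast_div_le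
    push_cast
    linarith

end OptDegree

end AFCS

end

theorem lemma3 :
    ∃ C : ℝ, 0 < C ∧ ∀ T : ℕ, 1 ≤ T →
      (∀ (n k D : ℕ) (w : Fin D → ℝ) (b : Fin n → ℝ), 0 < k → k < n →
        AFCS.optDegree T ((k : ℝ) / n) ≤ n →
        ∀ hLD : AFCS.optDegree T ((k : ℝ) / n) ≤ D,
        AFCS.UniquelyDecodable w → AFCS.IsBinarySignal k b →
          (∀ ω : AFCS.Sample n D,
            (n : ℝ≥0∞) / (AFCS.optDegree T ((k : ℝ) / n) : ℝ≥0∞) ≤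
              (AFCS.minMeasurements T w hLD b ω : ℝ≥0∞)) ∧
          ∫⁻ ω, (AFCS.minMeasurements T w hLD b ω : ℝ≥0∞) ∂(AFCS.seedLaw n D) ≤
            ENNReal.ofReal (C * (-(2 * n * Real.log (1 - (k : ℝ) / n)) / (T + 2)))) ∧
      (∀ ε : ℝ, 0 < ε → ∃ K : ℕ,
        ∀ (n k D : ℕ) (w : Fin D → ℝ) (b : Fin n → ℝ), K ≤ k → 0 < k → k < n →
        AFCS.optDegree T ((k : ℝ) / n) ≤ n →
        ∀ hLD : AFCS.optDegree T ((k : ℝ) / n) ≤ D,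
        AFCS.UniquelyDecodable w → AFCS.IsBinarySignal k b →
          AFCS.seedLaw n D {ω |
            ENNReal.ofReal (C * (-(2 * n * Real.log (1 - (k : ℝ) / n)) / (T + 2))) <
              (AFCS.minMeasurements T w hLD b ω : ℝ≥0∞)} ≤ ENNReal.ofReal ε) := by
  obtain ⟨B, a, θ, hB, ha, hθ, hθ1, hstuck⟩ := AFCS.exists_measure_stuck_le
  obtain ⟨B', hB', htail⟩ := AFCS.exists_measure_stuck_le_of_sparsity
  have hBa : 0 < B * (1 + a / (1 - θ)) := by
    have : 0 ≤ a / (1 - θ) := div_nonneg ha (by linarith)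
    positivity
  refine ⟨2 + B * (1 + a / (1 - θ)) + B', by positivity, fun T hT => ⟨?_, fun ε hε => ?_⟩⟩
  · intro n k D w b hk hkn hLn hLD hw hb
    have hn0 : 0 < n := by omega
    have hcard : (AFCS.support b).card = k := hb.2
    have hL0 := AFCS.optDegree_pos (T := T) hk hkn
    have hX := AFCS.div_optDegree_le (T := T) hk hkn
    set L := AFCS.optDegree T ((k : ℝ) / n)
    set X := -(2 * n * Real.log (1 - (k : ℝ) / n)) / ((T : ℝ) + 2)
    have hnL : (0 : ℝ) ≤ (n : ℝ) / L := by positivity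
    refine ⟨fun ω => AFCS.div_le_minMeasurements hw hLn b, ?_⟩
    by_cases htriv : L ≤ T ∨ k ≤ T
    · obtain ⟨m, hm, hmX⟩ := AFCS.exists_cover hL0 hLn
      have h1 : ∀ ω : AFCS.Sample n D, (AFCS.minMeasurements T w hLD b ω : ℝ≥0∞) ≤ (m : ℝ≥0∞) := by
        intro ω
        exact_mod_cast AFCS.minMeasurements_le_of_not_stuck hb hw hLD hLn hn0 hm
          (AFCS.not_stuck_of_le hLn (by rwa [hcard]) hm)
      have hprob : IsProbabilityMeasure (AFCS.seedLaw n D) := by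
        unfold AFCS.seedLaw; infer_instance
      calc _ ≤ ∫⁻ _, (m : ℝ≥0∞) ∂(AFCS.seedLaw n D) := lintegral_mono h1
        _ = (m : ℝ≥0∞) := by simp
        _ ≤ _ := by
          rw [← ENNReal.ofReal_natCast]
          refine ENNReal.ofReal_le_ofReal ?_
          nlinarith
    · rw [not_or, not_le, not_le] at htriv
      have hadm : AFCS.Admissible T n L (AFCS.support b).card := by
        rw [hcard]
        exact AFCS.admissible_optDegree hT hk hkn hLn htriv.1 htriv.2
      obtain ⟨m, hm⟩ := hstuck (D := D) hadm
      refine (AFCS.lintegral_minMeasurements_le hb hw hLD hLn hn0 (mul_nonneg hB.le hnL) ha hθ hθ1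
        hm).trans (ENNReal.ofReal_le_ofReal ?_)
      have h1 : B * (1 + a / (1 - θ)) * (n / L) ≤ B * (1 + a / (1 - θ)) * X := by gcongr
      have h2 : 0 ≤ (2 + B') * X := mul_nonneg (by linarith) (hnL.trans hX)
      linarith
  · obtain ⟨K, hK⟩ := htail T ε hε
    refine ⟨K, fun n k D w b hKk hk hkn hLn hLD hw hb => ?_⟩
    have hn0 : 0 < n := by omega
    have hcard : (AFCS.support b).card = k := hb.2
    have hL0 := AFCS.optDegree_pos (T := T) hk hkn
    have hX := AFCS.div_optDegree_le (T := T) hk hkn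
    set L := AFCS.optDegree T ((k : ℝ) / n)
    set X := -(2 * n * Real.log (1 - (k : ℝ) / n)) / ((T : ℝ) + 2)
    have hnL : (0 : ℝ) ≤ (n : ℝ) / L := by positivity
    have hX0 : 0 ≤ X := hnL.trans hX
    have hsub : ∀ m : ℕ, n ≤ m * L → (m : ℝ) ≤ (2 + B * (1 + a / (1 - θ)) + B') * X →
        {ω : AFCS.Sample n D | ENNReal.ofReal ((2 + B * (1 + a / (1 - θ)) + B') * X) <
          (AFCS.minMeasurements T w hLD b ω : ℝ≥0∞)} ⊆
        {ω | AFCS.Stuck T L (AFCS.support b) m ω} := by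
      intro m hm hmX ω hω
      by_contra hns
      have h1 := AFCS.minMeasurements_le_of_not_stuck hb hw hLD hLn hn0 hm hns
      have h2 : (AFCS.minMeasurements T w hLD b ω : ℝ≥0∞) ≤ (m : ℝ≥0∞) := by exact_mod_cast h1
      rw [← ENNReal.ofReal_natCast] at h2
      exact absurd (h2.trans (ENNReal.ofReal_le_ofReal hmX)) (not_le.2 hω)
    by_cases htriv : L ≤ T ∨ k ≤ T
    · obtain ⟨m, hm, hmX⟩ := AFCS.exists_cover hL0 hLn
      have h1 : {ω : AFCS.Sample n D | AFCS.Stuck T L (AFCS.support b) m ω} = ∅ := by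
        ext ω
        simpa using AFCS.not_stuck_of_le hLn (by rwa [hcard]) hm
      refine (measure_mono (hsub m hm ?_)).trans ?_
      · have : 0 ≤ (B * (1 + a / (1 - θ)) + B') * X := mul_nonneg (by linarith) hX0
        linarith
      · rw [h1, measure_empty]
        exact zero_le
    · rw [not_or, not_le, not_le] at htriv
      have hadm : AFCS.Admissible T n L (AFCS.support b).card := by
        rw [hcard]
        exact AFCS.admissible_optDegree hT hk hkn hLn htriv.1 htriv.2
      obtain ⟨m, hm, hmX, hmε⟩ := hK (D := D) hadm (by rwa [hcard])
      refine (measure_mono (hsub m hm (hmX.trans ?_))).trans hmε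
      have h1 : B' * (n / L) ≤ B' * X := by gcongr
      have h2 : 0 ≤ (2 + B * (1 + a / (1 - θ))) * X := mul_nonneg (by linarith) hX0
      linarith
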